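/- **Setting.** All classical values are finite binary trees (coding bit strings, numbers, tuples and lists), and algorithms are programs over such trees and qubits (while loops, fair coins, preparation of qubits, measurement, the gates $H$, $T$, CNOT), with a step count; trees are stored as shared graphs, so that every primitive counts as one step. Let $\mathcal X=(\mathcal X_\lambda)$, $\mathcal F=(\mathcal F_\lambda)$ be plaintext and function spaces such that membership in $\mathcal X_\lambda$ and $\mathcal F_\lambda$ can be decided, and $f(x)$ computed for $f\in\mathcal F_\lambda$, $x\in\mathcal X_\lambda$, in time polynomial in $\lambda$. The parameters $\lambda,q,n$ are positive integers. An *SKFE-SKL scheme* is a tuple $(\mathsf{Setup},\mathcal{KG},\mathsf{Enc},\mathcal{Dec},\mathcal{Cert},\mathsf{Vrfy})$ with $\mathsf{Setup}(1^\lambda,1^q)\to\mathsf{msk}$, $\mathcal{KG}(\mathsf{msk},f,1^n)\to(\mathit{fsk},\mathsf{vk})$ ($\mathit{fsk}$ a quantum state with a classical part), $\mathsf{Enc}(\mathsf{msk},x)\to\mathsf{ct}$, $\mathcal{Dec}(\mathit{fsk},\mathsf{ct})$, $\mathcal{Cert}(\mathit{fsk})\to\mathsf{cert}$ (classical), $\mathsf{Vrfy}(\mathsf{vk},\mathsf{cert})\to\top/\bot$.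 Here $\mathsf{Setup},\mathsf{Enc},\mathsf{Vrfy}$ are classical probabilistic and the others quantum; $\mathsf{Setup}$ and $\mathsf{Enc}$ run in time polynomial in $\lambda,q$, and the others in time polynomial in $\lambda,q,n$ (all on honestly generated inputs, $\mathsf{Vrfy}$ for every $\mathsf{cert}$). For all $q,n$ there is a negligible $\nu$ such that for all $\lambda$, $x\in\mathcal X_\lambda$, $f\in\mathcal F_\lambda$, honest decryption gives $f(x)$, and an honest certificate is accepted, each with probability at least $1-\nu(\lambda)$. *Selective lessor security*: for every (uniform) quantum polynomial-time adversary $\mathcal A$ (the total number of steps is at most a polynomial in $\lambda$ whatever the replies), the difference between the probabilities that the following experiment outputs $1$ for $\mathsf{coin}=0$ and $\mathsf{coin}=1$ is negligible in $\lambda$. $\mathcal A$ sends $(1^q,x_0^*,x_1^*)$ with $x_0^*,x_1^*\in\mathcal X_\lambda$, and $\mathsf{msk}\leftarrow\mathsf{Setup}(1^\lambda,1^q)$. Throughout, $\mathcal A$ has classical query access to * $O_{\mathsf{Enc}}(x)$, $x\in\mathcal X_\lambda$: returns $\mathsf{Enc}(\mathsf{msk},x)$. * $O_{\mathcal{KG}}(f,1^n)$,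 $f\in\mathcal F_\lambda$, at most $q$ times: generates $(\mathit{fsk},\mathsf{vk})\leftarrow\mathcal{KG}(\mathsf{msk},f,1^n)$, returns $\mathit{fsk}$, and appends $(f,n,\mathsf{vk},\bot)$ to a list $L$. * $O_{\mathsf{Vrfy}}(f,\mathsf{cert})$: takes the first entry $(f,n,\mathsf{vk},M)$ of $L$ with function $f$ (returns $\bot$ if there is none). If $\mathsf{Vrfy}(\mathsf{vk},\mathsf{cert})=\top$ and fewer than $n$ queries to $O_{\mathsf{Enc}}$ have been made so far, it sets $M:=\top$ in this entry and returns $\top$; otherwise it returns $\bot$. $\mathcal A$ may request the challenge ciphertext once. If some entry of $L$ has $f(x_0^*)\neq f(x_1^*)$ and $M=\bot$, the experiment outputs $0$; otherwise $\mathcal A$ receives $\mathsf{Enc}(\mathsf{msk},x^*_{\mathsf{coin}})$, and from then on $O_{\mathcal{KG}}$ refuses every $f$ with $f(x_0^*)\ne f(x_1^*)$. Finally $\mathcal A$ outputs a bit, which is the output of the experiment. An *SKFE-sbSKL scheme* (static availability bound) is defined in the same way except that $\mathsf{Setup}(1^\lambda,1^q,n)$ takes the availability bound $n$, in binary, and $\mathcal{KG}(\mathsf{msk},f)$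 takes none, and that *weak optimal efficiency* is required: $\mathsf{Setup}$ and $\mathsf{Enc}$ run in time bounded by a fixed polynomial in $\lambda$, $q$, $\log n$ (the other algorithms: in $\lambda,q,n$). *Selective strong lessor security* is defined by the same experiment, except that $\mathcal A$ also declares $n$ (in binary) at the beginning, $\mathsf{msk}\leftarrow\mathsf{Setup}(1^\lambda,1^q,n)$, $O_{\mathcal{KG}}$ takes only $f$, the declared $n$ is the bound of every key, and $\mathcal A$ may query $O_{\mathcal{KG}}$ and $O_{\mathsf{Vrfy}}$ only if $\mathcal{KG}$ and $\mathsf{Vrfy}$ under $(q,n)$ run within $p(\lambda)$ steps, where $p$ is an arbitrary polynomial. **Construction.** Given an SKFE-sbSKL scheme $\mathsf{sb}$, let $\mathsf{SKL}.\mathsf{Setup}(1^\lambda,1^q)=(\mathsf{msk}_k)_{k=1}^{\lambda}$ with $\mathsf{msk}_k\leftarrow\mathsf{sb}.\mathsf{Setup}(1^\lambda,1^q,2^k)$, and $\mathsf{SKL}.\mathsf{Enc}$ outputs $(\mathsf{ct}_k)_{k=1}^{\lambda}$ with $\mathsf{ct}_k\leftarrow\mathsf{sb}.\mathsf{Enc}(\mathsf{msk}_k,x)$.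 $\mathsf{SKL}.\mathcal{KG}$ on $f,1^n$ takes the least $k\in\{1,\dots,\lambda\}$ with $n\le 2^{k}$ (so $2^{k-1}\le n\le 2^k$; $k=\lambda$ if $n>2^\lambda$), generates $(\mathit{fsk}_k,\mathsf{vk}_k)\leftarrow\mathsf{sb}.\mathcal{KG}(\mathsf{msk}_k,f)$, and outputs $(k,\mathit{fsk}_k)$ and $\mathsf{vk}_k$. $\mathsf{SKL}.\mathcal{Dec}((k,\mathit{fsk}_k),(\mathsf{ct}_j)_j)=\mathsf{sb}.\mathcal{Dec}(\mathit{fsk}_k,\mathsf{ct}_k)$, $\mathsf{SKL}.\mathcal{Cert}(k,\mathit{fsk}_k)=\mathsf{sb}.\mathcal{Cert}(\mathit{fsk}_k)$, $\mathsf{SKL}.\mathsf{Vrfy}=\mathsf{sb}.\mathsf{Vrfy}$. **Theorem.** If $\mathsf{sb}$ is an SKFE-sbSKL scheme (in particular with weak optimal efficiency) that satisfies selective strong lessor security, then $\mathsf{SKL}$ is an SKFE-SKL scheme (its algorithms run in polynomial time and it has decryption and verification correctness), with the availability bound of each key chosen at key generation, and it satisfies selective lessor security. -/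

import Mathlib

namespace KeyLeasing

/-! ## Classical data

Every classical value (security parameters, plaintexts, keys, ciphertexts, messages) is a finite
binary tree.  Bit strings, numbers, tuples and lists are coded in the usual way. -/

inductive Data where
  | nil : Data
  | cons : Data → Data → Data
  deriving DecidableEq

namespace Data

def fst : Data → Data
  | nil => nil
  | cons a _ => a

def snd : Data → Data
  | nil => nil
  | cons _ b => b

/-- The bit `false` is `nil`; every other tree counts as `true`. -/
def bit : Bool → Data
  | false => nil
  | true => cons nil nil

def ofList : List Data → Data
  | [] => nil
  | a :: l => cons a (ofList l)

def toList : Data → List Data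
  | nil => []
  | cons a b => a :: toList b

/-- Number of entries of a list; the value of a number given in unary. -/
def len : Data → ℕ
  | nil => 0
  | cons _ b => len b + 1

/-- The string `1^n`. -/
def unary (n : ℕ) : Data := ofList (List.replicate n nil)

/-- The number `n` in binary, least significant bit first. -/
def binary (n : ℕ) : Data := ofList (n.bits.map bit)

/-- The value of a number given in binary. -/
def ofBinary : Data → ℕ
  | nil => 0
  | cons b l => (if b = nil then 0 else 1) + 2 * ofBinary l

end Data

/-! ## Quantum memories -/

/-- A (not necessarily normalised) pure state of `size` qubits: `amp b` is the amplitude of the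
computational basis state labelled by the bit string `b` of length `size`. -/
structure QMem where
  size : ℕ
  amp : List Bool → ℂ
  amp_eq_zero : ∀ b : List Bool, b.length ≠ size → amp b = 0

namespace QMem

/-- The squared norm. -/
noncomputable def normSq (m : QMem) : ℝ :=
  ∑ v : Fin m.size → Bool, Complex.normSq (m.amp (List.ofFn v))

/-- The memory without qubits, with amplitude one. -/
noncomputable def empty : QMem where
  size := 0
  amp b := if b = [] then 1 else 0
  amp_eq_zero := by
    intro b hb
    rw [if_neg]
    rintro rfl
    exact hb rfl

/-- One qubit in the state `|0⟩`. -/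
noncomputable def ket0 : QMem where
  size := 1
  amp b := if b = [false] then 1 else 0
  amp_eq_zero := by
    intro b hb
    rw [if_neg]
    rintro rfl
    exact hb rfl

/-- The tensor product; the qubits of `k` follow those of `m`. -/
noncomputable def tensor (m k : QMem) : QMem where
  size := m.size + k.size
  amp b := m.amp (b.take m.size) * k.amp (b.drop m.size)
  amp_eq_zero := by
    intro b hb
    by_cases h : (b.take m.size).length = m.size
    · rw [k.amp_eq_zero, mul_zero]
      rw [List.length_take] at h
      rw [List.length_drop]
      omega
    · rw [m.amp_eq_zero _ h, zero_mul]

noncomputable def scale (z : ℂ) (m : QMem) : QMem where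
  size := m.size
  amp b := z * m.amp b
  amp_eq_zero := by
    intro b hb
    rw [m.amp_eq_zero b hb, mul_zero]

/-- The Hadamard gate on qubit `i` (no effect if there is no such qubit). -/
noncomputable def hadamard (i : ℕ) (m : QMem) : QMem where
  size := m.size
  amp b :=
    if i < m.size then
      (m.amp (b.set i false) + (if b[i]? = some true then -1 else 1) * m.amp (b.set i true)) /
        (Real.sqrt 2 : ℂ)
    else m.amp b
  amp_eq_zero := by
    intro b hb
    rw [m.amp_eq_zero (b.set i false) (by simpa using hb),
      m.amp_eq_zero (b.set i true) (by simpa using hb), m.amp_eq_zero b hb]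
    simp

/-- The gate `diag (1, exp (iπ/4))` on qubit `i` (no effect if there is no such qubit). -/
noncomputable def phase (i : ℕ) (m : QMem) : QMem where
  size := m.size
  amp b := (if b[i]? = some true then Complex.exp (Complex.I * Real.pi / 4) else 1) * m.amp b
  amp_eq_zero := by
    intro b hb
    rw [m.amp_eq_zero b hb, mul_zero]

/-- The controlled-not gate with control `i` and target `j` (no effect unless these are two
different existing qubits). -/
noncomputable def cnot (i j : ℕ) (m : QMem) : QMem where
  size := m.size
  amp b := m.amp (if i ≠ j ∧ b[i]? = some true then b.modify j not else b)
  amp_eq_zero := by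
    intro b hb
    apply m.amp_eq_zero
    split_ifs <;> simpa using hb

/-- The unnormalised state after measuring qubit `i` with outcome `o`. -/
noncomputable def project (i : ℕ) (o : Bool) (m : QMem) : QMem where
  size := m.size
  amp b := if b[i]? = some o then m.amp b else 0
  amp_eq_zero := by
    intro b hb
    rw [m.amp_eq_zero b hb, ite_self]

/-- The unnormalised state after measuring the last qubit with outcome `o` and removing it. -/
noncomputable def dropLast (o : Bool) (m : QMem) : QMem where
  size := m.size - 1
  amp b := m.amp (b ++ [o])
  amp_eq_zero := by
    intro b hb
    apply m.amp_eq_zero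
    rw [List.length_append, List.length_singleton]
    omega

end QMem

/-- A finite ensemble of classical outcomes with the quantum memory left behind.  The memories are
unnormalised: an entry `(a, m)` stands for an event of probability `m.normSq`. -/
abbrev Ens := List (Data × QMem)

namespace Ens

/-- The probability of the classical outcome `a`. -/
noncomputable def prob (e : Ens) (a : Data) : ℝ :=
  ((e.filter fun r => r.1 = a).map fun r => r.2.normSq).sum

/-- The matrix entry `(b, b')` of the part of the classical-quantum state of the ensemble that has
classical outcome `a` and `n` qubits. -/
noncomputable def density (e : Ens) (a : Data) (n : ℕ) (b b' : List Bool) : ℂ :=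
  ((e.filter fun r => r.1 = a ∧ r.2.size = n).map
    fun r => r.2.amp b * (starRingEnd ℂ) (r.2.amp b')).sum

/-- Two ensembles describe the same classical-quantum state. -/
def SameState (e e' : Ens) : Prop :=
  ∀ (a : Data) (n : ℕ) (b b' : List Bool), b.length = n → b'.length = n →
    e.density a n b b' = e'.density a n b b'

/-- Two ensembles have the same distribution of the classical outcome. -/
def SameDist (e e' : Ens) : Prop := ∀ a : Data, e.prob a = e'.prob a

/-- Sampling from a list of ensembles, independently and in the given order. -/
noncomputable def samples : List Ens → List (List Data × QMem)
  | [] => [([], QMem.empty)]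
  | e :: es => e.flatMap fun r => (samples es).map fun s => (r.1 :: s.1, r.2.tensor s.2)

end Ens

/-! ## Quantum programs with a step count

A program turns a classical value into a classical value and acts on a quantum memory.  Trees are
kept in memory as shared graphs with one node for each different subtree, so that every primitive
on classical data follows, compares or creates a bounded number of pointers; gates and measurements
address a qubit by a number in unary.  Each primitive counts as one step.  The language has
unbounded `while` loops, and coins, preparation of qubits, measurement and the universal gate set
`H`, `T`, `CNOT`. -/

inductive Prog where
  /-- return the input -/
  | id : Prog
  /-- return `nil` -/
  | zero : Prog
  | fst : Prog
  | snd : Prog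
  /-- are the two components of the input equal? -/
  | eq : Prog
  /-- run `p`, then `q` on its result -/
  | seq (p q : Prog) : Prog
  /-- run `p` and then `q` on the input; return the pair of results -/
  | pair (p q : Prog) : Prog
  /-- run `c` on the input; if this returns `true`, run `p` on the input, otherwise `q` -/
  | cond (c p q : Prog) : Prog
  /-- as long as `c` returns `true` on the current value, replace the value by the result of `p` -/
  | loop (c p : Prog) : Prog
  /-- return a fair coin -/
  | coin : Prog
  /-- return the number of qubits, in unary -/
  | size : Prog
  /-- append a qubit in state `|0⟩` -/
  | new : Prog
  | had : Prog
  | phase : Prog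
  /-- controlled-not; the input is the pair of control and target -/
  | cnot : Prog
  /-- measure a qubit and return the outcome -/
  | meas : Prog
  /-- measure and remove the last qubit and return the outcome -/
  | drop : Prog
  /-- call `p` with a fresh quantum memory, which is appended to the caller's afterwards -/
  | frame (p : Prog) : Prog

/-- One way in which a run can go: the value returned (`none` if the run was broken off), the
unnormalised quantum memory, and the number of steps. -/
structure Branch where
  val : Option Data
  mem : QMem
  cost : ℕ

namespace Branch

/-- Return in one step. -/
def done (a : Data) (m : QMem) : Branch := ⟨some a, m, 1⟩

/-- Add `n` steps. -/
def tick (n : ℕ) (r : Branch) : Branch := { r with cost := n + r.cost }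

/-- Continue every branch that has returned. -/
def bind (L : List Branch) (k : Data → QMem → List Branch) : List Branch :=
  L.flatMap fun r =>
    match r.val with
    | none => [r]
    | some a => (k a r.mem).map (tick r.cost)

/-- A loop with condition `c` and body `p`, broken off after `T` tests of the condition. -/
def loop (c p : Data → QMem → List Branch) : ℕ → Data → QMem → List Branch
  | 0, _, m => [⟨none, m, 0⟩]
  | T + 1, v, m =>
    (bind (c v m) fun a m' =>
      if a = Data.nil then [done v m'] else bind (p v m') (loop c p T)).map (tick 1)

open Classical in
/-- The branches of a measurement: outcomes of probability zero do not occur. -/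
noncomputable def measured (s : Bool → QMem) : List Branch :=
  ([false, true].filter fun o => (s o).normSq ≠ 0).map fun o => done (Data.bit o) (s o)

end Branch

namespace Prog

/-- The branches of the run of a program on a classical input and a quantum memory, where every
loop is broken off after `T` tests of its condition. -/
noncomputable def run (T : ℕ) : Prog → Data → QMem → List Branch
  | id, v, m => [Branch.done v m]
  | zero, _, m => [Branch.done Data.nil m]
  | fst, v, m => [Branch.done v.fst m]
  | snd, v, m => [Branch.done v.snd m]
  | eq, v, m => [Branch.done (Data.bit (decide (v.fst = v.snd))) m]
  | seq p q, v, m => (Branch.bind (p.run T v m) (q.run T)).map (Branch.tick 1)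
  | pair p q, v, m =>
    (Branch.bind (p.run T v m) fun a m' =>
      Branch.bind (q.run T v m') fun b m'' => [Branch.done (Data.cons a b) m'']).map (Branch.tick 1)
  | cond c p q, v, m =>
    (Branch.bind (c.run T v m) fun a m' =>
      if a = Data.nil then q.run T v m' else p.run T v m').map (Branch.tick 1)
  | loop c p, v, m => Branch.loop (c.run T) (p.run T) T v m
  | coin, _, m =>
    [false, true].map fun o => Branch.done (Data.bit o) (m.scale (1 / (Real.sqrt 2 : ℂ)))
  | size, _, m => [Branch.done (Data.unary m.size) m]
  | new, _, m => [Branch.done Data.nil (m.tensor QMem.ket0)]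
  | had, v, m => [Branch.done Data.nil (m.hadamard v.len)]
  | phase, v, m => [Branch.done Data.nil (m.phase v.len)]
  | cnot, v, m => [Branch.done Data.nil (m.cnot v.fst.len v.snd.len)]
  | meas, v, m =>
    if v.len < m.size then Branch.measured fun o => m.project v.len o
    else [Branch.done Data.nil m]
  | drop, _, m =>
    if 0 < m.size then Branch.measured fun o => m.dropLast o
    else [Branch.done Data.nil m]
  | frame p, v, m =>
    (p.run T v QMem.empty).map fun r => { r with mem := m.tensor r.mem, cost := 1 + r.cost }

/-- Whatever the coins and the measurement outcomes are, the program halts within `T` steps.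
(A run of at most `T` steps tests no loop condition more than `T` times.) -/
def HaltsIn (p : Prog) (v : Data) (m : QMem) (T : ℕ) : Prop :=
  ∀ r ∈ p.run T v m, r.val.isSome ∧ r.cost ≤ T

open Classical in
/-- The outcome of a program that halts. -/
noncomputable def out (p : Prog) (v : Data) (m : QMem) : Ens :=
  if h : ∃ T, p.HaltsIn v m T then
    (p.run (Nat.find h) v m).filterMap fun r => r.val.map fun a => (a, r.mem)
  else []

/-- The program uses no quantum operation. -/
def IsClassical : Prog → Prop
  | id | zero | fst | snd | eq | coin => True
  | size | new | had | phase | cnot | meas | drop => False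
  | seq p q | pair p q | loop p q => p.IsClassical ∧ q.IsClassical
  | cond c p q => c.IsClassical ∧ p.IsClassical ∧ q.IsClassical
  | frame p => p.IsClassical

end Prog

/-- A polynomial bound; every polynomial is below one of these. -/
def poly (c a : ℕ) : ℕ := c * a ^ c + c

/-- Negligible functions of the security parameter. -/
def Negligible (ν : ℕ → ℝ) : Prop :=
  Asymptotics.SuperpolynomialDecay Filter.atTop (fun lam : ℕ => (lam : ℝ)) ν

/-! ## Plaintext, output and function spaces -/

/-- For every security parameter `lam` a set `X lam` of plaintexts, a set `F lam` of
(descriptions of) functions, and the value `ev lam f x` of the function `f` at `x`. -/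
structure FunClass where
  X : ℕ → Set Data
  F : ℕ → Set Data
  ev : ℕ → Data → Data → Data

/-- Membership in the spaces is decidable, and the functions can be evaluated, in time polynomial
in the security parameter. -/
def FunClass.Efficient (𝓕 : FunClass) : Prop :=
  ∃ (pX pF pE : Prog) (c : ℕ), pX.IsClassical ∧ pF.IsClassical ∧ pE.IsClassical ∧
    ∀ lam : ℕ, 0 < lam →
    (∀ d : Data, pX.HaltsIn (.cons (.unary lam) d) QMem.empty (poly c lam) ∧
      ∀ r ∈ pX.out (.cons (.unary lam) d) QMem.empty, r.1 ≠ .nil ↔ d ∈ 𝓕.X lam) ∧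
    (∀ d : Data, pF.HaltsIn (.cons (.unary lam) d) QMem.empty (poly c lam) ∧
      ∀ r ∈ pF.out (.cons (.unary lam) d) QMem.empty, r.1 ≠ .nil ↔ d ∈ 𝓕.F lam) ∧
    (∀ f ∈ 𝓕.F lam, ∀ x ∈ 𝓕.X lam,
      pE.HaltsIn (.cons (.unary lam) (.cons f x)) QMem.empty (poly c lam) ∧
      ∀ r ∈ pE.out (.cons (.unary lam) (.cons f x)) QMem.empty, r.1 = 𝓕.ev lam f x)

/-! ## Schemes -/

/-- The input-output behaviour of the six algorithms of a functional encryption scheme with secure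
key leasing.  A functional decryption key consists of a classical part and a quantum memory; the
classical outcome of `kg msk f n` is the pair of the classical part of the key and the verification
key, and its quantum memory is that of the key.  The verification algorithm accepts (`⊤`) if its
outcome is not `nil`. -/
structure SKL where
  setup (lam q : ℕ) : Ens
  kg (msk f : Data) (n : ℕ) : Ens
  enc (msk x : Data) : Ens
  dec (c : Data) (φ : QMem) (ct : Data) : Ens
  cert (c : Data) (φ : QMem) : Ens
  vrfy (vk z : Data) : Ens

namespace SKL

/-- The probability that a fresh key for `f`, with availability bound `n`, decrypts a fresh
ciphertext of `x` to `y`. -/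
noncomputable def decProb (S : SKL) (lam q n : ℕ) (f x y : Data) : ℝ :=
  ((S.setup lam q).map fun s => s.2.normSq *
    ((S.kg s.1 f n).map fun k =>
      ((S.enc s.1 x).map fun e => e.2.normSq * (S.dec k.1.fst k.2 e.1).prob y).sum).sum).sum

/-- The probability that the certificate of a fresh key for `f`, with availability bound `n`, is
accepted. -/
noncomputable def vrfyProb (S : SKL) (lam q n : ℕ) (f : Data) : ℝ :=
  ((S.setup lam q).map fun s => s.2.normSq *
    ((S.kg s.1 f n).map fun k =>
      ((S.cert k.1.fst k.2).map fun z => z.2.normSq *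
        (((S.vrfy k.1.snd z.1).filter fun r => r.1 ≠ .nil).map fun r => r.2.normSq).sum).sum).sum).sum

/-- Decryption and verification correctness for the collusion bound `q` and the availability
bound `n`. -/
def CorrectAt (S : SKL) (𝓕 : FunClass) (q n : ℕ) : Prop :=
  (∃ ν : ℕ → ℝ, Negligible ν ∧ ∀ lam : ℕ, 0 < lam → ∀ x ∈ 𝓕.X lam, ∀ f ∈ 𝓕.F lam,
    1 - ν lam ≤ S.decProb lam q n f x (𝓕.ev lam f x)) ∧
  (∃ ν : ℕ → ℝ, Negligible ν ∧ ∀ lam : ℕ, 0 < lam → ∀ f ∈ 𝓕.F lam,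
    1 - ν lam ≤ S.vrfyProb lam q n f)

end SKL

/-- A tuple of six algorithms. -/
structure Algs where
  setup : Prog
  kg : Prog
  enc : Prog
  dec : Prog
  cert : Prog
  vrfy : Prog

/-- `Setup`, `Enc` and `Vrfy` are classical algorithms. -/
def Algs.Classical (S : Algs) : Prop :=
  S.setup.IsClassical ∧ S.enc.IsClassical ∧ S.vrfy.IsClassical

/-- The algorithm `p`, run on `v` and `m`, halts within `T` steps with the state `e`. -/
def Prog.Yields (p : Prog) (v : Data) (m : QMem) (T : ℕ) (e : Ens) : Prop :=
  p.HaltsIn v m T ∧ (p.out v m).SameState e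

/-- As `Yields`, for algorithms with classical output: what remains in the quantum memory is
discarded. -/
def Prog.YieldsClassical (p : Prog) (v : Data) (m : QMem) (T : ℕ) (e : Ens) : Prop :=
  p.HaltsIn v m T ∧ (p.out v m).SameDist e

/-- The behaviour is that of six polynomial-time algorithms, of which `Setup`, `Enc` and `Vrfy` are
classical: `Setup (1^lam, 1^q)` and `Enc` run in time polynomial in `lam` and `q`, and
`KG (msk, f, 1^n)`, `Dec`, `Cert` and `Vrfy` in time polynomial in `lam`, `q` and `n`. -/
def SKL.PolyTime (S : SKL) (𝓕 : FunClass) : Prop :=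
  ∃ (P : Algs) (c : ℕ), P.Classical ∧ ∀ lam q : ℕ, 0 < lam → 0 < q →
    P.setup.Yields (.cons (.unary lam) (.unary q)) QMem.empty (poly c (lam + q))
      (S.setup lam q) ∧
    ∀ s ∈ S.setup lam q,
      (∀ x ∈ 𝓕.X lam,
        P.enc.Yields (.cons s.1 x) QMem.empty (poly c (lam + q)) (S.enc s.1 x)) ∧
      ∀ f ∈ 𝓕.F lam, ∀ n : ℕ, 0 < n →
        P.kg.Yields (.cons s.1 (.cons f (.unary n))) QMem.empty (poly c (lam + q + n))
          (S.kg s.1 f n) ∧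
        ∀ k ∈ S.kg s.1 f n,
          (∀ x ∈ 𝓕.X lam, ∀ e ∈ S.enc s.1 x,
            P.dec.YieldsClassical (.cons k.1.fst e.1) k.2 (poly c (lam + q + n))
              (S.dec k.1.fst k.2 e.1)) ∧
          P.cert.YieldsClassical k.1.fst k.2 (poly c (lam + q + n)) (S.cert k.1.fst k.2) ∧
          ∀ z : Data, P.vrfy.Yields (.cons k.1.snd z) QMem.empty (poly c (lam + q + n))
            (S.vrfy k.1.snd z)

/-- An SKFE-SKL scheme (secret-key functional encryption with secure key leasing): polynomial-time
algorithms with decryption and verification correctness. -/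
def SKL.IsScheme (S : SKL) (𝓕 : FunClass) : Prop :=
  S.PolyTime 𝓕 ∧ ∀ q n : ℕ, 0 < q → 0 < n → S.CorrectAt 𝓕 q n

/-! ### Static availability bound

An SKFE-sbSKL scheme is a tuple of algorithms `Setup (1^lam, 1^q, n)`, with `n` in binary,
`KG (msk, f)`, `Enc (msk, x)`, `Dec (fsk, ct)`, `Cert fsk` and `Vrfy (vk, cert)`. -/

namespace Algs

/-- The behaviour of a scheme with static availability bound when `Setup` is given the bound `n`;
key generation takes no bound. -/
noncomputable def atBound (S : Algs) (n : ℕ) : SKL where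
  setup lam q := S.setup.out (.cons (.unary lam) (.cons (.unary q) (.binary n))) QMem.empty
  kg msk f _ := S.kg.out (.cons msk f) QMem.empty
  enc msk x := S.enc.out (.cons msk x) QMem.empty
  dec c φ ct := S.dec.out (.cons c ct) φ
  cert c φ := S.cert.out c φ
  vrfy vk z := S.vrfy.out (.cons vk z) QMem.empty

/-- Under the bounds `q` and `n`, key generation and verification run in at most `T` steps. -/
def KeyTime (S : Algs) (𝓕 : FunClass) (lam q n T : ℕ) : Prop :=
  ∀ s ∈ (S.atBound n).setup lam q, ∀ f ∈ 𝓕.F lam,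
    S.kg.HaltsIn (.cons s.1 f) QMem.empty T ∧
    ∀ k ∈ (S.atBound n).kg s.1 f n, ∀ z : Data,
      S.vrfy.HaltsIn (.cons k.1.snd z) QMem.empty T

/-- Weak optimal efficiency: `Setup` and `Enc` run in time polynomial in `lam`, `q` and `log n`. -/
def WeakOptimalEfficiency (S : Algs) (𝓕 : FunClass) : Prop :=
  ∃ c : ℕ, ∀ lam q n : ℕ, 0 < lam → 0 < q → 0 < n →
    S.setup.HaltsIn (.cons (.unary lam) (.cons (.unary q) (.binary n))) QMem.empty
      (poly c (lam + q + n.size)) ∧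
    ∀ s ∈ (S.atBound n).setup lam q, ∀ x ∈ 𝓕.X lam,
      S.enc.HaltsIn (.cons s.1 x) QMem.empty (poly c (lam + q + n.size))

/-- The other algorithms run in time polynomial in `lam`, `q` and `n`. -/
def PolyTime (S : Algs) (𝓕 : FunClass) : Prop :=
  ∃ c : ℕ, ∀ lam q n : ℕ, 0 < lam → 0 < q → 0 < n →
    S.KeyTime 𝓕 lam q n (poly c (lam + q + n)) ∧
    ∀ s ∈ (S.atBound n).setup lam q, ∀ f ∈ 𝓕.F lam, ∀ k ∈ (S.atBound n).kg s.1 f n,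
      (∀ x ∈ 𝓕.X lam, ∀ e ∈ (S.atBound n).enc s.1 x,
        S.dec.HaltsIn (.cons k.1.fst e.1) k.2 (poly c (lam + q + n))) ∧
      S.cert.HaltsIn k.1.fst k.2 (poly c (lam + q + n))

/-- An SKFE-sbSKL scheme. -/
def IsStaticScheme (S : Algs) (𝓕 : FunClass) : Prop :=
  S.Classical ∧ S.WeakOptimalEfficiency 𝓕 ∧ S.PolyTime 𝓕 ∧
    ∀ q n : ℕ, 0 < q → 0 < n → (S.atBound n).CorrectAt 𝓕 q n

end Algs

/-! ## Adversaries -/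

/-- The messages of an adversary. -/
inductive Query where
  /-- the opening message: collusion bound, declared availability bound (of no effect where the
  adversary has none to declare), and the two challenge plaintexts -/
  | start (q n : ℕ) (x₀ x₁ : Data)
  | enc (x : Data)
  /-- a key for `f` with availability bound `n` (of no effect where key generation takes none) -/
  | kg (f : Data) (n : ℕ)
  | vrfy (f z : Data)
  /-- request of the challenge ciphertext -/
  | chal
  /-- the final guess -/
  | guess (b : Bool)

namespace Query

/-- How a message is read off the output of the adversary. -/
def decode : Data → Query
  | .nil => .guess false
  | .cons t d =>
    match t.len with
    | 0 => .guess (decide (d ≠ .nil))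
    | 1 => .start d.fst.len d.snd.fst.ofBinary d.snd.snd.fst d.snd.snd.snd
    | 2 => .enc d
    | 3 => .kg d.fst d.snd.len
    | 4 => .vrfy d.fst d.snd
    | _ => .chal

/-- The time for writing the numbers in a message: `1^q` and `1^n` in unary, and the declared
bound in binary. -/
def cost : Query → ℕ
  | .start q n _ _ => q + n.size
  | .kg _ n => n
  | _ => 0

def IsGuess : Query → Prop
  | .guess _ => True
  | _ => False

end Query

/-- An adversary is a program that is run again for every message it sends.  It is run on the pair
of its classical state and the reply to its last message, and on its quantum memory, to which the
quantum part of the reply has been appended; it returns the pair of its new classical state and its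
next message.  Initially the classical state is `1^lam` and there are no qubits.

`Reach A T lam v m t`: for some replies to its messages, the adversary is about to be run on `v` and
`m` after `t` steps.  Loops are broken off after `T` tests. -/
inductive Reach (A : Prog) (T lam : ℕ) : Data → QMem → ℕ → Prop
  | start : Reach A T lam (.cons (.unary lam) .nil) QMem.empty 0
  | next {v : Data} {m : QMem} {t : ℕ} {r : Branch} {a : Data} (reply : Data) (φ : QMem) :
      Reach A T lam v m t → r ∈ A.run T v m → r.val = some a →
      ¬ (Query.decode a.snd).IsGuess → φ.normSq ≠ 0 →
      Reach A T lam (.cons a.fst reply) (r.mem.tensor φ) (t + r.cost + (Query.decode a.snd).cost)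

/-- Quantum polynomial-time adversaries: the total number of steps until the final guess, whatever
the replies, is bounded by a polynomial in the security parameter. -/
def QPT (A : Prog) : Prop :=
  ∃ c : ℕ, ∀ lam : ℕ, 0 < lam → ∀ (v : Data) (m : QMem) (t : ℕ),
    Reach A (poly c lam) lam v m t → ∀ r ∈ A.run (poly c lam) v m,
      ∃ a : Data, r.val = some a ∧ t + r.cost + (Query.decode a.snd).cost ≤ poly c lam

/-! ## The security experiments -/

/-- An entry of the list of keys given out: function, availability bound, verification key, and
whether a valid certificate has been returned. -/
structure Entry where
  f : Data
  n : ℕ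
  vk : Data
  returned : Bool

/-- Marks the first entry with function `f`. -/
def markFirst (f : Data) : List Entry → List Entry
  | [] => []
  | e :: es => if e.f = f then { e with returned := true } :: es else e :: markFirst f es

/-- The state of the challenger after the opening message. -/
structure Session where
  msk : Data
  q : ℕ
  n : ℕ
  x₀ : Data
  x₁ : Data
  keys : List Entry
  /-- number of encryption queries so far -/
  encs : ℕ
  /-- whether the challenge ciphertext has been given out -/
  challenged : Bool

/-- What distinguishes the experiments for dynamic and static availability bounds. -/
structure Game where
  /-- the scheme, under the declared availability bound -/
  scheme : ℕ → SKL
  /-- the admissible declared bounds -/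
  admissible : ℕ → Prop
  /-- the availability bound of a key, from the declared and the queried bound -/
  bound : ℕ → ℕ → ℕ
  /-- whether the key generation and verification oracles may be queried, under the collusion
  bound and the declared availability bound -/
  leasing : ℕ → ℕ → Prop

/-- A refusal (`⊥`). -/
noncomputable def refuse (σ : Session) : List (Option Session × Data × QMem) :=
  [(some σ, .nil, QMem.empty)]

/-- The reply `a`. -/
def Data.ok (a : Data) : Data := .cons .nil a

open Classical in
/-- The challenger: its new state, the classical reply and the quantum reply.  An empty list means
that the experiment ends with output `0`. -/
noncomputable def respond (G : Game) (𝓕 : FunClass) (lam : ℕ) (coin : Bool) :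
    Option Session → Query → List (Option Session × Data × QMem)
  | none, .start q n x₀ x₁ =>
    if 0 < q ∧ G.admissible n ∧ x₀ ∈ 𝓕.X lam ∧ x₁ ∈ 𝓕.X lam then
      ((G.scheme n).setup lam q).map fun s => (some ⟨s.1, q, n, x₀, x₁, [], 0, false⟩, .nil, s.2)
    else []
  | none, _ => []
  | some σ, .enc x =>
    if x ∈ 𝓕.X lam then
      ((G.scheme σ.n).enc σ.msk x).map fun e => (some { σ with encs := σ.encs + 1 }, .ok e.1, e.2)
    else refuse σ
  | some σ, .kg f n =>
    if G.leasing σ.q σ.n ∧ f ∈ 𝓕.F lam ∧ 0 < G.bound σ.n n ∧ σ.keys.length < σ.q ∧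
        (σ.challenged = true → 𝓕.ev lam f σ.x₀ = 𝓕.ev lam f σ.x₁) then
      ((G.scheme σ.n).kg σ.msk f n).map fun k =>
        (some { σ with keys := σ.keys ++ [⟨f, G.bound σ.n n, k.1.snd, false⟩] }, .ok k.1.fst, k.2)
    else refuse σ
  | some σ, .vrfy f z =>
    if G.leasing σ.q σ.n then
      match σ.keys.find? (fun e => e.f = f) with
      | none => refuse σ
      | some e =>
        ((G.scheme σ.n).vrfy e.vk z).map fun r =>
          if r.1 ≠ .nil ∧ σ.encs < e.n then
            (some { σ with keys := markFirst f σ.keys }, .ok .nil, r.2)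
          else (some σ, .nil, r.2)
    else refuse σ
  | some σ, .chal =>
    if σ.challenged then refuse σ
    else if ∀ e ∈ σ.keys, 𝓕.ev lam e.f σ.x₀ ≠ 𝓕.ev lam e.f σ.x₁ → e.returned = true then
      ((G.scheme σ.n).enc σ.msk (if coin then σ.x₁ else σ.x₀)).map fun e =>
        (some { σ with challenged := true }, .ok e.1, e.2)
    else []
  | some σ, .start _ _ _ _ => refuse σ
  | some _, .guess _ => []

/-- The probability that the experiment, continued from a state of the challenger and an input and
quantum memory of the adversary, outputs `1` after at most the given number of messages. -/
noncomputable def play (G : Game) (𝓕 : FunClass) (lam : ℕ) (coin : Bool) (A : Prog) :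
    ℕ → Option Session → Data → QMem → ENNReal
  | 0, _, _, _ => 0
  | R + 1, σ, v, m =>
    ((A.out v m).map fun o =>
      match Query.decode o.1.snd with
      | .guess b => if b then ENNReal.ofReal o.2.normSq else 0
      | msg => ((respond G 𝓕 lam coin σ msg).map fun a =>
          play G 𝓕 lam coin A R a.1 (.cons o.1.fst a.2.1) (o.2.tensor a.2.2)).sum).sum

/-- The probability that the experiment outputs `1`. -/
noncomputable def prExp (G : Game) (𝓕 : FunClass) (A : Prog) (lam : ℕ) (coin : Bool) : ENNReal :=
  ⨆ R : ℕ, play G 𝓕 lam coin A R none (.cons (.unary lam) .nil) QMem.empty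

/-- The advantage of the adversary. -/
noncomputable def adv (G : Game) (𝓕 : FunClass) (A : Prog) (lam : ℕ) : ℝ :=
  |(prExp G 𝓕 A lam false).toReal - (prExp G 𝓕 A lam true).toReal|

/-- The experiment for dynamic availability bounds: every key query comes with its own bound. -/
def SKL.game (S : SKL) : Game where
  scheme _ := S
  admissible _ := True
  bound _ n := n
  leasing _ _ := True

/-- Selective lessor security. -/
def SKL.SelectivelyLessorSecure (S : SKL) (𝓕 : FunClass) : Prop :=
  ∀ A : Prog, QPT A → Negligible (adv S.game 𝓕 A)

/-- The experiment for static availability bounds: the adversary declares a bound at the beginning,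
and may query the key generation and verification oracles only if key generation and verification
run in at most `T` steps under this bound. -/
noncomputable def Algs.game (S : Algs) (𝓕 : FunClass) (lam T : ℕ) : Game where
  scheme := S.atBound
  admissible n := 0 < n
  bound n _ := n
  leasing q n := S.KeyTime 𝓕 lam q n T

/-- Selective strong lessor security.  The time allowed for key generation and verification, if the
adversary uses their oracles, is an arbitrary polynomial. -/
def Algs.SelectivelyStrongLessorSecure (S : Algs) (𝓕 : FunClass) : Prop :=
  ∀ (A : Prog) (c : ℕ), QPT A → Negligible fun lam => adv (S.game 𝓕 lam (poly c lam)) 𝓕 A lam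

/-! ## The construction -/

/-- The instance in charge of keys with availability bound `n`, if there are `l` instances: the
least `k` in `{1, …, l}` with `n ≤ 2^k`, and `l` if there is none.  For `1 ≤ n ≤ 2^l` it satisfies
`2^(k-1) ≤ n ≤ 2^k`. -/
def level (l n : ℕ) : ℕ := min l (max 1 (Nat.clog 2 n))

/-- The scheme that runs `lam` instances of `S`, the `k`-th with static availability bound `2^k` for
`k = 1, …, lam`.  Master secret keys and ciphertexts are lists of `lam` entries.  A key with
availability bound `n` is one of the instance `k = level lam n`, together with the number `k`. -/
noncomputable def Algs.instances (S : Algs) : SKL where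
  setup lam q :=
    (Ens.samples ((List.range lam).map fun i => (S.atBound (2 ^ (i + 1))).setup lam q)).map
      fun s => (.ofList s.1, s.2)
  kg msk f n :=
    let k := level msk.toList.length n
    ((S.atBound (2 ^ k)).kg (msk.toList.getD (k - 1) .nil) f n).map
      fun r => (.cons (.cons (.unary k) r.1.fst) r.1.snd, r.2)
  enc msk x :=
    (Ens.samples (msk.toList.mapIdx fun i a => (S.atBound (2 ^ (i + 1))).enc a x)).map
      fun s => (.ofList s.1, s.2)
  dec c φ ct :=
    (S.atBound (2 ^ c.fst.len)).dec c.snd φ (ct.toList.getD (c.fst.len - 1) .nil)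
  cert c φ := S.cert.out c.snd φ
  vrfy vk z := S.vrfy.out (.cons vk z) QMem.empty

end KeyLeasing

/-! Security is a hybrid argument over the `lam` instances. In hybrid `h` the challenge ciphertext
encrypts `x₁` in its first `h` components and `x₀` in the others, so that hybrids `0` and `lam` are
the two experiments against the construction (`hybrid_zero`, `hybrid_lam`). The hybrids `i` and `i +
1` differ only in the component of the instance with static bound `2 ^ (i + 1)`. The reduction
`Reduction.adversary` declares this bound to its challenger, samples the master keys of all other
instances itself, and runs the given adversary `A` inside. The challenger's coin then decides which
of the two hybrids `A` sees (`hybridEnc_eq`, `Setting.play_eq_hybrid`).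

Efficiency: for most `i` the bound `2 ^ (i + 1)` is not polynomial. `Setup` and `Enc` stay
polynomial by weak optimal efficiency. Key generation and verification are run, or requested from
the challenger, only for keys whose bound `n` has been written in unary by `A`. The instance in
charge of such a key has static bound at most `2 * n` (`two_pow_level_le`), so its running time is
polynomial and its oracles may be queried (`Setting.leasing`).

Availability: the static challenger accepts a certificate as long as fewer than `2 ^ (i + 1)`
encryptions have been made, the simulated one only below `n ≤ 2 ^ (i + 1)`. The reduction keeps its
own list of keys and turns late acceptances into refusals. Hence a key of its instance that counts
as returned in the simulation is also marked by the challenger (`KeysRel.returned`), and a challenge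
granted in the simulation is granted by the challenger. If the simulated challenger would end the
experiment at the challenge, the reduction guesses `0`. The inequality `n ≤ 2 ^ (i + 1)` needs `n ≤
2 ^ lam`, which holds for large `lam` because `n` is polynomially bounded.

Loss: adversaries are uniform, so `i` is guessed with fair coins, uniformly below the least power of
two that is at least `lam`; the reduction guesses `0` if `i ≥ lam`. Summed over `i`, the differences
of neighbouring hybrids telescope before absolute values are taken. For large `lam` the advantage of
the reduction is therefore exactly `(1 / 2) ^ Nat.clog 2 lam` times that of `A`
(`Setting.adv_adversary`), a loss of at most `2 * lam`.

Correctness: decryption and verification depend on one of the independent instances only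
(`Ens.expect_lists`). For fixed `n` the index of this instance stays bounded as `lam` grows, so
finitely many negligible errors have to be added.

All programs are analysed exactly: `Computes`, `Framed` and `Det` record the list of outcomes with a
step bound. Classical randomness shows in the memory only as a scalar, and scalars commute with
everything and factor out. This makes it possible to compare the two experiments as equal sums
instead of up to an error. -/

namespace KeyLeasing

/-! ## Quantum memories -/

namespace QMem

theorem ext' {m k : QMem} (hs : m.size = k.size) (ha : ∀ b, m.amp b = k.amp b) : m = k := by
  cases m
  cases k
  obtain rfl : _ = _ := hs
  obtain rfl : _ = _ := funext ha
  rfl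

theorem tensor_assoc (m k l : QMem) : (m.tensor k).tensor l = m.tensor (k.tensor l) := by
  refine ext' (Nat.add_assoc _ _ _) fun b => ?_
  simp only [tensor, List.take_take, List.drop_drop, List.drop_take, mul_assoc]
  congr 3
  · rw [Nat.min_eq_left (Nat.le_add_right _ _)]
  · congr 2
    omega

theorem empty_tensor (m : QMem) : empty.tensor m = m :=
  ext' (Nat.zero_add _) fun b => by simp [tensor, empty]

theorem tensor_empty (m : QMem) : m.tensor empty = m := by
  refine ext' (Nat.add_zero _) fun b => ?_
  simp only [tensor, empty]
  by_cases h : b.length ≤ m.size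
  · rw [List.drop_of_length_le h, List.take_of_length_le h]; simp
  · rw [if_neg, mul_zero, m.amp_eq_zero b (by omega)]
    intro h'
    rw [List.drop_eq_nil_iff] at h'
    exact h h'

/-- A memory without qubits is a single amplitude. In this form the coins of classical subroutines
act on the memory of the adversary. -/
theorem tensor_eq_scale (m s : QMem) (hs : s.size = 0) : m.tensor s = m.scale (s.amp []) := by
  refine ext' (by simp [tensor, scale, hs]) fun b => ?_
  simp only [tensor, scale]
  by_cases h : b.length ≤ m.size
  · rw [List.drop_of_length_le h, List.take_of_length_le h, mul_comm]
  · rw [m.amp_eq_zero b (by omega), s.amp_eq_zero, mul_zero, mul_zero]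
    rw [List.length_drop]
    omega

/-- Scalars may change places, factors with qubits may not. This moves the ciphertext or master key
supplied by the challenger, which is sampled last, to its place in a list. -/
theorem tensor_comm_of_size {s t : QMem} (hs : s.size = 0) (ht : t.size = 0) :
    s.tensor t = t.tensor s := by
  rw [tensor_eq_scale _ _ hs, tensor_eq_scale _ _ ht]
  refine ext' (by simp [scale, hs, ht]) fun b => ?_
  simp only [scale]
  by_cases h : b = []
  · subst h; ring
  · have : b.length ≠ 0 := by simpa using h
    rw [s.amp_eq_zero b (by omega), t.amp_eq_zero b (by omega)]; ring

theorem scale_one (m : QMem) : m.scale 1 = m := ext' rfl fun b => by simp [scale]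

theorem scale_scale (z w : ℂ) (m : QMem) : (m.scale z).scale w = m.scale (w * z) :=
  ext' rfl fun b => by simp [scale, mul_assoc]

theorem tensor_scale (m k : QMem) (z : ℂ) : m.tensor (k.scale z) = (m.tensor k).scale z :=
  ext' rfl fun b => by simp only [scale, tensor]; ring

theorem scale_tensor (m k : QMem) (z : ℂ) : (m.scale z).tensor k = (m.tensor k).scale z :=
  ext' rfl fun b => by simp only [scale, tensor]; ring

theorem tensor_empty_scale (m : QMem) (z : ℂ) : m.tensor (empty.scale z) = m.scale z := by
  rw [tensor_scale, tensor_empty]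

/-- The bit strings of length `n`. -/
def bits (n : ℕ) : Finset (List Bool) :=
  Finset.univ.map ⟨fun v : Fin n → Bool => List.ofFn v, List.ofFn_injective⟩

theorem mem_bits {n : ℕ} {b : List Bool} : b ∈ bits n ↔ b.length = n := by
  simp only [bits, Finset.mem_map, Finset.mem_univ, true_and, Function.Embedding.coeFn_mk]
  constructor
  · rintro ⟨v, rfl⟩; simp
  · rintro rfl
    exact ⟨b.get, List.ofFn_get b⟩

theorem normSq_eq (m : QMem) : m.normSq = ∑ b ∈ bits m.size, Complex.normSq (m.amp b) := by
  simp [normSq, bits]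

theorem normSq_nonneg (m : QMem) : 0 ≤ m.normSq := by
  rw [normSq_eq]
  exact Finset.sum_nonneg fun b _ => Complex.normSq_nonneg _

theorem normSq_scale (z : ℂ) (m : QMem) : (m.scale z).normSq = Complex.normSq z * m.normSq := by
  simp [normSq_eq, scale, Finset.mul_sum]

theorem bits_zero : bits 0 = {[]} := by
  ext b; simp [mem_bits]

theorem bits_one : bits 1 = {[false], [true]} := by
  ext b
  rcases b with _ | ⟨_ | _, _ | ⟨y, b⟩⟩ <;> simp [mem_bits]

theorem normSq_of_size {m : QMem} (h : m.size = 0) : m.normSq = Complex.normSq (m.amp []) := by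
  rw [normSq_eq, h, bits_zero, Finset.sum_singleton]

theorem normSq_empty : empty.normSq = 1 := by
  rw [normSq_of_size rfl]; simp [empty]

theorem sum_bits_add (a c : ℕ) (F : List Bool → ℝ) :
    ∑ b ∈ bits (a + c), F b = ∑ x ∈ bits a, ∑ y ∈ bits c, F (x ++ y) := by
  rw [← Finset.sum_product']
  refine (Finset.sum_bij' (fun p _ => p.1 ++ p.2) (fun b _ => (b.take a, b.drop a))
    ?_ ?_ ?_ ?_ ?_).symm
  · rintro ⟨x, y⟩ h
    simp_all [mem_bits]
  · intro b h
    simp_all [mem_bits]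
  · rintro ⟨x, y⟩ h
    simp only [Finset.mem_product, mem_bits] at h
    simp [← h.1]
  · intro b h
    simp
  · rintro ⟨x, y⟩ h
    rfl

theorem normSq_tensor (m k : QMem) : (m.tensor k).normSq = m.normSq * k.normSq := by
  rw [normSq_eq, normSq_eq m, normSq_eq k, Finset.sum_mul_sum]
  simp only [tensor, sum_bits_add]
  refine Finset.sum_congr rfl fun x hx => Finset.sum_congr rfl fun y hy => ?_
  rw [mem_bits] at hx
  simp [← hx]

theorem normSq_ket0 : ket0.normSq = 1 := by
  rw [normSq_eq]
  simp [ket0, bits_one]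

theorem normSq_phase (i : ℕ) (m : QMem) : (m.phase i).normSq = m.normSq := by
  rw [normSq_eq, normSq_eq]
  refine Finset.sum_congr rfl fun b _ => ?_
  simp only [phase, map_mul]
  split_ifs
  · rw [Complex.normSq_eq_norm_sq,
      show Complex.I * (Real.pi : ℂ) / 4 = ((Real.pi / 4 : ℝ) : ℂ) * Complex.I by push_cast; ring,
      Complex.norm_exp_ofReal_mul_I]
    simp
  · simp

theorem modify_not_involutive (i : ℕ) (b : List Bool) : (b.modify i not).modify i not = b := by
  refine List.ext_getElem? fun j => ?_
  by_cases h : i = j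
  · subst h
    cases h : b[i]? <;> simp [h]
  · simp [h]

theorem normSq_cnot (i j : ℕ) (m : QMem) : (m.cnot i j).normSq = m.normSq := by
  rw [normSq_eq, normSq_eq]
  let g : List Bool → List Bool :=
    fun b => if i ≠ j ∧ b[i]? = some true then b.modify j not else b
  have hlen : ∀ b ∈ bits m.size, g b ∈ bits m.size := by
    intro b hb
    simp only [mem_bits, g] at hb ⊢
    split_ifs <;> simpa
  have hinv : ∀ b ∈ bits m.size, g (g b) = b := by
    intro b _
    simp only [g]
    by_cases h : i ≠ j ∧ b[i]? = some true
    -- Flipping the target leaves the control alone because `i ≠ j`. Hence the relabelling of basis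
    -- states is an involution, in particular a permutation.
    · have h' : (b.modify j not)[i]? = some true := by
        rw [List.getElem?_modify_ne _ _ h.1.symm]; exact h.2
      rw [if_pos h, if_pos ⟨h.1, h'⟩, modify_not_involutive]
    · rw [if_neg h, if_neg h]
  exact Finset.sum_bij' (fun b _ => g b) (fun b _ => g b) hlen hlen hinv hinv fun b _ => rfl

theorem sum_bits_flip (n i : ℕ) (F : List Bool → ℝ) :
    ∑ b ∈ bits n, F (b.modify i not) = ∑ b ∈ bits n, F b :=
  Finset.sum_bij' (fun b _ => b.modify i not) (fun b _ => b.modify i not)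
    (by simp [mem_bits]) (by simp [mem_bits]) (fun b _ => modify_not_involutive i b)
    (fun b _ => modify_not_involutive i b) fun b _ => rfl

theorem normSq_add_sub (x y : ℂ) :
    Complex.normSq ((x + y) / (Real.sqrt 2 : ℂ)) + Complex.normSq ((x - y) / (Real.sqrt 2 : ℂ)) =
      Complex.normSq x + Complex.normSq y := by
  rw [Complex.normSq_div, Complex.normSq_div, Complex.normSq_ofReal,
    Real.mul_self_sqrt (by norm_num)]
  simp only [Complex.normSq_apply, Complex.add_re, Complex.add_im, Complex.sub_re, Complex.sub_im]
  ring

/-- The gate mixes a basis string only with the string in which bit `i` is flipped, and on such a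
pair the parallelogram identity `normSq_add_sub` applies. Summing every pair twice avoids the choice
of a representative. -/
theorem normSq_hadamard (i : ℕ) (m : QMem) : (m.hadamard i).normSq = m.normSq := by
  by_cases hi : i < m.size
  swap
  · congr 1
    exact ext' rfl fun b => by simp [hadamard, hi]
  have h2 : ∀ k : QMem, 2 * k.normSq =
      ∑ b ∈ bits k.size, (Complex.normSq (k.amp b) + Complex.normSq (k.amp (b.modify i not))) := by
    intro k
    rw [Finset.sum_add_distrib, sum_bits_flip _ _ fun b => Complex.normSq (k.amp b), normSq_eq]
    ring
  refine mul_left_cancel₀ (two_ne_zero' ℝ) ?_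
  rw [h2, h2]
  refine Finset.sum_congr rfl fun b hb => ?_
  have hb : b.length = m.size := mem_bits.1 hb
  have hib : i < b.length := by omega
  simp only [hadamard, hi, if_true]
  have e1 : ∀ o, (b.modify i not).set i o = b.set i o := by
    intro o
    refine List.ext_getElem? fun j => ?_
    by_cases h : i = j
    · subst h; simp [List.getElem?_set]
    · simp [h]
  rw [e1, e1]
  have e3 : b = b.set i b[i] := by simp
  have e4 : b.modify i not = b.set i (!b[i]) := by
    refine List.ext_getElem? fun j => ?_
    by_cases h : i = j
    · subst h; simp [hib]
    · simp [h]
  have e5 : b[i]? = some b[i] := List.getElem?_eq_getElem hib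
  have e6 : (b.modify i not)[i]? = some (!b[i]) := by simp [e5]
  rw [e6, e5, e4]
  have e7 : m.amp b = m.amp (b.set i b[i]) := by rw [← e3]
  rw [e7]
  cases b[i]
  · simp only [Option.some.injEq, Bool.false_eq_true, if_false, one_mul, Bool.not_false,
      if_true, neg_one_mul, ← sub_eq_add_neg]
    exact normSq_add_sub _ _
  · simp only [Option.some.injEq, Bool.false_eq_true, if_false, one_mul, Bool.not_true,
      if_true, neg_one_mul, ← sub_eq_add_neg]
    rw [add_comm, normSq_add_sub, add_comm]

theorem normSq_project (i : ℕ) (m : QMem) (hi : i < m.size) :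
    (m.project i false).normSq + (m.project i true).normSq = m.normSq := by
  rw [normSq_eq, normSq_eq, normSq_eq]
  simp only [project]
  rw [← Finset.sum_add_distrib]
  refine Finset.sum_congr rfl fun b hb => ?_
  have hb : b.length = m.size := mem_bits.1 hb
  rw [List.getElem?_eq_getElem (by omega : i < b.length)]
  cases b[i] <;> simp

theorem normSq_dropLast (m : QMem) (hm : 0 < m.size) :
    (m.dropLast false).normSq + (m.dropLast true).normSq = m.normSq := by
  rw [normSq_eq m, show m.size = m.size - 1 + 1 by omega, sum_bits_add, normSq_eq, normSq_eq]
  rw [bits_one]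
  simp [dropLast, Finset.sum_add_distrib]

theorem normSq_coin (m : QMem) :
    (m.scale (1 / (Real.sqrt 2 : ℂ))).normSq + (m.scale (1 / (Real.sqrt 2 : ℂ))).normSq =
      m.normSq := by
  rw [normSq_scale, Complex.normSq_div, Complex.normSq_ofReal, Real.mul_self_sqrt (by norm_num)]
  simp
  ring

end QMem

end KeyLeasing

namespace KeyLeasing

/-! ## Runs of programs -/

namespace Branch

/-- No branch has been broken off. -/
def AllReturn (L : List Branch) : Prop := ∀ r ∈ L, r.val.isSome

@[simp] theorem tick_val (n : ℕ) (r : Branch) : (tick n r).val = r.val := rfl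
@[simp] theorem tick_mem (n : ℕ) (r : Branch) : (tick n r).mem = r.mem := rfl
@[simp] theorem tick_cost (n : ℕ) (r : Branch) : (tick n r).cost = n + r.cost := rfl

theorem allReturn_map_tick {n : ℕ} {L : List Branch} :
    AllReturn (L.map (tick n)) ↔ AllReturn L := by
  simp [AllReturn]

theorem mem_bind {L : List Branch} {k : Data → QMem → List Branch} {s : Branch} :
    s ∈ bind L k ↔ ∃ r ∈ L, (r.val = none ∧ s = r) ∨
      ∃ a, r.val = some a ∧ ∃ s' ∈ k a r.mem, tick r.cost s' = s := by
  simp only [bind, List.mem_flatMap]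
  refine exists_congr fun r => and_congr_right fun _ => ?_
  cases r.val <;> simp

theorem allReturn_bind {L : List Branch} {k : Data → QMem → List Branch} :
    AllReturn (bind L k) ↔
      AllReturn L ∧ ∀ r ∈ L, ∀ a, r.val = some a → AllReturn (k a r.mem) := by
  constructor
  · intro h
    refine ⟨fun r hr => ?_, fun r hr a ha s hs => ?_⟩
    · cases hv : r.val with
      | none =>
        have := h r (mem_bind.2 ⟨r, hr, .inl ⟨hv, rfl⟩⟩)
        rw [hv] at this
        exact this
      | some a => rfl
    · exact h (tick r.cost s) (mem_bind.2 ⟨r, hr, .inr ⟨a, ha, s, hs, rfl⟩⟩)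
  · rintro ⟨h, h'⟩ s hs
    obtain ⟨r, hr, ⟨hv, -⟩ | ⟨a, ha, s', hs', rfl⟩⟩ := mem_bind.1 hs
    · have := h r hr
      rw [hv] at this
      cases this
    · exact h' r hr a ha s' hs'

theorem bind_congr {L : List Branch} {k k' : Data → QMem → List Branch}
    (h : ∀ r ∈ L, ∀ a, r.val = some a → k a r.mem = k' a r.mem) : bind L k = bind L k' := by
  refine List.flatMap_congr fun r hr => ?_
  cases hv : r.val with
  | none => rfl
  | some a => simp only [h r hr a hv]

/-- The bound for the loops limits the rounds and also enters the runs of condition and body. Hence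
condition and body are allowed to change here, as long as they agree wherever nothing is broken off.
-/
theorem loop_mono {c p c' p' : Data → QMem → List Branch}
    (hc : ∀ v m, AllReturn (c v m) → c' v m = c v m)
    (hp : ∀ v m, AllReturn (p v m) → p' v m = p v m) :
    ∀ {N N' : ℕ}, N ≤ N' → ∀ v m, AllReturn (loop c p N v m) →
      loop c' p' N' v m = loop c p N v m := by
  intro N
  induction N with
  | zero =>
    intro N' _ v m h
    have := h ⟨none, m, 0⟩ (by simp [loop])
    cases this
  | succ N ih =>
    intro N' hN v m h
    obtain ⟨N', rfl⟩ : ∃ n, N' = n + 1 := ⟨N' - 1, by omega⟩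
    simp only [loop] at h ⊢
    rw [allReturn_map_tick, allReturn_bind] at h
    rw [hc v m h.1]
    congr 1
    refine bind_congr fun r hr a ha => ?_
    have h' := h.2 r hr a ha
    split_ifs at h' ⊢ with h0
    · rfl
    · rw [allReturn_bind] at h'
      rw [hp v _ h'.1]
      exact bind_congr fun s hs b hb => ih (by omega) _ _ (h'.2 s hs b hb)

/-- The total probability of the branches. -/
noncomputable def mass (L : List Branch) : ℝ := (L.map fun r => r.mem.normSq).sum

theorem mass_map_tick (n : ℕ) (L : List Branch) : mass (L.map (tick n)) = mass L := by
  simp [mass, Function.comp_def]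

theorem mass_bind {L : List Branch} {k : Data → QMem → List Branch}
    (h : ∀ a m, mass (k a m) = m.normSq) : mass (bind L k) = mass L := by
  induction L with
  | nil => rfl
  | cons r L ih =>
    have : bind (r :: L) k = (match r.val with
      | none => [r]
      | some a => (k a r.mem).map (tick r.cost)) ++ bind L k := rfl
    rw [this]
    unfold mass at ih ⊢
    rw [List.map_append, List.sum_append, ih, List.map_cons, List.sum_cons]
    congr 1
    cases r.val with
    | none => simp
    | some a => exact (mass_map_tick _ _).trans (h a r.mem)

theorem mass_done (a : Data) (m : QMem) : mass [done a m] = m.normSq := by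
  simp [mass, done]

theorem mass_measured (s : Bool → QMem) :
    mass (measured s) = (s false).normSq + (s true).normSq := by
  by_cases h : (s false).normSq = 0 <;> by_cases h' : (s true).normSq = 0 <;>
    simp [measured, mass, done, h, h']

theorem mass_loop {c p : Data → QMem → List Branch} (hc : ∀ v m, mass (c v m) = m.normSq)
    (hp : ∀ v m, mass (p v m) = m.normSq) :
    ∀ N v m, mass (loop c p N v m) = m.normSq := by
  intro N
  induction N with
  | zero => intro v m; simp [loop, mass]
  | succ N ih =>
    intro v m
    simp only [loop]
    rw [mass_map_tick, mass_bind, hc]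
    intro a m'
    split_ifs
    · exact mass_done _ _
    · rw [mass_bind ih, hp]

/-- Every branch of `L` has a memory in relation to `m`. -/
def Leads (ρ : QMem → QMem → Prop) (m : QMem) (L : List Branch) : Prop := ∀ r ∈ L, ρ m r.mem

section

variable {ρ : QMem → QMem → Prop}

theorem leads_map_tick {m : QMem} {n : ℕ} {L : List Branch} :
    Leads ρ m (L.map (tick n)) ↔ Leads ρ m L := by
  simp [Leads]

theorem leads_done {m k : QMem} {a : Data} : Leads ρ m [done a k] ↔ ρ m k := by
  simp [Leads, done]

theorem leads_bind (ht : ∀ m k l, ρ m k → ρ k l → ρ m l) {m : QMem} {L : List Branch}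
    {k : Data → QMem → List Branch} (hL : Leads ρ m L) (hk : ∀ a m', Leads ρ m' (k a m')) :
    Leads ρ m (bind L k) := by
  intro s hs
  obtain ⟨r, hr, ⟨hv, rfl⟩ | ⟨a, ha, s', hs', rfl⟩⟩ := mem_bind.1 hs
  · exact hL _ hr
  · exact ht _ _ _ (hL r hr) (hk a r.mem s' hs')

theorem leads_loop (hr : ∀ m, ρ m m) (ht : ∀ m k l, ρ m k → ρ k l → ρ m l)
    {c p : Data → QMem → List Branch} (hc : ∀ v m, Leads ρ m (c v m))
    (hp : ∀ v m, Leads ρ m (p v m)) : ∀ N v m, Leads ρ m (loop c p N v m) := by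
  intro N
  induction N with
  | zero => intro v m; simpa [loop, Leads] using hr m
  | succ N ih =>
    intro v m
    simp only [loop]
    rw [leads_map_tick]
    refine leads_bind ht (hc v m) fun a m' => ?_
    split_ifs
    · exact leads_done.2 (hr _)
    · exact leads_bind ht (hp v m') ih

end

/-- Multiply the memory by a scalar. -/
noncomputable def scale (z : ℂ) (r : Branch) : Branch := { r with mem := r.mem.scale z }

theorem map_tick_scale (z : ℂ) (n : ℕ) (L : List Branch) :
    (L.map (scale z)).map (tick n) = (L.map (tick n)).map (scale z) := by
  simp [scale, tick, Function.comp_def]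

theorem bind_scale {z : ℂ} {L : List Branch} {k : Data → QMem → List Branch}
    (hk : ∀ a m, k a (m.scale z) = (k a m).map (scale z)) :
    bind (L.map (scale z)) k = (bind L k).map (scale z) := by
  simp only [bind, List.flatMap_map, List.map_flatMap]
  refine List.flatMap_congr fun r _ => ?_
  cases hv : r.val with
  | none => simp [scale, hv]
  | some a =>
    have : (scale z r).val = some a := hv
    rw [this]
    simp only [← map_tick_scale]
    rw [← hk]
    rfl

theorem loop_scale {z : ℂ} {c p : Data → QMem → List Branch}
    (hc : ∀ v m, c v (m.scale z) = (c v m).map (scale z))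
    (hp : ∀ v m, p v (m.scale z) = (p v m).map (scale z)) :
    ∀ N v m, loop c p N v (m.scale z) = (loop c p N v m).map (scale z) := by
  intro N
  induction N with
  | zero => intro v m; rfl
  | succ N ih =>
    intro v m
    simp only [loop]
    rw [hc, bind_scale, map_tick_scale]
    intro a m'
    split_ifs
    · rfl
    · rw [hp, bind_scale ih]

theorem measured_scale {z : ℂ} (hz : z ≠ 0) (s : Bool → QMem) :
    measured (fun o => (s o).scale z) = (measured s).map (scale z) := by
  simp only [measured, QMem.normSq_scale, List.map_map]
  have : ∀ o, Complex.normSq z * (s o).normSq ≠ 0 ↔ (s o).normSq ≠ 0 := by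
    intro o; simp [hz]
  simp only [this]
  rfl

end Branch

open Branch

namespace Prog

/-- A run that is not broken off does not depend on the bound for the loops. -/
theorem run_mono {T T' : ℕ} (hT : T ≤ T') (p : Prog) :
    ∀ v m, AllReturn (p.run T v m) → p.run T' v m = p.run T v m := by
  induction p with
  | seq p q ihp ihq =>
    intro v m h
    simp only [run] at h ⊢
    rw [allReturn_map_tick, allReturn_bind] at h
    rw [ihp v m h.1]
    exact congrArg _ (bind_congr fun r hr a ha => ihq _ _ (h.2 r hr a ha))
  | pair p q ihp ihq =>
    intro v m h
    simp only [run] at h ⊢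
    rw [allReturn_map_tick, allReturn_bind] at h
    rw [ihp v m h.1]
    refine congrArg _ (bind_congr fun r hr a ha => ?_)
    have h' := h.2 r hr a ha
    rw [allReturn_bind] at h'
    rw [ihq _ _ h'.1]
  | cond c p q ihc ihp ihq =>
    intro v m h
    simp only [run] at h ⊢
    rw [allReturn_map_tick, allReturn_bind] at h
    rw [ihc v m h.1]
    refine congrArg _ (bind_congr fun r hr a ha => ?_)
    have h' := h.2 r hr a ha
    split_ifs at h' ⊢ with h0
    · exact ihq _ _ h'
    · exact ihp _ _ h'
  | loop c p ihc ihp =>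
    intro v m h
    exact loop_mono ihc ihp hT v m h
  | frame p ihp =>
    intro v m h
    simp only [run] at h ⊢
    rw [ihp]
    intro r hr
    exact (h _ (List.mem_map.2 ⟨r, hr, rfl⟩) :)
  | _ => intros; rfl

/-- Gates preserve the norm, while measurements and coins split it. Branches that are broken off
keep their weight, so no assumption on halting is needed. -/
theorem mass_run (T : ℕ) (p : Prog) : ∀ v m, mass (p.run T v m) = m.normSq := by
  induction p with
  | seq p q ihp ihq =>
    intro v m
    simp only [run]
    rw [mass_map_tick, mass_bind ihq, ihp]
  | pair p q ihp ihq =>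
    intro v m
    simp only [run]
    rw [mass_map_tick, mass_bind, ihp]
    intro a m'
    rw [mass_bind fun _ _ => mass_done _ _, ihq]
  | cond c p q ihc ihp ihq =>
    intro v m
    simp only [run]
    rw [mass_map_tick, mass_bind, ihc]
    intro a m'
    split_ifs
    · exact ihq _ _
    · exact ihp _ _
  | loop c p ihc ihp => exact mass_loop ihc ihp T
  | frame p ihp =>
    intro v m
    have := ihp v QMem.empty
    simp only [run, mass, List.map_map, Function.comp_def, QMem.normSq_tensor] at this ⊢
    rw [List.sum_map_mul_left, this, QMem.normSq_empty, mul_one]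
  | coin =>
    intro v m
    have := QMem.normSq_coin m
    simpa [run, mass, done] using this
  | new => intro v m; simp [run, mass_done, QMem.normSq_tensor, QMem.normSq_ket0]
  | had => intro v m; simp [run, mass_done, QMem.normSq_hadamard]
  | phase => intro v m; simp [run, mass_done, QMem.normSq_phase]
  | cnot => intro v m; simp [run, mass_done, QMem.normSq_cnot]
  | meas =>
    intro v m
    simp only [run]
    split_ifs with h
    · rw [mass_measured, QMem.normSq_project _ _ h]
    · exact mass_done _ _
  | drop =>
    intro v m
    simp only [run]
    split_ifs with h
    · rw [mass_measured, QMem.normSq_dropLast _ h]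
    · exact mass_done _ _
  | _ => intros; exact mass_done _ _

theorem measured_ne_zero (m : QMem) (s : Bool → QMem) :
    Leads (fun m k => m.normSq ≠ 0 → k.normSq ≠ 0) m (measured s) := by
  intro r hr _
  simp only [measured, List.mem_map, List.mem_filter, decide_eq_true_eq] at hr
  obtain ⟨o, ⟨-, ho⟩, rfl⟩ := hr
  exact ho

/-- Branches of a run on a memory that does not vanish have positive probability. -/
theorem run_ne_zero (T : ℕ) (p : Prog) :
    ∀ v m, Leads (fun m k => m.normSq ≠ 0 → k.normSq ≠ 0) m (p.run T v m) := by
  have ht : ∀ m k l : QMem, (m.normSq ≠ 0 → k.normSq ≠ 0) → (k.normSq ≠ 0 → l.normSq ≠ 0) →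
      (m.normSq ≠ 0 → l.normSq ≠ 0) := by tauto
  induction p with
  | seq p q ihp ihq =>
    intro v m
    simp only [run]
    exact leads_map_tick.2 (leads_bind ht (ihp v m) ihq)
  | pair p q ihp ihq =>
    intro v m
    simp only [run]
    exact leads_map_tick.2 (leads_bind ht (ihp v m) fun a m' => leads_bind ht (ihq v m')
      fun _ _ => leads_done.2 (by tauto))
  | cond c p q ihc ihp ihq =>
    intro v m
    simp only [run]
    refine leads_map_tick.2 (leads_bind ht (ihc v m) fun a m' => ?_)
    split_ifs
    · exact ihq _ _
    · exact ihp _ _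
  | loop c p ihc ihp => exact leads_loop (by tauto) ht ihc ihp T
  | frame p ihp =>
    intro v m r hr hm
    simp only [run, List.mem_map] at hr
    obtain ⟨r, hr, rfl⟩ := hr
    rw [QMem.normSq_tensor]
    exact mul_ne_zero hm (ihp v QMem.empty r hr (by simp [QMem.normSq_empty]))
  | coin =>
    intro v m r hr hm
    simp only [run, List.mem_map] at hr
    obtain ⟨o, -, rfl⟩ := hr
    simpa [done, QMem.normSq_scale] using hm
  | new => intro v m; simp [run, leads_done, QMem.normSq_tensor, QMem.normSq_ket0]
  | had => intro v m; simp [run, leads_done, QMem.normSq_hadamard]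
  | phase => intro v m; simp [run, leads_done, QMem.normSq_phase]
  | cnot => intro v m; simp [run, leads_done, QMem.normSq_cnot]
  | meas =>
    intro v m
    simp only [run]
    split_ifs
    · exact measured_ne_zero _ _
    · exact leads_done.2 (by tauto)
  | drop =>
    intro v m
    simp only [run]
    split_ifs
    · exact measured_ne_zero _ _
    · exact leads_done.2 (by tauto)
  | _ => intro v m; exact leads_done.2 (by tauto)

/-- A coin only rescales the memory and no other classical primitive touches it. On the empty memory
a classical program therefore leaves a scalar. -/
theorem IsClassical.run_size (T : ℕ) {p : Prog} (hp : p.IsClassical) :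
    ∀ v m, Leads (fun m k => k.size = m.size) m (p.run T v m) := by
  have ht : ∀ m k l : QMem, k.size = m.size → l.size = k.size → l.size = m.size := by
    intro m k l h h'; exact h'.trans h
  induction p with
  | seq p q ihp ihq =>
    intro v m
    simp only [run]
    exact leads_map_tick.2 (leads_bind ht (ihp hp.1 v m) (ihq hp.2))
  | pair p q ihp ihq =>
    intro v m
    simp only [run]
    exact leads_map_tick.2 (leads_bind ht (ihp hp.1 v m) fun a m' =>
      leads_bind ht (ihq hp.2 v m') fun _ _ => leads_done.2 rfl)
  | cond c p q ihc ihp ihq =>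
    intro v m
    simp only [run]
    refine leads_map_tick.2 (leads_bind ht (ihc hp.1 v m) fun a m' => ?_)
    split_ifs
    · exact ihq hp.2.2 _ _
    · exact ihp hp.2.1 _ _
  | loop c p ihc ihp => exact leads_loop (ρ := fun m k => k.size = m.size) (fun _ => rfl) ht (ihc hp.1) (ihp hp.2) T
  | frame p ihp =>
    intro v m r hr
    simp only [run, List.mem_map] at hr
    obtain ⟨r, hr, rfl⟩ := hr
    have := ihp hp v QMem.empty r hr
    simp only [QMem.tensor, this]
    rfl
  | coin =>
    intro v m r hr
    simp only [run, List.mem_map] at hr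
    obtain ⟨o, -, rfl⟩ := hr
    rfl
  | id => intro v m; exact leads_done.2 rfl
  | zero => intro v m; exact leads_done.2 rfl
  | fst => intro v m; exact leads_done.2 rfl
  | snd => intro v m; exact leads_done.2 rfl
  | eq => intro v m; exact leads_done.2 rfl
  | _ => exact hp.elim

/-- Every primitive is linear in the memory. The only dependence on the norm is that measurement
outcomes of norm zero are dropped, which is why `z` must not vanish. -/
theorem run_scale {z : ℂ} (hz : z ≠ 0) (T : ℕ) (p : Prog) :
    ∀ v m, p.run T v (m.scale z) = (p.run T v m).map (Branch.scale z) := by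
  have hd : ∀ {a : Data} {m k : QMem}, k = m.scale z →
      [done a k] = [done a m].map (Branch.scale z) := by
    rintro a m _ rfl; rfl
  induction p with
  | seq p q ihp ihq =>
    intro v m
    simp only [run]
    rw [ihp, bind_scale ihq, map_tick_scale]
  | pair p q ihp ihq =>
    intro v m
    simp only [run]
    rw [ihp, bind_scale, map_tick_scale]
    intro a m'
    rw [ihq, bind_scale]
    intro b m''
    rfl
  | cond c p q ihc ihp ihq =>
    intro v m
    simp only [run]
    rw [ihc, bind_scale, map_tick_scale]
    intro a m'
    split_ifs
    · exact ihq _ _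
    · exact ihp _ _
  | loop c p ihc ihp => exact loop_scale ihc ihp T
  | frame p ihp =>
    intro v m
    simp [run, Function.comp_def, Branch.scale, QMem.scale_tensor]
  | coin =>
    intro v m
    simp [run, Branch.scale, done, QMem.scale_scale, mul_comm]
  | new => intro v m; exact hd (QMem.scale_tensor _ _ _)
  | had =>
    intro v m
    refine hd (QMem.ext' rfl fun b => ?_)
    simp only [QMem.hadamard, QMem.scale]
    by_cases h : v.len < m.size
    · simp only [h, if_true]; ring
    · simp only [h, if_false]
  | phase =>
    intro v m
    refine hd (QMem.ext' rfl fun b => ?_)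
    simp only [QMem.phase, QMem.scale]
    split_ifs <;> ring
  | cnot => intro v m; exact hd (QMem.ext' rfl fun b => rfl)
  | meas =>
    intro v m
    simp only [run]
    by_cases h : v.len < m.size
    · rw [if_pos h, if_pos (show v.len < (m.scale z).size from h), ← measured_scale hz]
      congr 1
      funext o
      refine QMem.ext' rfl fun b => ?_
      simp only [QMem.project, QMem.scale]
      split_ifs <;> simp
    · rw [if_neg h, if_neg (show ¬ v.len < (m.scale z).size from h)]
      rfl
  | drop =>
    intro v m
    simp only [run]
    by_cases h : 0 < m.size
    · rw [if_pos h, if_pos (show 0 < (m.scale z).size from h), ← measured_scale hz]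
      rfl
    · rw [if_neg h, if_neg (show ¬ 0 < (m.scale z).size from h)]
      rfl
  | _ => intro v m; rfl

/-- Replace the coins by `false`. -/
def derand : Prog → Prog
  | seq p q => seq p.derand q.derand
  | pair p q => pair p.derand q.derand
  | cond c p q => cond c.derand p.derand q.derand
  | loop c p => loop c.derand p.derand
  | frame p => frame p.derand
  | coin => zero
  | p => p

/-- The run `L` on the memory `m` has a single branch, which leaves the memory as it is and occurs
in `L'` up to the memory. -/
def Selects (m : QMem) (L L' : List Branch) : Prop :=
  ∃ val cost, L = [⟨val, m, cost⟩] ∧ ∃ r ∈ L', r.val = val ∧ r.cost = cost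

theorem selects_done (a : Data) (m m' : QMem) : Selects m [done a m] [done a m'] :=
  ⟨some a, 1, rfl, _, List.mem_singleton_self _, rfl, rfl⟩

theorem Selects.map_tick {m : QMem} {L L' : List Branch} (h : Selects m L L') (n : ℕ) :
    Selects m (L.map (tick n)) (L'.map (tick n)) := by
  obtain ⟨val, cost, rfl, r, hr, rfl, rfl⟩ := h
  exact ⟨_, _, rfl, tick n r, List.mem_map_of_mem hr, rfl, rfl⟩

theorem Selects.bind {m : QMem} {L L' : List Branch} {k k' : Data → QMem → List Branch}
    (h : Selects m L L') (hk : ∀ a m', Selects m (k a m) (k' a m')) :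
    Selects m (bind L k) (bind L' k') := by
  obtain ⟨val, cost, rfl, r, hr, rfl, rfl⟩ := h
  cases hv : r.val with
  | none => exact ⟨_, _, by simp [Branch.bind], r,
    mem_bind.2 ⟨r, hr, .inl ⟨hv, rfl⟩⟩, hv, rfl⟩
  | some a =>
    obtain ⟨val, cost, he, s, hs, rfl, rfl⟩ := hk a r.mem
    refine ⟨_, r.cost + s.cost, ?_, tick r.cost s,
      mem_bind.2 ⟨r, hr, .inr ⟨a, hv, s, hs, rfl⟩⟩, rfl, rfl⟩
    simp [Branch.bind, he, tick]

theorem selects_loop {m : QMem} {c p c' p' : Data → QMem → List Branch}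
    (hc : ∀ v m', Selects m (c v m) (c' v m')) (hp : ∀ v m', Selects m (p v m) (p' v m')) :
    ∀ N v m', Selects m (Branch.loop c p N v m) (Branch.loop c' p' N v m') := by
  intro N
  induction N with
  | zero => intro v m'; exact ⟨none, 0, rfl, _, List.mem_singleton_self _, rfl, rfl⟩
  | succ N ih =>
    intro v m'
    simp only [Branch.loop]
    refine ((hc v m').bind fun a m'' => ?_).map_tick 1
    split_ifs
    · exact selects_done _ _ _
    · exact (hp v m'').bind ih

/-- Answering every coin by `false` follows one branch of the random run, with the same value and
cost. Classical programs never read the memory, so the two runs may start from different memories.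
-/
theorem IsClassical.selects_derand (T : ℕ) {p : Prog} (hp : p.IsClassical) :
    ∀ v m m', Selects m (p.derand.run T v m) (p.run T v m') := by
  induction p with
  | seq p q ihp ihq =>
    intro v m m'
    exact ((ihp hp.1 v m m').bind fun a m'' => ihq hp.2 a m m'').map_tick 1
  | pair p q ihp ihq =>
    intro v m m'
    exact ((ihp hp.1 v m m').bind fun a m'' => (ihq hp.2 v m m'').bind fun b m3 =>
      selects_done _ _ _).map_tick 1
  | cond c p q ihc ihp ihq =>
    intro v m m'
    refine ((ihc hp.1 v m m').bind fun a m'' => ?_).map_tick 1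
    split_ifs
    · exact ihq hp.2.2 _ _ _
    · exact ihp hp.2.1 _ _ _
  | loop c p ihc ihp =>
    intro v m m'
    exact selects_loop (fun v m' => ihc hp.1 v m m') (fun v m' => ihp hp.2 v m m') T v m'
  | frame p ihp =>
    intro v m m'
    obtain ⟨val, cost, he, r, hr, rfl, rfl⟩ := ihp hp v QMem.empty QMem.empty
    simp only [derand, run, he]
    exact ⟨_, _, by simp [QMem.tensor_empty], _, List.mem_map_of_mem hr, rfl, rfl⟩
  | coin =>
    intro v m m'
    exact ⟨some .nil, 1, rfl, done (Data.bit false) (m'.scale (1 / (Real.sqrt 2 : ℂ))),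
      by simp [run], rfl, rfl⟩
  | id => intro v m m'; exact selects_done _ _ _
  | zero => intro v m m'; exact selects_done _ _ _
  | fst => intro v m m'; exact selects_done _ _ _
  | snd => intro v m m'; exact selects_done _ _ _
  | eq => intro v m m'; exact selects_done _ _ _
  | _ => exact hp.elim

theorem loop_cost_pos {c p : Data → QMem → List Branch} {N : ℕ} {v : Data} {m : QMem} {r : Branch}
    (hr : r ∈ Branch.loop c p N v m) (hv : r.val.isSome) : 1 ≤ r.cost := by
  cases N with
  | zero =>
    simp only [Branch.loop, List.mem_singleton] at hr
    subst hr
    cases hv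
  | succ N =>
    simp only [Branch.loop, List.mem_map] at hr
    obtain ⟨s, -, rfl⟩ := hr
    simp

/-- Since no run is free, the step bound of an adversary also bounds the number of its messages, and
with it the number of activations of the reduction. -/
theorem cost_pos {T : ℕ} {p : Prog} {v : Data} {m : QMem} {r : Branch} (hr : r ∈ p.run T v m)
    (hv : r.val.isSome) : 1 ≤ r.cost := by
  have ht : ∀ {L : List Branch}, r ∈ L.map (tick 1) → 1 ≤ r.cost := by
    intro L h
    obtain ⟨s, -, rfl⟩ := List.mem_map.1 h
    simp
  have hm : ∀ {s : Bool → QMem}, r ∈ measured s → 1 ≤ r.cost := by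
    intro s h
    simp only [measured, List.mem_map] at h
    obtain ⟨o, -, rfl⟩ := h
    exact le_rfl
  have hd : ∀ {a : Data} {k : QMem}, r ∈ [done a k] → 1 ≤ r.cost := by
    intro a k h
    rw [List.mem_singleton.1 h]
    exact le_rfl
  cases p with
  | seq p q => exact ht hr
  | pair p q => exact ht hr
  | cond c p q => exact ht hr
  | loop c p => exact loop_cost_pos hr hv
  | frame p =>
    simp only [run, List.mem_map] at hr
    obtain ⟨s, -, rfl⟩ := hr
    simp
  | coin =>
    simp only [run, List.mem_map] at hr
    obtain ⟨s, -, rfl⟩ := hr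
    exact le_rfl
  | meas => simp only [run] at hr; split_ifs at hr; exacts [hm hr, hd hr]
  | drop => simp only [run] at hr; split_ifs at hr; exacts [hm hr, hd hr]
  | _ => exact hd hr

/-- The outcome can be read off every run that is not broken off. -/
theorem HaltsIn.out_eq {p : Prog} {v : Data} {m : QMem} {T : ℕ} (h : p.HaltsIn v m T) :
    p.out v m = (p.run T v m).filterMap fun r => r.val.map fun a => (a, r.mem) := by
  classical
  have hex : ∃ T, p.HaltsIn v m T := ⟨T, h⟩
  rw [out, dif_pos hex,
    run_mono (Nat.find_min' hex h) p v m fun r hr => (Nat.find_spec hex r hr).1]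

theorem HaltsIn.mono {p : Prog} {v : Data} {m : QMem} {T T' : ℕ} (h : p.HaltsIn v m T)
    (hT : T ≤ T') : p.HaltsIn v m T' := by
  intro r hr
  rw [run_mono hT p v m fun r hr => (h r hr).1] at hr
  exact ⟨(h r hr).1, (h r hr).2.trans hT⟩

theorem mem_out {p : Prog} {v : Data} {m : QMem} {r : Data × QMem} (h : r ∈ p.out v m) :
    ∃ T, ∃ s ∈ p.run T v m, s.val = some r.1 ∧ s.mem = r.2 := by
  classical
  by_cases hex : ∃ T, p.HaltsIn v m T
  · obtain ⟨T, hT⟩ := hex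
    rw [hT.out_eq, List.mem_filterMap] at h
    obtain ⟨s, hs, h⟩ := h
    rw [Option.map_eq_some_iff] at h
    obtain ⟨a, ha, rfl⟩ := h
    exact ⟨T, s, hs, ha, rfl⟩
  · rw [out, dif_neg hex] at h
    cases h

theorem out_ne_zero {p : Prog} {v : Data} {m : QMem} (hm : m.normSq ≠ 0) {r : Data × QMem}
    (h : r ∈ p.out v m) : r.2.normSq ≠ 0 := by
  obtain ⟨T, s, hs, -, he⟩ := mem_out h
  rw [← he]
  exact run_ne_zero T p v m s hs hm

theorem IsClassical.out_size {p : Prog} (hp : p.IsClassical) {v : Data} {m : QMem}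
    {r : Data × QMem} (h : r ∈ p.out v m) : r.2.size = m.size := by
  obtain ⟨T, s, hs, -, he⟩ := mem_out h
  rw [← he]
  exact hp.run_size T v m s hs

theorem out_scale {z : ℂ} (hz : z ≠ 0) (p : Prog) (v : Data) (m : QMem) :
    p.out v (m.scale z) = (p.out v m).map fun r => (r.1, r.2.scale z) := by
  classical
  have hH : ∀ T, p.HaltsIn v (m.scale z) T ↔ p.HaltsIn v m T := by
    intro T
    simp [HaltsIn, run_scale hz, Branch.scale]
  by_cases h : ∃ T, p.HaltsIn v m T
  · obtain ⟨T, hT⟩ := h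
    rw [hT.out_eq, ((hH T).2 hT).out_eq, run_scale hz, List.filterMap_map, List.map_filterMap]
    refine List.filterMap_congr fun r _ => ?_
    cases h : r.val <;> simp [Branch.scale, h]
  · rw [out, out, dif_neg h, dif_neg (by simpa only [hH] using h)]
    rfl

theorem sum_filterMap_eq_mass {L : List Branch} (h : AllReturn L) :
    ((L.filterMap fun r => r.val.map fun a => (a, r.mem)).map fun r => r.2.normSq).sum =
      mass L := by
  induction L with
  | nil => rfl
  | cons r L ih =>
    have hr := h r (List.mem_cons_self ..)
    obtain ⟨a, ha⟩ := Option.isSome_iff_exists.1 hr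
    have := ih fun s hs => h s (List.mem_cons_of_mem _ hs)
    simp only [mass, List.map_cons, List.sum_cons] at this ⊢
    rw [← this, List.filterMap_cons]
    simp [ha]

/-- The outcome of a program that halts has total probability one. -/
theorem HaltsIn.mass_out {p : Prog} {v : Data} {m : QMem} {T : ℕ} (h : p.HaltsIn v m T) :
    ((p.out v m).map fun r => r.2.normSq).sum = m.normSq := by
  rw [h.out_eq, sum_filterMap_eq_mass fun r hr => (h r hr).1, mass_run]

theorem mass_out_le (p : Prog) (v : Data) (m : QMem) :
    ((p.out v m).map fun r => r.2.normSq).sum ≤ m.normSq := by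
  classical
  by_cases hex : ∃ T, p.HaltsIn v m T
  · obtain ⟨T, hT⟩ := hex
    exact hT.mass_out.le
  · rw [out, dif_neg hex]
    exact m.normSq_nonneg

end Prog

end KeyLeasing

namespace KeyLeasing

open Branch

/-! ## Calculus of program outcomes -/

namespace Branch

/-- The branches `L` return the ensemble `E`, each within `C` steps. -/
def Gives (L : List Branch) (C : ℕ) (E : Ens) : Prop :=
  List.Forall₂ (fun r s => r.val = some s.1 ∧ r.mem = s.2 ∧ r.cost ≤ C) L E

theorem Gives.mono {L : List Branch} {C C' : ℕ} {E : Ens} (h : Gives L C E) (hC : C ≤ C') :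
    Gives L C' E :=
  h.imp fun _ _ h => ⟨h.1, h.2.1, h.2.2.trans hC⟩

theorem Gives.map_tick {L : List Branch} {C : ℕ} {E : Ens} (h : Gives L C E) (n : ℕ) :
    Gives (L.map (tick n)) (n + C) E := by
  induction h with
  | nil => exact .nil
  | cons h _ ih => exact .cons ⟨h.1, h.2.1, Nat.add_le_add_left h.2.2 n⟩ ih

theorem gives_done (a : Data) (m : QMem) : Gives [done a m] 1 [(a, m)] :=
  .cons ⟨rfl, rfl, le_rfl⟩ .nil

theorem Gives.bind {L : List Branch} {C C' : ℕ} {E : Ens} {k : Data → QMem → List Branch}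
    {K : Data → QMem → Ens} (h : Gives L C E) (hk : ∀ s ∈ E, Gives (k s.1 s.2) C' (K s.1 s.2)) :
    Gives (bind L k) (C + C') (E.flatMap fun s => K s.1 s.2) := by
  induction h with
  | nil => exact .nil
  | @cons r s L E h hL ih =>
    have : Branch.bind (r :: L) k = (match r.val with
      | none => [r]
      | some a => (k a r.mem).map (tick r.cost)) ++ Branch.bind L k := rfl
    rw [this, List.flatMap_cons]
    refine List.rel_append ?_ (ih fun s hs => hk s (List.mem_cons_of_mem _ hs))
    rw [h.1, h.2.1]
    exact ((hk s (List.mem_cons_self ..)).map_tick _).mono (Nat.add_le_add_right h.2.2 _)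

theorem Gives.exists_of_mem {L : List Branch} {C : ℕ} {E : Ens} (h : Gives L C E) {r : Branch}
    (hr : r ∈ L) : ∃ s ∈ E, r.val = some s.1 ∧ r.mem = s.2 ∧ r.cost ≤ C := by
  induction h with
  | nil => cases hr
  | cons h _ ih =>
    rcases List.mem_cons.1 hr with rfl | hr
    · exact ⟨_, List.mem_cons_self .., h⟩
    · obtain ⟨s, hs, h⟩ := ih hr
      exact ⟨s, List.mem_cons_of_mem _ hs, h⟩

end Branch

namespace Ens

/-- The certain classical outcome `a`, without qubits. -/
noncomputable def pure (a : Data) : Ens := [(a, QMem.empty)]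

/-- The ensemble with its qubits appended to those of `m`. -/
noncomputable def after (m : QMem) (E : Ens) : Ens := E.map fun r => (r.1, m.tensor r.2)

/-- Continue with an ensemble that depends on the classical outcome. -/
noncomputable def bind (E : Ens) (K : Data → Ens) : Ens := E.flatMap fun r => (K r.1).after r.2

/-- Change the classical outcome. -/
noncomputable def mapVal (g : Data → Data) (E : Ens) : Ens := E.map fun r => (g r.1, r.2)

theorem after_empty (E : Ens) : E.after QMem.empty = E := by
  simp [after, QMem.empty_tensor]

theorem after_pure (m : QMem) (a : Data) : (pure a).after m = [(a, m)] := by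
  simp [after, pure, QMem.tensor_empty]

theorem after_bind (m : QMem) (E : Ens) (K : Data → Ens) :
    (E.bind K).after m = (E.after m).flatMap fun r => (K r.1).after r.2 := by
  simp only [bind, after, List.map_flatMap, List.flatMap_map]
  refine List.flatMap_congr fun r _ => ?_
  simp [QMem.tensor_assoc, Function.comp_def]

theorem pure_bind (a : Data) (K : Data → Ens) : (pure a).bind K = K a := by
  simp [bind, pure, after_empty]

theorem bind_pure (E : Ens) (g : Data → Data) : (E.bind fun a => pure (g a)) = E.mapVal g := by
  induction E with
  | nil => rfl
  | cons r E ih =>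
    simp only [bind, mapVal, List.flatMap_cons, List.map_cons] at ih ⊢
    rw [ih, after_pure]
    rfl

theorem mapVal_mapVal (g g' : Data → Data) (E : Ens) :
    (E.mapVal g).mapVal g' = E.mapVal fun a => g' (g a) := by
  simp [mapVal, Function.comp_def]

theorem after_mapVal (m : QMem) (g : Data → Data) (E : Ens) :
    (E.mapVal g).after m = (E.after m).mapVal g := by
  simp [mapVal, after, Function.comp_def]

theorem mapVal_bind (E : Ens) (K : Data → Ens) (g : Data → Data) :
    (E.bind K).mapVal g = E.bind fun a => (K a).mapVal g := by
  simp [mapVal, bind, after, List.map_flatMap, Function.comp_def]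

theorem bind_mapVal (E : Ens) (g : Data → Data) (K : Data → Ens) :
    (E.mapVal g).bind K = E.bind fun a => K (g a) := by
  simp [mapVal, bind, List.flatMap_map]

theorem mem_bind {E : Ens} {K : Data → Ens} {s : Data × QMem} :
    s ∈ E.bind K ↔ ∃ r ∈ E, ∃ t ∈ K r.1, s = (t.1, r.2.tensor t.2) := by
  simp [bind, after, eq_comm]

end Ens

namespace Prog

/-- The run of `p` on `v` and `m` takes at most `C` steps and returns the ensemble `E`. -/
def Computes (p : Prog) (v : Data) (m : QMem) (C : ℕ) (E : Ens) : Prop :=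
  ∀ T, C ≤ T → Gives (p.run T v m) C E

theorem HaltsIn.gives {p : Prog} {v : Data} {m : QMem} {C : ℕ} (h : p.HaltsIn v m C) {T : ℕ}
    (hT : C ≤ T) : Gives (p.run T v m) C (p.out v m) := by
  rw [h.out_eq, run_mono hT p v m fun r hr => (h r hr).1]
  have : ∀ L : List Branch, (∀ r ∈ L, r.val.isSome ∧ r.cost ≤ C) →
      Gives L C (L.filterMap fun r => r.val.map fun a => (a, r.mem)) := by
    intro L hL
    induction L with
    | nil => exact .nil
    | cons r L ih =>
      have hr := hL r (List.mem_cons_self ..)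
      obtain ⟨a, ha⟩ := Option.isSome_iff_exists.1 hr.1
      rw [List.filterMap_cons]
      simp only [ha, Option.map_some]
      exact .cons ⟨ha, rfl, hr.2⟩ (ih fun s hs => hL s (List.mem_cons_of_mem _ hs))
  exact this _ h

theorem HaltsIn.computes {p : Prog} {v : Data} {m : QMem} {C : ℕ} (h : p.HaltsIn v m C) :
    p.Computes v m C (p.out v m) := fun _ hT => h.gives hT

namespace Computes

variable {p q : Prog} {v : Data} {m : QMem} {C C' : ℕ} {E : Ens}

theorem haltsIn (h : p.Computes v m C E) : p.HaltsIn v m C := by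
  intro r hr
  obtain ⟨s, -, hv, -, hc⟩ := (h C le_rfl).exists_of_mem hr
  exact ⟨by rw [hv]; rfl, hc⟩

theorem out_eq (h : p.Computes v m C E) : p.out v m = E := by
  rw [h.haltsIn.out_eq]
  have hg := h C le_rfl
  clear h
  generalize p.run C v m = L at hg
  induction hg with
  | nil => rfl
  | cons h _ ih => simp [ih, h.1, h.2.1]

theorem mono (h : p.Computes v m C E) (hC : C ≤ C') : p.Computes v m C' E :=
  fun T hT => (h T (hC.trans hT)).mono hC

theorem seq {K : Data → QMem → Ens} (h : p.Computes v m C E)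
    (hq : ∀ s ∈ E, q.Computes s.1 s.2 C' (K s.1 s.2)) :
    (Prog.seq p q).Computes v m (C + C' + 1) (E.flatMap fun s => K s.1 s.2) := by
  intro T hT
  exact (((h T (by omega)).bind fun s hs => hq s hs T (by omega)).map_tick 1).mono (by omega)

end Computes

/-- Whatever the quantum memory is, `p` on `v` takes at most `C` steps and appends the ensemble
`E`. -/
def Framed (p : Prog) (v : Data) (C : ℕ) (E : Ens) : Prop := ∀ m, p.Computes v m C (E.after m)

/-- The program `p` on `v` returns `a` within `C` steps and leaves the memory as it is. -/
def Det (p : Prog) (v a : Data) (C : ℕ) : Prop := p.Framed v C (Ens.pure a)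

namespace Framed

variable {p q c : Prog} {v a : Data} {C C' C'' : ℕ} {E : Ens}

theorem mono (h : p.Framed v C E) (hC : C ≤ C') : p.Framed v C' E := fun m => (h m).mono hC

theorem computes_empty (h : p.Framed v C E) : p.Computes v QMem.empty C E := by
  simpa [Ens.after_empty] using h QMem.empty

theorem seq {K : Data → Ens} (h : p.Framed v C E) (hq : ∀ s ∈ E, q.Framed s.1 C' (K s.1)) :
    (Prog.seq p q).Framed v (C + C' + 1) (E.bind K) := by
  intro m
  rw [Ens.after_bind]
  refine Computes.seq (K := fun a k => (K a).after k) (h m) fun s hs => ?_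
  simp only [Ens.after, List.mem_map] at hs
  obtain ⟨r, hr, rfl⟩ := hs
  exact hq r hr _

theorem seq_det (h : p.Det v a C) (hq : q.Framed a C' E) :
    (Prog.seq p q).Framed v (C + C' + 1) E := by
  have := Framed.seq (q := q) (K := fun _ => E) h fun s hs => by
    obtain rfl : s = (a, QMem.empty) := by simpa [Ens.pure] using hs
    exact hq
  rwa [Ens.pure_bind] at this

theorem pair {E' : Ens} (h : p.Framed v C E) (hq : q.Framed v C' E') :
    (Prog.pair p q).Framed v (C + C' + 2) (E.bind fun a => E'.mapVal (Data.cons a)) := by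
  intro m T hT
  have h1 := (h m T (by omega)).bind
    (k := fun a m' => Branch.bind (q.run T v m') fun b m'' => [done (Data.cons a b) m''])
    (K := fun a m' => (E'.after m').flatMap fun s => [(Data.cons a s.1, s.2)]) (C' := C' + 1)
    fun s _ => (hq s.2 T (by omega)).bind (K := fun b m'' => [(Data.cons s.1 b, m'')])
      fun t _ => gives_done _ _
  have h2 := (h1.map_tick 1).mono (show 1 + (C + (C' + 1)) ≤ C + C' + 2 by omega)
  rw [Ens.after_bind]
  convert h2 using 2
  · rfl
  · funext r
    rw [Ens.after_mapVal]
    simp [Ens.mapVal, ← List.map_eq_flatMap]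

theorem pair_det_left (h : p.Det v a C) (hq : q.Framed v C' E) :
    (Prog.pair p q).Framed v (C + C' + 2) (E.mapVal (Data.cons a)) := by
  have := Framed.pair h hq
  rwa [Ens.pure_bind] at this

theorem cond_true (hc : c.Det v a C) (ha : a ≠ .nil) (hp : p.Framed v C' E) :
    (Prog.cond c p q).Framed v (C + C' + 1) E := by
  intro m T hT
  have h := hc m T (by omega)
  rw [Ens.after_pure] at h
  have := (h.bind (k := fun a m' => if a = Data.nil then q.run T v m' else p.run T v m')
    (K := fun _ k => E.after k) (C' := C') fun s hs => by
      obtain rfl := List.mem_singleton.1 hs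
      simp only [if_neg ha]
      exact hp m T (by omega)).map_tick 1
  rw [List.flatMap_singleton] at this
  exact Gives.mono this (by omega)

theorem cond_false (hc : c.Det v .nil C) (hq : q.Framed v C' E) :
    (Prog.cond c p q).Framed v (C + C' + 1) E := by
  intro m T hT
  have h := hc m T (by omega)
  rw [Ens.after_pure] at h
  have := (h.bind (k := fun a m' => if a = Data.nil then q.run T v m' else p.run T v m')
    (K := fun _ k => E.after k) (C' := C') fun s hs => by
      obtain rfl := List.mem_singleton.1 hs
      simp only [if_true]
      exact hq m T (by omega)).map_tick 1
  rw [List.flatMap_singleton] at this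
  exact Gives.mono this (by omega)

/-- An arbitrary program may look at the qubits of its caller. `frame` hides them, so that the
outcome on the empty memory determines the behaviour on every memory; for this reason subroutines of
the scheme are called through `frame`. -/
theorem frame (h : p.Computes v QMem.empty C E) : (Prog.frame p).Framed v (C + 1) E := by
  intro m T hT
  have hg := h T (by omega)
  clear h
  simp only [run]
  generalize p.run T v QMem.empty = L at hg
  induction hg with
  | nil => exact .nil
  | @cons r s _ _ h _ ih =>
    refine .cons ⟨h.1, ?_, ?_⟩ ih
    · simp [h.2.1]
    · have := h.2.2
      simp only
      omega

theorem coin : Prog.coin.Framed v 1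
    [(.nil, QMem.empty.scale (1 / (Real.sqrt 2 : ℂ))),
      (Data.bit true, QMem.empty.scale (1 / (Real.sqrt 2 : ℂ)))] := by
  intro m T hT
  simp only [run, Ens.after, List.map_cons, List.map_nil, QMem.tensor_empty_scale]
  exact .cons ⟨rfl, rfl, le_rfl⟩ (.cons ⟨rfl, rfl, le_rfl⟩ .nil)

end Framed

namespace Det

variable {p q : Prog} {v a b : Data} {C C' : ℕ}

theorem mono (h : p.Det v a C) (hC : C ≤ C') : p.Det v a C' := Framed.mono h hC

theorem seq (h : p.Det v a C) (hq : q.Det a b C') : (Prog.seq p q).Det v b (C + C' + 1) :=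
  Framed.seq_det h hq

theorem pair (h : p.Det v a C) (hq : q.Det v b C') :
    (Prog.pair p q).Det v (.cons a b) (C + C' + 2) :=
  Framed.pair_det_left h hq

end Det

theorem HaltsIn.framed {p : Prog} {v : Data} {C : ℕ} (h : p.HaltsIn v QMem.empty C) :
    (Prog.frame p).Framed v (C + 1) (p.out v QMem.empty) :=
  Framed.frame h.computes

/-! ### Programs without loops -/

/-- The program is made of operations on trees, without loops. -/
def simple : Prog → Bool
  | id | zero | fst | snd | eq => true
  | seq p q | pair p q => p.simple && q.simple
  | cond c p q => c.simple && p.simple && q.simple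
  | _ => false

/-- The function computed by a simple program. -/
def eval : Prog → Data → Data
  | fst, v => v.fst
  | snd, v => v.snd
  | eq, v => Data.bit (decide (v.fst = v.snd))
  | seq p q, v => q.eval (p.eval v)
  | pair p q, v => .cons (p.eval v) (q.eval v)
  | cond c p q, v => if c.eval v = .nil then q.eval v else p.eval v
  | id, v => v
  | _, _ => .nil

/-- A bound for the number of steps of a simple program. -/
def weight : Prog → ℕ
  | seq p q => p.weight + q.weight + 1
  | pair p q => p.weight + q.weight + 2
  | cond c p q => c.weight + (p.weight + q.weight) + 1
  | _ => 1

theorem det_eval {p : Prog} (hp : p.simple = true) : ∀ v, p.Det v (p.eval v) p.weight := by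
  have hd : ∀ (a : Data) (m : QMem), Gives [done a m] 1 ((Ens.pure a).after m) := by
    intro a m
    rw [Ens.after_pure]
    exact gives_done a m
  induction p with
  | id => intro v m T _; exact hd _ _
  | zero => intro v m T _; exact hd _ _
  | fst => intro v m T _; exact hd _ _
  | snd => intro v m T _; exact hd _ _
  | eq => intro v m T _; exact hd _ _
  | seq p q ihp ihq =>
    intro v
    simp only [simple, Bool.and_eq_true] at hp
    exact (ihp hp.1 v).seq (ihq hp.2 _)
  | pair p q ihp ihq =>
    intro v
    simp only [simple, Bool.and_eq_true] at hp
    exact (ihp hp.1 v).pair (ihq hp.2 _)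
  | cond c p q ihc ihp ihq =>
    intro v
    simp only [simple, Bool.and_eq_true] at hp
    simp only [eval, weight]
    have hc := ihc hp.1.1 v
    split_ifs with h
    · rw [h] at hc
      exact (Framed.cond_false hc (ihq hp.2 v)).mono (by omega)
    · exact (Framed.cond_true hc h (ihp hp.1.2 v)).mono (by omega)
  | _ => simp [simple] at hp

theorem det_of_eval {p : Prog} {v a : Data} (hp : p.simple = true) (h : p.eval v = a) :
    p.Det v a p.weight := h ▸ det_eval hp v

/-! ### Intermediate results -/

/-- Call `q` on the result of `arg`, and `r` on the pair of the input and the result. -/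
def call (arg q r : Prog) : Prog := seq (pair id (seq arg q)) r

namespace Framed

variable {arg q r : Prog} {v w a : Data} {C C' : ℕ} {E : Ens}

theorem call {K : Data → Ens} (harg : arg.simple = true) (hw : arg.eval v = w)
    (hq : q.Framed w C E) (hr : ∀ s ∈ E, r.Framed (.cons v s.1) C' (K s.1)) :
    (Prog.call arg q r).Framed v (arg.weight + C + C' + 5) (E.bind K) := by
  have h := (Framed.pair_det_left (det_of_eval (p := Prog.id) rfl rfl)
    (Framed.seq_det (det_of_eval harg hw) hq)).seq (q := r) (C' := C')
    (K := fun b => K b.snd) fun s hs => by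
      simp only [Ens.mapVal, List.mem_map] at hs
      obtain ⟨t, ht, rfl⟩ := hs
      exact hr t ht
  rw [Ens.bind_mapVal] at h
  exact h.mono (by simp only [weight]; omega)

theorem call_det (harg : arg.simple = true) (hw : arg.eval v = w) (hq : q.Det w a C)
    (hr : r.Framed (.cons v a) C' E) :
    (Prog.call arg q r).Framed v (arg.weight + C + C' + 5) E := by
  have := Framed.call (K := fun _ => E) harg hw hq fun s hs => by
    obtain rfl : s = (a, QMem.empty) := by simpa [Ens.pure] using hs
    exact hr
  rwa [Ens.pure_bind] at this

end Framed

/-! ### Loops -/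

/-- The loop with condition `c` and body `p` returns `E` after `n` rounds; the condition takes at
most `Cc` and the body at most `Cp` steps. -/
inductive LoopRuns (c p : Prog) (Cc Cp : ℕ) : ℕ → Data → Ens → Prop
  | last {v : Data} : c.Det v .nil Cc → LoopRuns c p Cc Cp 0 v (Ens.pure v)
  | step {n : ℕ} {v a : Data} {E : Ens} {K : Data → Ens} : c.Det v a Cc → a ≠ .nil →
      p.Framed v Cp E → (∀ r ∈ E, LoopRuns c p Cc Cp n r.1 (K r.1)) →
      LoopRuns c p Cc Cp (n + 1) v (E.bind K)

theorem LoopRuns.step_det {c p : Prog} {Cc Cp n : ℕ} {v a w : Data} {E : Ens} (hc : c.Det v a Cc)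
    (ha : a ≠ .nil) (hp : p.Det v w Cp) (h : LoopRuns c p Cc Cp n w E) :
    LoopRuns c p Cc Cp (n + 1) v E := by
  have := LoopRuns.step (K := fun _ => E) hc ha hp fun r hr => by
    obtain rfl : r = (w, QMem.empty) := by simpa [Ens.pure] using hr
    exact h
  rwa [Ens.pure_bind] at this

theorem LoopRuns.gives {c p : Prog} {Cc Cp n : ℕ} {v : Data} {E : Ens}
    (h : LoopRuns c p Cc Cp n v E) {T : ℕ} (hT : Cc ≤ T) (hT' : Cp ≤ T) :
    ∀ N, n < N → ∀ m, Gives (Branch.loop (c.run T) (p.run T) N v m)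
      ((n + 1) * (Cc + Cp + 2)) (E.after m) := by
  induction h with
  | @last v hc =>
    intro N hN m
    obtain ⟨N, rfl⟩ : ∃ k, N = k + 1 := ⟨N - 1, by omega⟩
    have h := hc m T hT
    rw [Ens.after_pure] at h
    have := (h.bind (k := fun a m' => if a = Data.nil then [done v m'] else
      Branch.bind (p.run T v m') (Branch.loop (c.run T) (p.run T) N))
      (K := fun _ k => [(v, k)]) (C' := 1) fun s hs => by
        obtain rfl := List.mem_singleton.1 hs
        simp only [if_true]
        exact gives_done _ _).map_tick 1
    rw [Ens.after_pure]
    rw [List.flatMap_singleton] at this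
    exact Gives.mono this (by omega)
  | @step n v a E K hc ha hp hK ih =>
    intro N hN m
    obtain ⟨N, rfl⟩ : ∃ k, N = k + 1 := ⟨N - 1, by omega⟩
    have h := hc m T hT
    rw [Ens.after_pure] at h
    have h2 := (hp m T hT').bind (k := Branch.loop (c.run T) (p.run T) N)
      (K := fun b k => (K b).after k) (C' := (n + 1) * (Cc + Cp + 2)) fun s hs => by
        simp only [Ens.after, List.mem_map] at hs
        obtain ⟨r, hr, rfl⟩ := hs
        exact ih r hr N (by omega) _
    have := (h.bind (k := fun a m' => if a = Data.nil then [done v m'] else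
      Branch.bind (p.run T v m') (Branch.loop (c.run T) (p.run T) N))
      (K := fun _ k => (E.after k).flatMap fun s => (K s.1).after s.2)
      (C' := Cp + (n + 1) * (Cc + Cp + 2)) fun s hs => by
        obtain rfl := List.mem_singleton.1 hs
        simp only [if_neg ha]
        exact h2).map_tick 1
    rw [Ens.after_bind]
    rw [List.flatMap_singleton] at this
    refine Gives.mono this ?_
    rw [Nat.add_mul (n + 1)]
    omega

theorem LoopRuns.framed {c p : Prog} {Cc Cp n : ℕ} {v : Data} {E : Ens}
    (h : LoopRuns c p Cc Cp n v E) :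
    (Prog.loop c p).Framed v ((n + 1) * (Cc + Cp + 2)) E := by
  intro m T hT
  -- A loop of `n` rounds tests its condition `n + 1` times. The time bound exceeds this number, and
  -- also the bounds for condition and body, so a single `T` serves for all of them.
  have h1 : n + 1 ≤ (n + 1) * (Cc + Cp + 2) := Nat.le_mul_of_pos_right _ (by omega)
  have h2 : Cc + Cp + 2 ≤ (n + 1) * (Cc + Cp + 2) := Nat.le_mul_of_pos_left _ (by omega)
  exact h.gives (by omega) (by omega) T (by omega) m

end Prog

end KeyLeasing

namespace KeyLeasing

/-! ## Operations on lists and numbers -/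

namespace Data

theorem toList_ofList (l : List Data) : (ofList l).toList = l := by
  induction l with
  | nil => rfl
  | cons a l ih => simp [ofList, toList, ih]

theorem ofList_toList (d : Data) : ofList d.toList = d := by
  induction d with
  | nil => rfl
  | cons a b _ ih => simp [ofList, toList, ih]

theorem len_ofList (l : List Data) : (ofList l).len = l.length := by
  induction l with
  | nil => rfl
  | cons a l ih => simp [ofList, len, ih]

theorem len_unary (n : ℕ) : (unary n).len = n := by simp [unary, len_ofList]

theorem unary_succ (n : ℕ) : unary (n + 1) = cons nil (unary n) := by
  simp [unary, List.replicate_succ, ofList]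

theorem unary_injective {a b : ℕ} (h : unary a = unary b) : a = b := by
  rw [← len_unary a, h, len_unary]

theorem binary_two_pow_zero : binary (2 ^ 0) = cons (cons nil nil) nil := by
  simp [binary, Nat.one_bits, ofList, bit]

theorem binary_two_pow_succ (j : ℕ) : binary (2 ^ (j + 1)) = cons nil (binary (2 ^ j)) := by
  rw [pow_succ, mul_comm]
  simp [binary, Nat.bit0_bits _ (pow_ne_zero j two_ne_zero), ofList, bit]

theorem ofBinary_binary_two_pow (j : ℕ) : (binary (2 ^ j)).ofBinary = 2 ^ j := by
  induction j with
  | zero => rw [binary_two_pow_zero]; simp [ofBinary]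
  | succ j ih => rw [binary_two_pow_succ]; simp [ofBinary, ih, pow_succ, mul_comm]

/-- The list without its first `n` entries. -/
def drop : ℕ → Data → Data
  | 0, d => d
  | n + 1, d => drop n d.snd

theorem drop_ofList (n : ℕ) (l : List Data) : (ofList l).drop n = ofList (l.drop n) := by
  induction n generalizing l with
  | zero => rfl
  | succ n ih =>
    cases l with
    | nil => exact (ih []).trans (by simp)
    | cons a l => exact ih l

theorem drop_ne_nil {n : ℕ} {d : Data} : d.drop n ≠ nil ↔ n < d.len := by
  rw [← ofList_toList d, drop_ofList, len_ofList]
  generalize d.toList = l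
  rw [← not_le, ← List.drop_eq_nil_iff]
  cases List.drop n l <;> simp [ofList]

theorem drop_unary {n k : ℕ} : (unary k).drop n = unary (k - n) := by
  rw [unary, drop_ofList, List.drop_replicate, unary]

theorem fst_drop (n : ℕ) (d : Data) : (d.drop n).fst = d.toList.getD n nil := by
  rw [← ofList_toList d, drop_ofList, toList_ofList]
  generalize d.toList = l
  rw [List.getD_eq_getElem?_getD, ← List.head?_drop]
  cases List.drop n l <;> simp [ofList, fst]

/-- The entries of `a` in reversed order, followed by those of `b`. -/
def revApp : Data → Data → Data
  | nil, b => b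
  | cons x a, b => revApp a (cons x b)

theorem revApp_ofList (l l' : List Data) :
    revApp (ofList l) (ofList l') = ofList (l.reverse ++ l') := by
  induction l generalizing l' with
  | nil => rfl
  | cons a l ih => simpa [ofList, revApp] using ih (a :: l')

theorem revApp_unary (a b : ℕ) : revApp (unary a) (unary b) = unary (a + b) := by
  simp [unary, revApp_ofList]

/-- The concatenation of two lists. -/
def append (a b : Data) : Data := revApp (revApp a nil) b

theorem append_ofList (l l' : List Data) : append (ofList l) (ofList l') = ofList (l ++ l') := by
  rw [append, show nil = ofList [] from rfl, revApp_ofList, revApp_ofList]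
  simp

theorem len_revApp (a b : Data) : (revApp a b).len = a.len + b.len := by
  rw [← ofList_toList a, ← ofList_toList b, revApp_ofList]
  simp [len_ofList]

/-- Move entries from the third list to the front of the second one, up to the first entry that
satisfies `P`. -/
def split (P : Data → Bool) : Data → Data → Data
  | pre, nil => cons pre nil
  | pre, cons x rest => if P x then cons pre (cons x rest) else split P (cons x pre) rest

end Data

namespace Prog

open Data (unary binary ofList)

theorem det_id (v : Data) : Prog.id.Det v v 1 := det_of_eval (p := Prog.id) rfl rfl

/-- The truth value `true`. -/
def tt : Prog := pair zero zero

/-- Drop as many entries of the second list as the first list has. -/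
def dropP : Prog := seq (loop fst (pair (seq fst snd) (seq snd snd))) snd

theorem dropP_det (a b : Data) : dropP.Det (.cons a b) (b.drop a.len) (20 * (a.len + 1)) := by
  have h : ∀ (a b : Data), LoopRuns fst (pair (seq fst snd) (seq snd snd)) 1 8 a.len (.cons a b)
      (Ens.pure (.cons .nil (b.drop a.len))) := by
    intro a
    induction a with
    | nil => intro b; exact .last (det_of_eval (p := fst) rfl rfl)
    | cons x a _ ih =>
      intro b
      exact .step_det (det_of_eval (p := fst) (a := .cons x a) rfl rfl) (by simp)
        (det_of_eval (p := pair (seq fst snd) (seq snd snd)) rfl rfl) (ih b.snd)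
  exact Det.mono (Framed.seq_det (h a b).framed (det_of_eval (p := snd) rfl rfl))
    (by simp only [weight]; omega)

/-- Is the first list shorter than the second one? -/
def ltP : Prog := seq dropP (cond id tt zero)

theorem ltP_det (a b : Data) :
    ltP.Det (.cons a b) (Data.bit (decide (a.len < b.len))) (20 * (a.len + 1) + 10) := by
  refine Det.mono (Det.seq (dropP_det a b) (det_of_eval (p := cond id tt zero) rfl ?_))
    (by simp only [weight, tt]; omega)
  simp only [eval, tt]
  by_cases h : a.len < b.len
  · rw [if_neg (Data.drop_ne_nil.2 h)]; simp [h, Data.bit]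
  · rw [if_pos (by simpa using (not_congr Data.drop_ne_nil).2 h)]; simp [h, Data.bit]

/-- The entry of the second list whose index is the length of the first list. -/
def nthP : Prog := seq dropP fst

theorem nthP_det (a b : Data) :
    nthP.Det (.cons a b) (b.toList.getD a.len .nil) (20 * (a.len + 1) + 2) :=
  Det.mono (Det.seq (dropP_det a b) (det_of_eval (p := fst) rfl (Data.fst_drop _ _)))
    (by simp only [weight]; omega)

/-- Move the entries of the first list to the front of the second one. -/
def revAppP : Prog := seq (loop fst (pair (seq fst snd) (pair (seq fst fst) snd))) snd

theorem revAppP_det (a b : Data) :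
    revAppP.Det (.cons a b) (a.revApp b) (20 * (a.len + 1)) := by
  have h : ∀ (a b : Data), LoopRuns fst (pair (seq fst snd) (pair (seq fst fst) snd)) 1 11
      a.len (.cons a b) (Ens.pure (.cons .nil (a.revApp b))) := by
    intro a
    induction a with
    | nil => intro b; exact .last (det_of_eval (p := fst) rfl rfl)
    | cons x a _ ih =>
      intro b
      exact .step_det (det_of_eval (p := fst) (a := .cons x a) rfl rfl) (by simp)
        (Det.mono (det_of_eval (p := pair (seq fst snd) (pair (seq fst fst) snd)) rfl rfl)
          (by simp [weight])) (ih (.cons x b))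
  exact Det.mono (Framed.seq_det (h a b).framed (det_of_eval (p := snd) rfl rfl))
    (by simp only [weight]; omega)

/-- Reverse a list. -/
def revP : Prog := seq (pair id zero) revAppP

theorem revP_det (l : List Data) :
    revP.Det (ofList l) (ofList l.reverse) (20 * (l.length + 1) + 5) := by
  have h := Det.seq (det_of_eval (p := pair id zero) (v := ofList l) rfl rfl)
    (revAppP_det (ofList l) (ofList []))
  rw [Data.revApp_ofList, List.append_nil] at h
  refine Det.mono h ?_
  simp only [weight, Data.len_ofList]
  omega

/-- Concatenate two lists. -/
def appendP : Prog := seq (pair (seq (pair fst zero) revAppP) snd) revAppP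

theorem appendP_det (a b : Data) :
    appendP.Det (.cons a b) (a.append b) (40 * (a.len + 1) + 12) := by
  have h := ((det_of_eval (p := pair fst zero) (v := .cons a b) rfl rfl).seq
    (revAppP_det a .nil)).pair (det_of_eval (p := snd) rfl rfl) |>.seq (revAppP_det _ b)
  refine Det.mono h ?_
  simp only [weight, Data.len_revApp, Data.len]
  omega

/-- Split the third list `rest` of `(key, (pre, rest))` before the first entry `x` for which the
program `t` on `(key, x)` returns `true`, and move the entries before it to `pre`. -/
def splitP (t : Prog) : Prog :=
  seq (loop (cond (seq snd snd) (cond (seq (pair fst (seq snd (seq snd fst))) t) zero tt) zero)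
    (pair fst (pair (pair (seq snd (seq snd fst)) (seq snd fst)) (seq snd (seq snd snd))))) snd

theorem splitP_det {t : Prog} (ht : t.simple = true) (key pre rest : Data) :
    (splitP t).Det (.cons key (.cons pre rest))
      (Data.split (fun x => decide (t.eval (.cons key x) ≠ .nil)) pre rest)
      ((t.weight + 60) * (rest.len + 1)) := by
  set P : Data → Bool := fun x => decide (t.eval (.cons key x) ≠ .nil) with hP
  have hs : (cond (seq snd snd) (cond (seq (pair fst (seq snd (seq snd fst))) t) zero tt)
      zero).simple = true := by simp [simple, ht, tt]
  have h : ∀ (rest pre : Data), ∃ n ≤ rest.len, LoopRuns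
      (cond (seq snd snd) (cond (seq (pair fst (seq snd (seq snd fst))) t) zero tt) zero)
      (pair fst (pair (pair (seq snd (seq snd fst)) (seq snd fst)) (seq snd (seq snd snd))))
      (t.weight + 22) 24 n (.cons key (.cons pre rest))
      (Ens.pure (.cons key (Data.split P pre rest))) := by
    intro rest
    induction rest with
    | nil =>
      intro pre
      refine ⟨0, le_rfl, .last (Det.mono (det_of_eval hs ?_) ?_)⟩
      · simp [eval, Data.snd]
      · simp [weight, tt]; omega
    | cons x rest _ ih =>
      intro pre
      by_cases hx : t.eval (.cons key x) = .nil
      · obtain ⟨n, hn, h⟩ := ih (.cons x pre)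
        have he : Data.split P pre (.cons x rest) = Data.split P (.cons x pre) rest := by
          simp [Data.split, hP, hx]
        rw [he]
        refine ⟨n + 1, Nat.succ_le_succ hn, .step_det
          (Det.mono (det_of_eval hs (a := .cons .nil .nil) ?_) ?_) (by simp)
          (Det.mono (det_of_eval (a := .cons key (.cons (.cons x pre) rest)) rfl rfl) ?_) h⟩
        · simp [eval, Data.snd, Data.fst, hx, tt]
        · simp [weight, tt]; omega
        · simp [weight]
      · have he : Data.split P pre (.cons x rest) = .cons pre (.cons x rest) := by
          simp [Data.split, hP, hx]
        rw [he]
        refine ⟨0, Nat.zero_le _, .last (Det.mono (det_of_eval hs ?_) ?_)⟩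
        · simp [eval, Data.snd, Data.fst, hx]
        · simp [weight, tt]; omega
  obtain ⟨n, hn, h⟩ := h rest pre
  refine Det.mono (Framed.seq_det h.framed (det_of_eval (p := snd) rfl rfl)) ?_
  simp only [weight]
  calc (n + 1) * (t.weight + 22 + 24 + 2) + 1 + 1
      ≤ (rest.len + 1) * (t.weight + 22 + 24 + 2) + (rest.len + 1) * 2 := by
        have := Nat.mul_le_mul_right (t.weight + 22 + 24 + 2) (Nat.succ_le_succ hn)
        simp only [Nat.succ_eq_add_one] at this
        omega
    _ = (rest.len + 1) * (t.weight + 50) := by ring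
    _ ≤ (t.weight + 60) * (rest.len + 1) := by
        rw [mul_comm]; exact Nat.mul_le_mul_right _ (by omega)

/-- Run `p` on all `(x, env)`, for the entries `x` of a list, and return the list of results. -/
def mapP (p : Prog) : Prog :=
  seq (seq (pair fst (pair zero snd))
    (loop fst (call (pair (seq fst fst) (seq snd snd)) (frame p)
      (pair (seq fst (seq fst snd))
        (pair (pair snd (seq fst (seq snd fst))) (seq fst (seq snd snd)))))))
    (seq (seq snd fst) revP)

/-- The ensemble of the lists of outcomes. -/
noncomputable def _root_.KeyLeasing.Ens.lists (es : List Ens) : Ens :=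
  (Ens.samples es).map fun s => (ofList s.1, s.2)

theorem _root_.KeyLeasing.Ens.lists_nil : Ens.lists [] = Ens.pure .nil := rfl

theorem _root_.KeyLeasing.Ens.lists_cons (e : Ens) (es : List Ens) :
    Ens.lists (e :: es) = e.bind fun a => (Ens.lists es).mapVal (Data.cons a) := by
  simp [Ens.lists, Ens.samples, Ens.bind, Ens.mapVal, Ens.after, List.map_flatMap,
    Function.comp_def, ofList]

theorem _root_.KeyLeasing.Ens.mem_lists {es : List Ens} {r : Data × QMem}
    (h : r ∈ Ens.lists es) :
    List.Forall₂ (fun a e => ∃ m, (a, m) ∈ e) r.1.toList es := by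
  induction es generalizing r with
  | nil =>
    rw [Ens.lists_nil, Ens.pure, List.mem_singleton] at h
    subst h
    exact .nil
  | cons e es ih =>
    rw [Ens.lists_cons, Ens.mem_bind] at h
    obtain ⟨s, hs, t, ht, rfl⟩ := h
    simp only [Ens.mapVal, List.mem_map] at ht
    obtain ⟨u, hu, rfl⟩ := ht
    exact .cons ⟨s.2, hs⟩ (ih hu)

/-- The list is consumed from the front, in the order in which `Ens.samples` draws, and the results
are collected in front of an accumulator that is reversed at the end. `p` needs to be known on the
empty memory only, since it is called in a frame. -/
theorem mapP_framed {p : Prog} {env : Data} {C : ℕ} {E : Data → Ens} (l : List Data)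
    (h : ∀ x ∈ l, p.Computes (.cons x env) QMem.empty C (E x)) :
    (mapP p).Framed (.cons (ofList l) env) ((C + 70) * (l.length + 2)) (Ens.lists (l.map E)) := by
  set body := call (pair (seq fst fst) (seq snd snd)) (frame p)
    (pair (seq fst (seq fst snd))
      (pair (pair snd (seq fst (seq snd fst))) (seq fst (seq snd snd)))) with hbody
  have hl : ∀ (l acc : List Data), (∀ x ∈ l, p.Computes (.cons x env) QMem.empty C (E x)) →
      LoopRuns fst body 1 (C + 40) l.length (.cons (ofList l) (.cons (ofList acc) env))
        ((Ens.lists (l.map E)).mapVal fun a =>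
          .cons .nil (.cons (a.revApp (ofList acc)) env)) := by
    intro l
    induction l with
    | nil => intro acc _; exact .last (det_of_eval (p := fst) rfl rfl)
    | cons x l ih =>
      intro acc hx
      have hb : body.Framed (.cons (ofList (x :: l)) (.cons (ofList acc) env)) (C + 40)
          ((E x).mapVal fun a => .cons (ofList l) (.cons (ofList (a :: acc)) env)) := by
        rw [← Ens.bind_pure]
        refine (Framed.call (w := .cons x env)
          (K := fun a => Ens.pure (.cons (ofList l) (.cons (ofList (a :: acc)) env))) rfl rfl
          (Framed.frame (hx x (List.mem_cons_self ..)))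
          (fun s _ => det_of_eval rfl rfl)).mono ?_
        simp only [weight]
        omega
      -- The continuation of a round may depend on the classical value alone, so the accumulator is
      -- read off this value as `b.snd.fst`.
      have := LoopRuns.step (c := fst) (p := body) (n := l.length) (Cc := 1)
        (K := fun b => (Ens.lists (l.map E)).mapVal fun a =>
          .cons .nil (.cons (a.revApp b.snd.fst) env))
        (det_of_eval (p := fst) rfl rfl) (a := ofList (x :: l)) (by simp [ofList]) hb
        (fun r hr => by
          simp only [Ens.mapVal, List.mem_map] at hr
          obtain ⟨s, hs, rfl⟩ := hr
          exact ih (s.1 :: acc) fun y hy => hx y (List.mem_cons_of_mem _ hy))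
      rw [Ens.bind_mapVal] at this
      rw [List.map_cons, Ens.lists_cons, Ens.mapVal_bind]
      simp only [Ens.mapVal_mapVal]
      exact this
  have h1 := Framed.seq_det (det_of_eval (p := pair fst (pair zero snd))
    (v := .cons (ofList l) env) rfl rfl) (hl l [] h).framed
  have h3 := h1.seq (q := seq (seq snd fst) revP) (C' := 20 * (l.length + 1) + 10)
    (K := fun b => Ens.pure (b.snd.fst.revApp .nil)) fun r hr => by
      simp only [Ens.mapVal, List.mem_map] at hr
      obtain ⟨s, hs, rfl⟩ := hr
      have hlen : s.1.toList.length = l.length := by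
        simpa using (Ens.mem_lists hs).length_eq
      refine Det.mono (Det.seq (det_of_eval (p := seq snd fst) rfl rfl)
        (Det.seq (det_of_eval (p := pair id zero) rfl rfl) (revAppP_det _ _))) ?_
      rw [← Data.ofList_toList s.1]
      simp only [weight, eval, Data.snd, Data.fst, Data.len_revApp, Data.len_ofList, hlen]
      simp only [List.length_nil]
      omega
  rw [Ens.bind_pure, Ens.mapVal_mapVal] at h3
  have h4 := h3.mono (C' := (C + 70) * (l.length + 2)) (by simp only [weight]; nlinarith)
  have hE : ∀ a : Data,
      ((Data.cons .nil (.cons (a.revApp (ofList [])) env)).snd.fst).revApp .nil = a := by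
    intro a
    simp only [Data.snd, Data.fst]
    have h' := Data.revApp_ofList (a.toList.reverse ++ []) []
    rw [← Data.revApp_ofList] at h'
    simpa [Data.ofList_toList, ofList] using h'
  have hm : (Ens.mapVal (fun a => (Data.cons .nil (.cons (a.revApp (ofList [])) env)).snd.fst.revApp
      .nil) (Ens.lists (l.map E))) = Ens.lists (l.map E) := by
    simp [hE, Ens.mapVal]
  rw [hm] at h4
  exact h4

end Prog

end KeyLeasing

/-! ### Powers of two, levels, and random numbers -/

namespace KeyLeasing

namespace Prog

open Data (unary binary ofList)

/-- Starting with the power of two `bin`, append the successive powers of two to the front of a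
list, as many as the first list has entries. -/
def genP : Prog :=
  loop fst (pair (seq fst snd) (pair (pair zero (seq snd fst))
    (pair (pair zero (seq snd fst)) (seq snd snd))))

/-- With the least significant bit first, doubling puts one `nil` in front. Thus all bounds up to `2
^ lam` are written in time linear in `lam`. The list comes out in decreasing order, which
`setupListP` undoes. -/
theorem genP_det (n j : ℕ) (acc : List Data) :
    genP.Det (.cons (unary n) (.cons (binary (2 ^ j)) (ofList acc)))
      (.cons .nil (.cons (binary (2 ^ (j + n)))
        (ofList (((List.range n).map fun t => binary (2 ^ (j + t + 1))).reverse ++ acc))))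
      (40 * (n + 1)) := by
  suffices h : LoopRuns fst (pair (seq fst snd) (pair (pair zero (seq snd fst))
      (pair (pair zero (seq snd fst)) (seq snd snd)))) 1 24 n
      (.cons (unary n) (.cons (binary (2 ^ j)) (ofList acc)))
      (Ens.pure (.cons .nil (.cons (binary (2 ^ (j + n)))
        (ofList (((List.range n).map fun t => binary (2 ^ (j + t + 1))).reverse ++ acc))))) from
    Framed.mono h.framed (by omega)
  induction n generalizing j acc with
  | zero => exact .last (det_of_eval (p := fst) rfl rfl)
  | succ n ih =>
    have h := ih (j + 1) (binary (2 ^ (j + 1)) :: acc)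
    rw [Data.unary_succ]
    have e1 : j + (n + 1) = j + 1 + n := by omega
    have e2 : ((List.range (n + 1)).map fun t => binary (2 ^ (j + t + 1))).reverse ++ acc =
        ((List.range n).map fun t => binary (2 ^ (j + 1 + t + 1))).reverse ++
          binary (2 ^ (j + 1)) :: acc := by
      rw [List.range_succ_eq_map]
      simp only [List.map_cons, List.map_map, List.reverse_cons, List.append_assoc,
        List.singleton_append, Function.comp_def, Nat.succ_eq_add_one, Nat.add_zero]
      congr 5
      funext t
      congr 2
      omega
    rw [e1, e2]
    refine .step_det (det_of_eval (p := fst) (a := .cons .nil (unary n)) rfl rfl) (by simp)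
      (Det.mono (det_of_eval (by rfl) ?_) ?_) h
    · simp [eval, Data.fst, Data.snd, Data.binary_two_pow_succ, ofList]
    · simp [weight]

/-- The two conclusions are the two tests by which `levelP` decides to go on from `j` to `j + 1`. -/
theorem level_spec {l n j : ℕ} (hj : j < level l n - 1) : 2 ^ (j + 1) < n ∧ j + 1 < l := by
  simp only [level] at hj
  have h1 : j + 1 < Nat.clog 2 n := by omega
  exact ⟨(Nat.lt_clog_iff_pow_lt (by norm_num)).1 h1, by omega⟩

theorem level_pos {l : ℕ} (hl : 0 < l) (n : ℕ) : 0 < level l n := by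
  simp only [level]
  omega

theorem level_le (l n : ℕ) : level l n ≤ l := min_le_left _ _

/-- Without the assumption the cap at `l` could cut the level off below the logarithm of `n`. In the
simulation this is what makes the static challenger at least as tolerant as the simulated one. -/
theorem le_two_pow_level {l n : ℕ} (h : n ≤ 2 ^ l) : n ≤ 2 ^ level l n := by
  rcases le_total l (max 1 (Nat.clog 2 n)) with h' | h'
  · rwa [level, min_eq_left h']
  · rw [level, min_eq_right h']
    exact (Nat.le_pow_clog (by norm_num) n).trans (Nat.pow_le_pow_right (by norm_num) (by omega))

/-- By minimality the preceding power of two is below `n`, unless the level is at most `1`, where `2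
≤ 2 * n`. This keeps the static bound of the instance in charge linear in the requested bound. -/
theorem two_pow_level_le {l n : ℕ} (hn : 0 < n) : 2 ^ level l n ≤ 2 * n := by
  rcases Nat.lt_or_ge 1 (level l n) with h | h
  · obtain ⟨j, hj⟩ : ∃ j, level l n = j + 2 := ⟨level l n - 2, by omega⟩
    have := (level_spec (l := l) (n := n) (j := j) (by omega)).1
    rw [hj, pow_succ]
    omega
  · calc 2 ^ level l n ≤ 2 ^ 1 := Nat.pow_le_pow_right (by norm_num) h
      _ ≤ 2 * n := by omega

/-- The index (starting from zero) of the instance in charge of keys with availability bound the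
length of the second list, if the length of the first list is the number of instances. -/
def levelP : Prog :=
  seq (pair snd (pair (pair zero (pair zero zero)) (pair zero (seq fst snd))))
    (seq (loop
      (cond (seq snd (seq snd snd)) (seq (pair (seq snd fst) fst) ltP) zero)
      (pair fst (pair (seq (pair (seq snd fst) (seq snd fst)) revAppP)
        (pair (pair zero (seq snd (seq snd fst))) (seq snd (seq snd (seq snd snd)))))))
    (seq snd (seq snd fst)))

theorem levelP_det {l : ℕ} (hl : 0 < l) (n : Data) :
    levelP.Det (.cons (unary l) n) (unary (level l n.len - 1))
      ((l + 1) * (80 * n.len + 200)) := by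
  set K := level l n.len - 1 with hK
  set c := cond (seq snd (seq snd snd)) (seq (pair (seq snd fst) fst) ltP) zero with hc
  set p := pair fst (pair (seq (pair (seq snd fst) (seq snd fst)) revAppP)
    (pair (pair zero (seq snd (seq snd fst))) (seq snd (seq snd (seq snd snd))))) with hp
  have hKl : K < l := by have := level_le l n.len; omega
  -- The power `2 ^ j` has passed the test against `n`, so its double exceeds `2 * n` by little at
  -- most. Otherwise writing powers of two in unary would be too expensive.
  have hu : ∀ j ≤ K, 2 ^ (j + 1) ≤ 2 * n.len + 2 := by
    intro j hj
    rcases Nat.eq_zero_or_pos j with rfl | h0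
    · simp
    · have := (level_spec (l := l) (n := n.len) (j := j - 1) (by omega)).1
      rw [Nat.sub_add_cancel h0] at this
      rw [pow_succ]
      omega
  set S : ℕ → Data := fun j =>
    .cons n (.cons (unary (2 ^ (j + 1))) (.cons (unary j) (unary (l - 1 - j)))) with hS
  have hct : ∀ j ≤ K, c.Det (S j) (Data.bit (decide (j < K))) (40 * n.len + 100) := by
    intro j hj
    by_cases h0 : l - 1 - j = 0
    · have : ¬ j < K := by omega
      rw [decide_eq_false this]
      refine Det.mono (Framed.cond_false
        (det_of_eval (p := seq snd (seq snd snd)) rfl ?_) (det_of_eval (p := zero) rfl rfl)) ?_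
      · simp [hS, eval, Data.snd, h0, unary, ofList]
      · simp [weight]
    · obtain ⟨r, hr⟩ := Nat.exists_eq_succ_of_ne_zero h0
      have hd : decide (j < K) = decide ((unary (2 ^ (j + 1))).len < n.len) := by
        rw [Data.len_unary]
        refine decide_eq_decide.2 ⟨fun h => (level_spec (by omega)).1, fun h => ?_⟩
        -- The loop would stop at `j = K` although instances remain. Then the level is not cut off
        -- by `l`, so it is governed by the logarithm, and the next power of two cannot be below
        -- `n`.
        by_contra h'
        have : j = K := by omega
        have h3 : Nat.clog 2 n.len ≤ j + 1 := by
          simp only [level] at hK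
          omega
        have := (Nat.clog_le_iff_le_pow (by norm_num)).1 h3
        omega
      rw [hd]
      refine Det.mono (Framed.cond_true
        (det_of_eval (p := seq snd (seq snd snd)) (a := .cons .nil (unary r)) rfl ?_) (by simp)
        (Det.seq (det_of_eval (p := pair (seq snd fst) fst) rfl rfl) (ltP_det _ _))) ?_
      · simp only [hS, eval, Data.snd, hr, Nat.succ_eq_add_one, Data.unary_succ]
      · simp only [hS, Data.fst, Data.snd, weight, Data.len_unary, eval]
        have := hu j hj
        omega
  have hpt : ∀ j < K, p.Det (S j) (S (j + 1)) (20 * n.len + 60) := by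
    intro j hj
    have h2 := level_spec (l := l) (n := n.len) (j := j) (by omega)
    obtain ⟨r, hr⟩ : ∃ r, l - 1 - j = r + 1 := ⟨l - 2 - j, by omega⟩
    have h := (det_of_eval (p := fst) (v := S j) rfl rfl).pair (((det_of_eval
      (p := pair (seq snd fst) (seq snd fst)) (v := S j) rfl rfl).seq
      (revAppP_det (unary (2 ^ (j + 1))) (unary (2 ^ (j + 1))))).pair
      (det_of_eval (p := pair (pair zero (seq snd (seq snd fst)))
        (seq snd (seq snd (seq snd snd)))) (v := S j)
        (a := .cons (unary (j + 1)) (unary (l - 1 - (j + 1)))) rfl ?_))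
    · rw [Data.revApp_unary, ← two_mul, ← pow_succ'] at h
      refine Det.mono h ?_
      simp only [weight, Data.len_unary]
      omega
    · rw [show l - 1 - (j + 1) = r by omega]
      simp only [hS, eval, Data.fst, Data.snd, hr, Data.unary_succ]
  have hrun : ∀ d j, j + d = K →
      LoopRuns c p (40 * n.len + 100) (20 * n.len + 60) d (S j) (Ens.pure (S K)) := by
    intro d
    induction d with
    | zero =>
      rintro j rfl
      refine .last ?_
      simpa [Data.bit] using hct K le_rfl
    | succ d ih =>
      intro j hj
      refine .step_det (hct j (by omega)) ?_ (hpt j (by omega)) (ih (j + 1) (by omega))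
      rw [decide_eq_true (by omega : j < K)]
      simp [Data.bit]
  have h := Det.seq (det_of_eval (p := pair snd (pair (pair zero (pair zero zero))
    (pair zero (seq fst snd)))) (v := .cons (unary l) n) (a := S 0) rfl ?_)
    (Det.seq (hrun K 0 (by omega)).framed (det_of_eval (p := seq snd (seq snd fst)) rfl rfl))
  · refine Det.mono h ?_
    simp only [weight]
    have : (K + 1) * (40 * n.len + 100 + (20 * n.len + 60) + 2) ≤ l * (60 * n.len + 162) := by
      refine Nat.mul_le_mul (by omega) (by omega)
    have : (l + 1) * (80 * n.len + 200) = l * (60 * n.len + 162) + (l * (20 * n.len + 38) +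
      80 * n.len + 200) := by ring
    omega
  · obtain ⟨r, rfl⟩ := Nat.exists_eq_succ_of_ne_zero hl.ne'
    simp [hS, eval, Data.fst, Data.snd, Data.unary_succ]
    rfl

/-- A uniformly random number below the least power of two that is not less than the length of the
input. -/
def sampleP : Prog :=
  seq (pair id (pair (pair zero zero) zero))
    (seq (loop (seq (pair (seq snd fst) fst) ltP)
      (seq (pair id coin)
        (pair (seq fst fst)
          (pair (seq (pair (seq fst (seq snd fst)) (seq fst (seq snd fst))) revAppP)
            (seq (pair (seq fst (seq snd snd)) (cond snd
              (pair zero (seq fst (seq snd snd))) (seq fst (seq snd snd)))) revAppP)))))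
    (seq snd snd))

/-- The amplitude of a sequence of `s` coins. -/
noncomputable def coinAmp (s : ℕ) : ℂ := (1 / (Real.sqrt 2 : ℂ)) ^ s

theorem coinAmp_ne_zero (s : ℕ) : coinAmp s ≠ 0 := by
  simp [coinAmp]

theorem normSq_coinAmp (s : ℕ) : Complex.normSq (coinAmp s) = (1 / 2) ^ s := by
  rw [coinAmp, map_pow, Complex.normSq_div, Complex.normSq_ofReal,
    Real.mul_self_sqrt (by norm_num)]
  simp

/-- The uniform distribution on the numbers below `2 ^ s`. -/
noncomputable def uniform (s : ℕ) : Ens :=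
  (List.range (2 ^ s)).map fun w => (unary w, QMem.empty.scale (coinAmp s))

/-- While `2 ^ r < l`, the pair `(2 ^ r, i)` is replaced by `(2 ^ (r + 1), 2 * i + coin)`. All
branches make the same number of rounds, hence all numbers get the same amplitude. Rejecting numbers
that are not below `l` and trying again would not halt with certainty; such numbers are left to the
caller. -/
theorem sampleP_framed (l : ℕ) :
    sampleP.Framed (unary l) ((l + 2) * (120 * l + 200)) (uniform (Nat.clog 2 l)) := by
  set s := Nat.clog 2 l with hs
  set c := seq (pair (seq snd fst) fst) ltP with hc
  set q := pair (seq fst fst)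
    (pair (seq (pair (seq fst (seq snd fst)) (seq fst (seq snd fst))) revAppP)
      (seq (pair (seq fst (seq snd snd)) (cond snd
        (pair zero (seq fst (seq snd snd))) (seq fst (seq snd snd)))) revAppP)) with hq
  set S : ℕ → ℕ → Data := fun r i => .cons (unary l) (.cons (unary (2 ^ r)) (unary i)) with hS
  have hlt : ∀ r, r < s ↔ 2 ^ r < l := fun r => Nat.lt_clog_iff_pow_lt (by norm_num)
  have hu : ∀ r ≤ s, 2 ^ r ≤ 2 * l + 1 := by
    intro r hr
    rcases r with _ | r
    · simp
    · have := (hlt r).1 (by omega)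
      rw [pow_succ]
      omega
  have hct : ∀ r ≤ s, ∀ i, c.Det (S r i) (Data.bit (decide (r < s))) (40 * l + 60) := by
    intro r hr i
    have h := Det.seq (det_of_eval (p := pair (seq snd fst) fst) (v := S r i) rfl rfl)
      (ltP_det _ _)
    have hd : decide (((seq snd fst).eval (S r i)).len < ((fst).eval (S r i)).len) =
        decide (r < s) := by
      simp [hS, eval, Data.fst, Data.snd, Data.len_unary, hlt]
    rw [hd] at h
    refine Det.mono h ?_
    simp only [hS, eval, Data.fst, Data.snd, Data.len_unary, weight]
    have := hu r hr
    omega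
  have hqt : ∀ r < s, ∀ i < 2 ^ r, ∀ b : Bool,
      q.Det (.cons (S r i) (Data.bit b)) (S (r + 1) (2 * i + b.toNat)) (60 * l + 100) := by
    intro r hr i hi b
    have h := (det_of_eval (p := seq fst fst) (v := .cons (S r i) (Data.bit b)) rfl rfl).pair
      (((det_of_eval (p := pair (seq fst (seq snd fst)) (seq fst (seq snd fst)))
        (v := .cons (S r i) (Data.bit b)) rfl rfl).seq
        (revAppP_det (unary (2 ^ r)) (unary (2 ^ r)))).pair
      ((det_of_eval (p := pair (seq fst (seq snd snd)) (cond snd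
        (pair zero (seq fst (seq snd snd))) (seq fst (seq snd snd))))
        (v := .cons (S r i) (Data.bit b)) (a := .cons (unary i) (unary (i + b.toNat)))
        rfl ?_).seq (revAppP_det (unary i) (unary (i + b.toNat)))))
    · rw [Data.revApp_unary, Data.revApp_unary, ← two_mul, ← pow_succ', ← add_assoc,
        ← two_mul] at h
      refine Det.mono h ?_
      simp only [weight, Data.len_unary]
      have := (hlt r).1 hr
      omega
    · cases b <;> simp [hS, eval, Data.fst, Data.snd, Data.bit, Data.unary_succ]
  have hl : ∀ d r i, r + d = s → i < 2 ^ r →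
      LoopRuns c (seq (pair id coin) q) (40 * l + 60) (60 * l + 110) d (S r i)
        ((List.range (2 ^ d)).map fun w =>
          (S s (i * 2 ^ d + w), QMem.empty.scale (coinAmp d))) := by
    intro d
    induction d with
    | zero =>
      rintro r i rfl hi
      have := LoopRuns.last (c := c) (p := seq (pair id coin) q) (Cc := 40 * l + 60)
        (Cp := 60 * l + 110) (v := S s i) (by simpa [Data.bit] using hct s le_rfl i)
      simpa [Ens.pure, coinAmp, QMem.scale_one] using this
    | succ d ih =>
      intro r i hr hi
      have hb : (seq (pair id coin) q).Framed (S r i) (60 * l + 110)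
          [(S (r + 1) (2 * i), QMem.empty.scale (1 / (Real.sqrt 2 : ℂ))),
            (S (r + 1) (2 * i + 1), QMem.empty.scale (1 / (Real.sqrt 2 : ℂ)))] := by
        have h := (Framed.pair_det_left (det_id (S r i)) Framed.coin).seq (q := q)
          (C' := 60 * l + 100)
          (K := fun b => Ens.pure (S (r + 1) (2 * i + if b.snd = .nil then 0 else 1)))
          (by
            intro t ht
            simp only [Ens.mapVal, List.map_cons, List.map_nil, List.mem_cons,
              List.not_mem_nil, or_false] at ht
            rcases ht with rfl | rfl
            · simpa [Data.bit, Data.snd, Prog.Det] using hqt r (by omega) i hi false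
            · simpa [Data.bit, Data.snd, Prog.Det] using hqt r (by omega) i hi true)
        rw [Ens.bind_pure] at h
        simpa [Ens.mapVal, Data.snd, Data.bit] using h.mono (by omega)
      -- The number drawn so far is recovered as `a.snd.snd.len`, since the continuation sees only
      -- the classical value. The two halves of the range belong to the two outcomes of the coin.
      have h := LoopRuns.step (c := c) (p := seq (pair id coin) q) (hct r (by omega) i)
        (by rw [decide_eq_true (by omega : r < s)]; simp [Data.bit]) hb
        (n := d) (K := fun a => (List.range (2 ^ d)).map fun w =>
          (S s (a.snd.snd.len * 2 ^ d + w), QMem.empty.scale (coinAmp d)))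
        (by
          have h2 : 2 * i + 1 < 2 ^ (r + 1) := by rw [pow_succ]; omega
          intro t ht
          simp only [List.mem_cons, List.not_mem_nil, or_false] at ht
          rcases ht with rfl | rfl
          · simpa [hS, Data.snd, Data.len_unary] using ih (r + 1) (2 * i) (by omega) (by omega)
          · simpa [hS, Data.snd, Data.len_unary] using ih (r + 1) (2 * i + 1) (by omega) h2)
      convert h using 1
      rw [pow_succ, mul_two, List.range_add, List.map_append]
      simp only [Ens.bind, List.flatMap_cons, List.flatMap_nil, List.append_nil, Ens.after,
        List.map_map]
      congr 1
      · refine List.map_congr_left fun w _ => ?_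
        simp only [Function.comp, hS, Data.snd, Data.len_unary, Prod.mk.injEq,
          QMem.tensor_scale, QMem.tensor_empty, QMem.scale_scale]
        refine ⟨?_, ?_⟩
        · congr 4; ring
        · rfl
      · refine List.map_congr_left fun w _ => ?_
        simp only [Function.comp, hS, Data.snd, Data.len_unary, Prod.mk.injEq,
          QMem.tensor_scale, QMem.tensor_empty, QMem.scale_scale]
        refine ⟨?_, ?_⟩
        · rw [show i * (2 ^ d + 2 ^ d) + (2 ^ d + w) = (2 * i + 1) * 2 ^ d + w by ring]
        · rfl
  have h := Framed.seq_det (det_of_eval (p := pair id (pair (pair zero zero) zero))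
    (v := unary l) (a := S 0 0) rfl rfl)
    ((hl s 0 0 (by omega) (by simp)).framed.seq (q := seq snd snd) (C' := 3)
      (K := fun a => Ens.pure a.snd.snd) fun _ _ => det_of_eval rfl rfl)
  rw [Ens.bind_pure] at h
  have hE : Ens.mapVal (fun a => a.snd.snd) ((List.range (2 ^ s)).map fun w =>
      (S s (0 * 2 ^ s + w), QMem.empty.scale (coinAmp s))) = uniform s := by
    simp [Ens.mapVal, uniform, hS, Data.snd]
  rw [hE] at h
  refine h.mono ?_
  simp only [weight]
  have hsl : s ≤ l := by
    by_contra h'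
    have := (hlt l).1 (by omega)
    exact absurd this (not_lt.2 Nat.lt_two_pow_self.le)
  have : (s + 1) * (40 * l + 60 + (60 * l + 110) + 2) ≤ (l + 1) * (100 * l + 172) :=
    Nat.mul_le_mul (by omega) (by omega)
  nlinarith

end Prog

end KeyLeasing

namespace KeyLeasing

/-! ## Polynomial bounds -/

/-- Bounded by a polynomial on the positive integers. -/
def PolyBdd (f : ℕ → ℕ) : Prop := ∃ k, ∀ a, 0 < a → f a ≤ k * a ^ k

namespace PolyBdd

theorem const (c : ℕ) : PolyBdd fun _ => c :=
  ⟨c, fun _ ha => Nat.le_mul_of_pos_right _ (pow_pos ha _)⟩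

theorem id : PolyBdd (fun a => a) := ⟨1, fun _ _ => by simp⟩

theorem add {f g : ℕ → ℕ} (hf : PolyBdd f) (hg : PolyBdd g) : PolyBdd fun a => f a + g a := by
  obtain ⟨k, hk⟩ := hf
  obtain ⟨l, hl⟩ := hg
  refine ⟨k + l, fun a ha => ?_⟩
  calc f a + g a ≤ k * a ^ k + l * a ^ l := Nat.add_le_add (hk a ha) (hl a ha)
    _ ≤ k * a ^ (k + l) + l * a ^ (k + l) := Nat.add_le_add
        (Nat.mul_le_mul_left _ (Nat.pow_le_pow_right ha (Nat.le_add_right _ _)))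
        (Nat.mul_le_mul_left _ (Nat.pow_le_pow_right ha (Nat.le_add_left _ _)))
    _ = (k + l) * a ^ (k + l) := by ring

theorem mul {f g : ℕ → ℕ} (hf : PolyBdd f) (hg : PolyBdd g) : PolyBdd fun a => f a * g a := by
  obtain ⟨k, hk⟩ := hf
  obtain ⟨l, hl⟩ := hg
  -- The same number serves as coefficient and as exponent, so it has to dominate both `k * l` and
  -- `k + l`.
  refine ⟨k * l + (k + l), fun a ha => ?_⟩
  calc f a * g a ≤ (k * a ^ k) * (l * a ^ l) := Nat.mul_le_mul (hk a ha) (hl a ha)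
    _ = (k * l) * a ^ (k + l) := by ring
    _ ≤ (k * l + (k + l)) * a ^ (k * l + (k + l)) := Nat.mul_le_mul (Nat.le_add_right _ _)
        (Nat.pow_le_pow_right ha (Nat.le_add_left _ _))

theorem pow {f : ℕ → ℕ} (hf : PolyBdd f) (n : ℕ) : PolyBdd fun a => f a ^ n := by
  induction n with
  | zero => simpa using const 1
  | succ n ih => simpa only [pow_succ] using ih.mul hf

theorem comp_poly {f : ℕ → ℕ} (hf : PolyBdd f) (c : ℕ) : PolyBdd fun a => poly c (f a) :=
  ((const c).mul (hf.pow c)).add (const c)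

theorem exists_poly {f : ℕ → ℕ} (hf : PolyBdd f) : ∃ c, ∀ a, 0 < a → f a ≤ poly c a := by
  obtain ⟨k, hk⟩ := hf
  exact ⟨k, fun a ha => (hk a ha).trans (Nat.le_add_right _ _)⟩

end PolyBdd

theorem poly_mono {c a b : ℕ} (h : a ≤ b) : poly c a ≤ poly c b := by
  unfold poly
  gcongr

theorem poly_mono_left {c d a : ℕ} (h : c ≤ d) (ha : 0 < a) : poly c a ≤ poly d a := by
  unfold poly
  gcongr

/-! ## The algorithms of the construction -/

open Data (unary binary ofList)

namespace Prog

theorem Computes.yields {p : Prog} {v : Data} {m : QMem} {C : ℕ} {E : Ens}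
    (h : p.Computes v m C E) : p.Yields v m C E :=
  ⟨h.haltsIn, by rw [h.out_eq]; intro _ _ _ _ _ _; rfl⟩

theorem Computes.yieldsClassical {p : Prog} {v : Data} {m : QMem} {C : ℕ} {E : Ens}
    (h : p.Computes v m C E) : p.YieldsClassical v m C E :=
  ⟨h.haltsIn, by rw [h.out_eq]; intro _; rfl⟩

theorem Computes.seq_det {p q : Prog} {v a : Data} {m : QMem} {C C' : ℕ} {E : Ens}
    (h : p.Det v a C) (hq : q.Computes a m C' E) :
    (Prog.seq p q).Computes v m (C + C' + 1) E := by
  have h1 := h m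
  rw [Ens.after_pure] at h1
  have := Computes.seq (q := q) (K := fun _ _ => E) h1 fun s hs => by
    obtain rfl := List.mem_singleton.1 hs
    exact hq
  rwa [List.flatMap_singleton] at this

/-- The length of the first component, in unary. -/
def normP : Prog := mapP zero

theorem normP_det (l : List Data) (env : Data) :
    normP.Det (.cons (ofList l) env) (unary l.length) (71 * (l.length + 2)) := by
  have h := mapP_framed (p := zero) (env := env) (C := 1) (E := fun _ => Ens.pure .nil) l
    fun x _ => (det_of_eval (p := zero) rfl rfl : zero.Det _ _ 1).computes_empty
  have he : ∀ l : List Data, Ens.lists (l.map fun _ => Ens.pure .nil) =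
      Ens.pure (unary l.length) := by
    intro l
    induction l with
    | nil => rfl
    | cons a l ih =>
      rw [List.map_cons, Ens.lists_cons, ih, Ens.pure_bind, List.length_cons, Data.unary_succ]
      rfl
  rw [he] at h
  exact h

/-- Run `Setup` of `S` on the collusion bound for all availability bounds in the reversed list. -/
def setupListP (S : Algs) : Prog :=
  seq (pair (seq fst revP) snd)
    (mapP (seq (pair (seq snd fst) (pair (seq snd snd) fst)) S.setup))

theorem setupListP_framed {S : Algs} {lam q C : ℕ} (l : List ℕ)
    (h : ∀ j ∈ l, S.setup.HaltsIn (.cons (unary lam) (.cons (unary q) (binary (2 ^ j))))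
      QMem.empty C) :
    (setupListP S).Framed
      (.cons (ofList (l.map fun j => binary (2 ^ j)).reverse) (.cons (unary lam) (unary q)))
      ((C + 120) * (l.length + 2))
      (Ens.lists (l.map fun j => (S.atBound (2 ^ j)).setup lam q)) := by
  have h1 : ∀ x ∈ l.map fun j => binary (2 ^ j),
      (seq (pair (seq snd fst) (pair (seq snd snd) fst)) S.setup).Computes
        (.cons x (.cons (unary lam) (unary q))) QMem.empty (C + 20)
        (S.setup.out (.cons (unary lam) (.cons (unary q) x)) QMem.empty) := by
    intro x hx
    obtain ⟨j, hj, rfl⟩ := List.mem_map.1 hx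
    refine (Computes.seq_det (det_of_eval
      (a := .cons (unary lam) (.cons (unary q) (binary (2 ^ j)))) rfl rfl) (h j hj).computes).mono ?_
    simp only [weight]
    omega
  have h2 := Framed.seq_det (Det.pair (Det.seq (det_of_eval (p := fst)
    (v := .cons (ofList (l.map fun j => binary (2 ^ j)).reverse) (.cons (unary lam) (unary q)))
    rfl rfl) (revP_det (l.map fun j => binary (2 ^ j)).reverse)) (det_of_eval (p := snd) rfl rfl))
    (by rw [List.reverse_reverse]; exact mapP_framed _ h1)
  simp only [List.map_map, Function.comp_def] at h2
  refine Framed.mono h2 ?_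
  simp only [weight, List.length_reverse, List.length_map]
  nlinarith

end Prog

namespace Algs

open Prog

/-- The algorithms of the construction. -/
def combined (S : Algs) : Algs where
  setup := call (pair fst (pair (pair (pair zero zero) zero) zero)) genP
    (seq (pair (seq snd (seq snd snd)) fst) (setupListP S))
  kg := call (pair fst zero) normP (call (pair snd (seq fst (seq snd snd))) levelP
    (call (pair snd (seq fst (seq fst fst))) nthP
      (call (pair snd (seq fst (seq fst (seq fst (seq snd fst))))) (frame S.kg)
        (pair (pair (pair zero (seq fst (seq fst snd))) (seq snd fst)) (seq snd snd)))))
  enc := mapP S.enc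
  dec := seq (pair (seq fst snd) (seq (pair (seq fst (seq fst snd)) snd) nthP)) S.dec
  cert := seq snd S.cert
  vrfy := S.vrfy

theorem combined_classical {S : Algs} (hS : S.Classical) : S.combined.Classical := by
  obtain ⟨h1, h2, h3⟩ := hS
  refine ⟨?_, ?_, h3⟩ <;>
    simp [combined, setupListP, genP, call, revP, revAppP, mapP, IsClassical, h1, h2]

theorem instances_setup (S : Algs) (lam q : ℕ) : S.instances.setup lam q =
    Ens.lists ((List.range lam).map fun i => (S.atBound (2 ^ (i + 1))).setup lam q) := rfl

theorem instances_enc (S : Algs) (msk x : Data) : S.instances.enc msk x =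
    Ens.lists (msk.toList.map fun a => S.enc.out (.cons a x) QMem.empty) := by
  have : ∀ (l : List Data) (g : Data → Ens), l.mapIdx (fun _ a => g a) = l.map g := by
    intro l g
    induction l with
    | nil => rfl
    | cons a l ih => rw [List.mapIdx_cons, ih, List.map_cons]
  exact congrArg Ens.lists (this _ _)

theorem instances_kg (S : Algs) (msk f : Data) (n : ℕ) : S.instances.kg msk f n =
    (S.kg.out (.cons (msk.toList.getD (level msk.toList.length n - 1) .nil) f) QMem.empty).mapVal
      fun a => .cons (.cons (unary (level msk.toList.length n)) a.fst) a.snd := rfl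

/-- Master secret keys consist of one key of every instance. -/
theorem mem_instances_setup {S : Algs} {lam q : ℕ} {s : Data × QMem}
    (h : s ∈ S.instances.setup lam q) : s.1.toList.length = lam ∧
      ∀ i < lam, ∃ m, (s.1.toList.getD i .nil, m) ∈ (S.atBound (2 ^ (i + 1))).setup lam q := by
  have h := Ens.mem_lists h
  rw [List.forall₂_iff_get] at h
  simp only [List.length_map, List.length_range] at h
  refine ⟨h.1, fun i hi => ?_⟩
  have := h.2 i (by rw [h.1]; exact hi) (by simpa using hi)
  rw [List.getD_eq_getElem _ _ (by rw [h.1]; exact hi)]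
  simpa using this

theorem exists_of_mem_toList {S : Algs} {lam q : ℕ} {s : Data × QMem}
    (h : s ∈ S.instances.setup lam q) {a : Data} (ha : a ∈ s.1.toList) :
    ∃ i < lam, ∃ m, (a, m) ∈ (S.atBound (2 ^ (i + 1))).setup lam q := by
  obtain ⟨h1, h2⟩ := mem_instances_setup h
  obtain ⟨i, hi, rfl⟩ := List.getElem_of_mem ha
  refine ⟨i, by omega, ?_⟩
  have := h2 i (by omega)
  rwa [List.getD_eq_getElem _ _ hi] at this

theorem size_two_pow (i : ℕ) : (2 ^ i).size = i + 1 := Nat.size_pow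

/-- Running times of the algorithms of a scheme with static availability bound. -/
structure Times (S : Algs) (𝓕 : FunClass) (c : ℕ) : Prop where
  setup : ∀ {lam q i : ℕ}, 0 < lam → 0 < q →
    S.setup.HaltsIn (.cons (unary lam) (.cons (unary q) (binary (2 ^ i)))) QMem.empty
      (poly c (lam + q + (i + 1)))
  enc : ∀ {lam q i : ℕ}, 0 < lam → 0 < q → ∀ {a : Data} {m : QMem},
    (a, m) ∈ (S.atBound (2 ^ i)).setup lam q → ∀ {x : Data}, x ∈ 𝓕.X lam →
    S.enc.HaltsIn (.cons a x) QMem.empty (poly c (lam + q + (i + 1)))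
  keyTime : ∀ {lam q i : ℕ}, 0 < lam → 0 < q → S.KeyTime 𝓕 lam q (2 ^ i) (poly c (lam + q + 2 ^ i))
  decCert : ∀ {lam q i : ℕ}, 0 < lam → 0 < q → ∀ {a : Data} {m : QMem},
    (a, m) ∈ (S.atBound (2 ^ i)).setup lam q → ∀ {f : Data}, f ∈ 𝓕.F lam →
    ∀ {k : Data × QMem}, k ∈ S.kg.out (.cons a f) QMem.empty →
    (∀ x ∈ 𝓕.X lam, ∀ e ∈ S.enc.out (.cons a x) QMem.empty,
      S.dec.HaltsIn (.cons k.1.fst e.1) k.2 (poly c (lam + q + 2 ^ i))) ∧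
    S.cert.HaltsIn k.1.fst k.2 (poly c (lam + q + 2 ^ i))

/-- The number `2 ^ i` has `i + 1` binary digits, so weak optimal efficiency bounds `Setup` and
`Enc` by a polynomial in `lam`, `q` and `i`. The other algorithms are only bounded by a polynomial
in `2 ^ i`. -/
theorem IsStaticScheme.exists_times {S : Algs} {𝓕 : FunClass} (hS : S.IsStaticScheme 𝓕) :
    ∃ c, S.Times 𝓕 c := by
  obtain ⟨-, ⟨c₁, h₁⟩, ⟨c₂, h₂⟩, -⟩ := hS
  have hm₁ : ∀ {a}, 0 < a → poly c₁ a ≤ poly (max c₁ c₂) a := poly_mono_left (le_max_left _ _)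
  have hm₂ : ∀ {a}, 0 < a → poly c₂ a ≤ poly (max c₁ c₂) a := poly_mono_left (le_max_right _ _)
  have hp : ∀ i, 0 < 2 ^ i := fun i => Nat.two_pow_pos i
  have hs : ∀ {a b k : ℕ}, 0 < a → 0 < a + b + k := by omega
  refine ⟨max c₁ c₂, fun {lam q i} hl hq => ?_, fun {lam q i} hl hq a m hs' x hx => ?_,
    fun {lam q i} hl hq s hs' f hf => ?_, fun {lam q i} hl hq a m hs' f hf k hk => ?_⟩
  · have := (h₁ lam q (2 ^ i) hl hq (hp i)).1
    rw [size_two_pow] at this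
    exact this.mono (hm₁ (hs hl))
  · have := (h₁ lam q (2 ^ i) hl hq (hp i)).2 _ hs' x hx
    rw [size_two_pow] at this
    exact this.mono (hm₁ (hs hl))
  · have h := (h₂ lam q (2 ^ i) hl hq (hp i)).1 s hs' f hf
    exact ⟨h.1.mono (hm₂ (hs hl)), fun k hk z => (h.2 k hk z).mono (hm₂ (hs hl))⟩
  · have h := (h₂ lam q (2 ^ i) hl hq (hp i)).2 _ hs' f hf k hk
    exact ⟨fun x hx e he => (h.1 x hx e he).mono (hm₂ (hs hl)), h.2.mono (hm₂ (hs hl))⟩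

end Algs

end KeyLeasing

namespace KeyLeasing

open Data (unary binary ofList)

namespace Algs

open Prog

section

variable {S : Algs} {𝓕 : FunClass} {c lam q : ℕ}

theorem combined_setup_computes (hT : S.Times 𝓕 c) (hl : 0 < lam) (hq : 0 < q) :
    S.combined.setup.Computes (.cons (unary lam) (unary q)) QMem.empty
      ((poly c (2 * (lam + q)) + 240) * (lam + 2)) (S.instances.setup lam q) := by
  rw [instances_setup]
  have h := setupListP_framed (S := S) (lam := lam) (q := q) (C := poly c (2 * (lam + q)))
    ((List.range lam).map (· + 1)) fun j hj => by
      obtain ⟨i, hi, rfl⟩ := List.mem_map.1 hj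
      have := List.mem_range.1 hi
      exact (hT.setup hl hq).mono (poly_mono (by omega))
  simp only [List.map_map, Function.comp_def, List.length_map, List.length_range] at h
  have hg := genP_det lam 0 []
  simp only [Nat.zero_add, List.append_nil] at hg
  refine (Framed.call_det (v := .cons (unary lam) (unary q)) rfl
    (w := .cons (unary lam) (.cons (binary (2 ^ 0)) (ofList []))) ?_ hg
    (Framed.seq_det (det_of_eval (by rfl) ?_) h)).computes_empty.mono ?_
  · rw [Data.binary_two_pow_zero]; rfl
  · rfl
  · simp only [weight]
    nlinarith

theorem combined_enc_computes (hT : S.Times 𝓕 c) (hl : 0 < lam) (hq : 0 < q)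
    {s : Data × QMem} (hs : s ∈ S.instances.setup lam q) {x : Data} (hx : x ∈ 𝓕.X lam) :
    S.combined.enc.Computes (.cons s.1 x) QMem.empty
      ((poly c (2 * (lam + q)) + 70) * (lam + 2)) (S.instances.enc s.1 x) := by
  rw [instances_enc]
  have h := mapP_framed (p := S.enc) (env := x) (C := poly c (2 * (lam + q)))
    (E := fun a => S.enc.out (.cons a x) QMem.empty) s.1.toList fun a ha => by
      obtain ⟨i, hi, m, hm⟩ := exists_of_mem_toList hs ha
      exact ((hT.enc hl hq hm hx).mono (poly_mono (by omega))).computes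
  rw [Data.ofList_toList, (mem_instances_setup hs).1] at h
  exact h.computes_empty

/-- The security parameter is not part of the input. It is the length of the master secret key,
which `normP` turns into a unary number for `levelP`. -/
theorem combined_kg_computes (hT : S.Times 𝓕 c) (hl : 0 < lam) (hq : 0 < q)
    {s : Data × QMem} (hs : s ∈ S.instances.setup lam q) {f : Data} (hf : f ∈ 𝓕.F lam) {n : ℕ}
    (hn : 0 < n) :
    S.combined.kg.Computes (.cons s.1 (.cons f (unary n))) QMem.empty
      (poly c (2 * (lam + q + n)) + 71 * (lam + 2) + (lam + 1) * (80 * n + 200) + 20 * lam + 200)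
      (S.instances.kg s.1 f n) := by
  obtain ⟨h1, h2⟩ := mem_instances_setup hs
  have hk0 : 0 < level lam n := level_pos hl n
  have hkl := level_le lam n
  obtain ⟨m, hm⟩ := h2 (level lam n - 1) (by omega)
  rw [Nat.sub_add_cancel hk0] at hm
  rw [instances_kg, h1]
  have h3 := normP_det s.1.toList .nil
  rw [Data.ofList_toList, h1] at h3
  have h4 := levelP_det hl (unary n)
  rw [Data.len_unary] at h4
  have h5 := nthP_det (unary (level lam n - 1)) s.1
  rw [Data.len_unary] at h5
  -- The instance runs in time polynomial in its static bound, which is at most `2 * n`.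
  have h6 := (((hT.keyTime hl hq _ hm f hf).1.mono
    (poly_mono (b := 2 * (lam + q + n)) (by have := two_pow_level_le (l := lam) hn; omega)))).framed
  rw [← Ens.bind_pure]
  have hlev : level lam n = level lam n - 1 + 1 := by omega
  refine Computes.mono (Framed.computes_empty (Framed.call_det rfl ?_ h3 (Framed.call_det rfl ?_ h4
    (Framed.call_det rfl ?_ h5 (Framed.call rfl ?_ h6 fun t _ => det_of_eval rfl ?_))))) ?_
  · rfl
  · rfl
  · rfl
  · rfl
  · conv_rhs => rw [hlev, Data.unary_succ]
    rfl
  · simp only [weight]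
    have : level lam n - 1 ≤ lam := by omega
    omega

theorem combined_dec_computes (hT : S.Times 𝓕 c) (hl : 0 < lam) (hq : 0 < q)
    {s : Data × QMem} (hs : s ∈ S.instances.setup lam q) {f : Data} (hf : f ∈ 𝓕.F lam) {n : ℕ}
    (hn : 0 < n) {k : Data × QMem} (hk : k ∈ S.instances.kg s.1 f n) {x : Data} (hx : x ∈ 𝓕.X lam)
    {e : Data × QMem} (he : e ∈ S.instances.enc s.1 x) :
    S.combined.dec.Computes (.cons k.1.fst e.1) k.2 (poly c (2 * (lam + q + n)) + 20 * lam + 40)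
      (S.instances.dec k.1.fst k.2 e.1) := by
  obtain ⟨h1, h2⟩ := mem_instances_setup hs
  have hk0 : 0 < level lam n := level_pos hl n
  have hkl := level_le lam n
  obtain ⟨m, hm⟩ := h2 (level lam n - 1) (by omega)
  rw [Nat.sub_add_cancel hk0] at hm
  rw [instances_kg, h1] at hk
  obtain ⟨r, hr, rfl⟩ := List.mem_map.1 hk
  rw [instances_enc] at he
  have he := Ens.mem_lists he
  rw [List.forall₂_iff_get] at he
  simp only [List.length_map, h1] at he
  obtain ⟨m', hm'⟩ := he.2 (level lam n - 1) (by omega) (by omega)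
  have h5 := nthP_det (unary (level lam n - 1)) e.1
  rw [Data.len_unary, List.getD_eq_getElem _ _ (by omega)] at h5
  simp only [List.get_eq_getElem, List.getElem_map] at hm'
  rw [List.getD_eq_getElem _ _ (by omega)] at hm hr
  have h6 := ((((hT.decCert hl hq hm hf hr).1 x hx _ hm').mono
    (poly_mono (b := 2 * (lam + q + n)) (by have := two_pow_level_le (l := lam) hn; omega)))).computes
  have hlev : level lam n = level lam n - 1 + 1 := by omega
  have hE : S.instances.dec (Data.cons (unary (level lam n)) r.1.fst) r.2 e.1 =
      S.dec.out (.cons r.1.fst (e.1.toList[level lam n - 1]'(by omega))) r.2 := by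
    simp only [instances, atBound, Data.fst, Data.snd, Data.len_unary]
    rw [List.getD_eq_getElem _ _ (by omega)]
  simp only [Data.fst] at hE ⊢
  rw [hE]
  refine (Computes.seq_det (Det.pair (det_of_eval (by rfl) ?_)
    (Det.seq (det_of_eval (by rfl) ?_) h5)) h6).mono ?_
  · rfl
  · rw [hlev, Data.unary_succ]; rfl
  · simp only [weight]
    omega

theorem combined_cert_computes (hT : S.Times 𝓕 c) (hl : 0 < lam) (hq : 0 < q)
    {s : Data × QMem} (hs : s ∈ S.instances.setup lam q) {f : Data} (hf : f ∈ 𝓕.F lam) {n : ℕ}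
    (hn : 0 < n) {k : Data × QMem} (hk : k ∈ S.instances.kg s.1 f n) :
    S.combined.cert.Computes k.1.fst k.2 (poly c (2 * (lam + q + n)) + 10)
      (S.instances.cert k.1.fst k.2) ∧
    ∀ z, S.combined.vrfy.Computes (.cons k.1.snd z) QMem.empty (poly c (2 * (lam + q + n)))
      (S.instances.vrfy k.1.snd z) := by
  obtain ⟨h1, h2⟩ := mem_instances_setup hs
  have hk0 : 0 < level lam n := level_pos hl n
  have hkl := level_le lam n
  obtain ⟨m, hm⟩ := h2 (level lam n - 1) (by omega)
  rw [Nat.sub_add_cancel hk0] at hm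
  rw [instances_kg, h1] at hk
  obtain ⟨r, hr, rfl⟩ := List.mem_map.1 hk
  have hp := poly_mono (c := c) (a := lam + q + 2 ^ level lam n) (b := 2 * (lam + q + n))
    (by have := two_pow_level_le (l := lam) hn; omega)
  refine ⟨(Computes.seq_det (det_of_eval (p := snd) rfl rfl)
    (((hT.decCert hl hq hm hf hr).2.mono hp).computes)).mono ?_, fun z =>
    (((hT.keyTime hl hq _ hm f hf).2 r hr z).mono hp).computes⟩
  simp only [weight]
  omega

/-- The algorithms of the construction run in polynomial time. -/
theorem instances_polyTime (hT : S.Times 𝓕 c) (hS : S.Classical) : S.instances.PolyTime 𝓕 := by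
  obtain ⟨C, hC⟩ : ∃ C, ∀ a, 0 < a → (poly c (2 * a) + 240) * (a + 2) + 71 * (a + 2) +
      (a + 1) * (80 * a + 200) + 20 * a + 200 ≤ poly C a := by
    have h2 : PolyBdd fun a => 2 * a := (PolyBdd.const 2).mul .id
    have h3 : ∀ k l, PolyBdd fun a => k * a + l := fun k l =>
      ((PolyBdd.const k).mul .id).add (.const l)
    refine PolyBdd.exists_poly ((((((h2.comp_poly c).add (.const 240)).mul
      (PolyBdd.id.add (.const 2))).add ((PolyBdd.const 71).mul (PolyBdd.id.add (.const 2)))).add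
      ((PolyBdd.id.add (.const 1)).mul (h3 80 200))).add ((PolyBdd.const 20).mul .id) |>.add
      (.const 200))
  have hm : ∀ {a b : ℕ}, a ≤ b → poly c (2 * a) ≤ poly c (2 * b) := fun h => poly_mono (by omega)
  refine ⟨S.combined, C, combined_classical hS, fun lam q hl hq => ?_⟩
  have e1 : (poly c (2 * (lam + q)) + 240) * (lam + 2) ≤ poly C (lam + q) := by
    refine le_trans ?_ (hC (lam + q) (by omega))
    have : (poly c (2 * (lam + q)) + 240) * (lam + 2) ≤
      (poly c (2 * (lam + q)) + 240) * (lam + q + 2) := Nat.mul_le_mul_left _ (by omega)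
    omega
  have e2 : ∀ n, poly c (2 * (lam + q + n)) + 71 * (lam + 2) + (lam + 1) * (80 * n + 200) +
      20 * lam + 200 ≤ poly C (lam + q + n) := by
    intro n
    refine le_trans ?_ (hC (lam + q + n) (by omega))
    have h1 : (lam + 1) * (80 * n + 200) ≤ (lam + q + n + 1) * (80 * (lam + q + n) + 200) :=
      Nat.mul_le_mul (by omega) (by omega)
    have h2 : (poly c (2 * (lam + q + n)) + 240) * 1 ≤
      (poly c (2 * (lam + q + n)) + 240) * (lam + q + n + 2) := Nat.mul_le_mul_left _ (by omega)
    omega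
  refine ⟨((combined_setup_computes hT hl hq).mono e1).yields, fun s hs => ⟨fun x hx =>
    ((combined_enc_computes hT hl hq hs hx).mono (le_trans (Nat.mul_le_mul_right _ (by omega))
      e1)).yields, fun f hf n hn => ⟨((combined_kg_computes hT hl hq hs hf hn).mono
      (e2 n)).yields, fun k hk => ⟨fun x hx e he =>
      ((combined_dec_computes hT hl hq hs hf hn hk hx he).mono (le_trans ?_ (e2 n))).yieldsClassical,
      (((combined_cert_computes hT hl hq hs hf hn hk).1).mono (le_trans ?_ (e2 n))).yieldsClassical,
      fun z => (((combined_cert_computes hT hl hq hs hf hn hk).2 z).mono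
        (le_trans ?_ (e2 n))).yields⟩⟩⟩⟩
  all_goals omega

end

end Algs

/-! ## Correctness of the construction -/

namespace Ens

/-- The expectation of a function of the classical outcome. -/
noncomputable def expect (E : Ens) (g : Data → ℝ) : ℝ := (E.map fun r => r.2.normSq * g r.1).sum

theorem expect_congr {E : Ens} {g g' : Data → ℝ} (h : ∀ r ∈ E, g r.1 = g' r.1) :
    E.expect g = E.expect g' := by
  unfold expect
  congr 1
  exact List.map_congr_left fun r hr => by rw [h r hr]

theorem expect_const (E : Ens) (y : ℝ) : E.expect (fun _ => y) = E.expect (fun _ => 1) * y := by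
  simp [expect, List.sum_map_mul_right]

theorem expect_mapVal (E : Ens) (h : Data → Data) (g : Data → ℝ) :
    (E.mapVal h).expect g = E.expect fun a => g (h a) := by
  simp [expect, mapVal, Function.comp_def]

theorem expect_bind (E : Ens) (K : Data → Ens) (g : Data → ℝ) :
    (E.bind K).expect g = E.expect fun a => (K a).expect g := by
  induction E with
  | nil => rfl
  | cons r E ih =>
    simp only [expect, bind, List.flatMap_cons, List.map_append, List.sum_append, List.map_cons,
      List.sum_cons] at ih ⊢
    rw [ih]
    congr 1
    simp only [after, List.map_map, Function.comp_def, QMem.normSq_tensor, mul_assoc,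
      List.sum_map_mul_left]

theorem expect_lists_one {es : List Ens} (h : ∀ e ∈ es, e.expect (fun _ => 1) = 1) :
    (lists es).expect (fun _ => 1) = 1 := by
  induction es with
  | nil => simp [lists_nil, pure, expect, QMem.normSq_empty]
  | cons e es ih =>
    rw [lists_cons, expect_bind]
    simp only [expect_mapVal]
    rw [ih fun e he => h e (List.mem_cons_of_mem _ he)]
    exact h e (List.mem_cons_self ..)

/-- The distribution of a single entry of independent samples. -/
theorem expect_lists {es : List Ens} (h : ∀ e ∈ es, e.expect (fun _ => 1) = 1) (g : Data → ℝ)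
    (i : ℕ) (hi : i < es.length) :
    (lists es).expect (fun d => g (d.toList.getD i .nil)) = es[i].expect g := by
  induction es generalizing i with
  | nil => simp at hi
  | cons e es ih =>
    have h' := fun e he => h e (List.mem_cons_of_mem _ he)
    rw [lists_cons, expect_bind]
    simp only [expect_mapVal, Data.toList]
    cases i with
    | zero =>
      simp only [List.getD_cons_zero, List.getElem_cons_zero]
      refine expect_congr fun r _ => ?_
      rw [expect_const, expect_lists_one h', one_mul]
    | succ i =>
      simp only [List.getD_cons_succ, List.getElem_cons_succ]
      rw [ih h' i (by simpa using hi), expect_const, h e (List.mem_cons_self ..), one_mul]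

end Ens

theorem Prog.HaltsIn.expect_one {p : Prog} {v : Data} {C : ℕ} (h : p.HaltsIn v QMem.empty C) :
    (p.out v QMem.empty).expect (fun _ => 1) = 1 := by
  have := h.mass_out
  rw [QMem.normSq_empty] at this
  simpa [Ens.expect] using this

namespace Algs

open Prog

variable {S : Algs} {𝓕 : FunClass} {c lam q : ℕ}

theorem expect_instances_setup (hT : S.Times 𝓕 c) (hl : 0 < lam) (hq : 0 < q) (g : Data → ℝ)
    {k : ℕ} (hk : 0 < k) (hkl : k ≤ lam) :
    (S.instances.setup lam q).expect (fun msk => g (msk.toList.getD (k - 1) .nil)) =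
      ((S.atBound (2 ^ k)).setup lam q).expect g := by
  rw [instances_setup, Ens.expect_lists _ g (k - 1) (by simp; omega)]
  · simp [Nat.sub_add_cancel hk]
  · intro e he
    obtain ⟨i, -, rfl⟩ := List.mem_map.1 he
    exact (hT.setup hl hq).expect_one

/-- Decryption looks at one master key and one ciphertext component. The other components are
independent and have total probability one, because `Setup` and `Enc` halt, so they drop out of the
sums. -/
theorem instances_decProb (hT : S.Times 𝓕 c) (hl : 0 < lam) (hq : 0 < q) (n : ℕ) (f : Data)
    {x : Data} (hx : x ∈ 𝓕.X lam) (y : Data) :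
    S.instances.decProb lam q n f x y =
      (S.atBound (2 ^ level lam n)).decProb lam q (2 ^ level lam n) f x y := by
  have hk0 : 0 < level lam n := level_pos hl n
  have hkl := level_le lam n
  unfold SKL.decProb
  refine Eq.trans ?_ (expect_instances_setup hT hl hq (fun a =>
    (((S.atBound (2 ^ level lam n)).kg a f (2 ^ level lam n)).map fun k =>
      (((S.atBound (2 ^ level lam n)).enc a x).map fun e => e.2.normSq *
        ((S.atBound (2 ^ level lam n)).dec k.1.fst k.2 e.1).prob y).sum).sum) hk0 hkl)
  unfold Ens.expect
  refine congrArg List.sum (List.map_congr_left fun s hs => congrArg (s.2.normSq * ·) ?_)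
  obtain ⟨h1, h2⟩ := mem_instances_setup hs
  rw [instances_kg, h1]
  simp only [Ens.mapVal, List.map_map]
  refine congrArg List.sum (List.map_congr_left fun k _ => ?_)
  rw [instances_enc]
  have h3 := Ens.expect_lists (es := s.1.toList.map fun a => S.enc.out (.cons a x) QMem.empty)
    (fun e he => by
      obtain ⟨a, ha, rfl⟩ := List.mem_map.1 he
      obtain ⟨i, hi, m, hm⟩ := exists_of_mem_toList hs ha
      exact (hT.enc hl hq hm hx).expect_one)
    (fun ct => (S.dec.out (.cons k.1.fst ct) k.2).prob y) (level lam n - 1)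
    (by rw [List.length_map]; omega)
  rw [List.getElem_map] at h3
  rw [List.getD_eq_getElem _ _ (by omega)]
  refine Eq.trans ?_ h3
  unfold Ens.expect
  refine congrArg List.sum (List.map_congr_left fun e _ => congrArg (e.2.normSq * ·) ?_)
  simp [instances, atBound, Data.fst, Data.snd, Data.len_unary]

theorem instances_vrfyProb (hT : S.Times 𝓕 c) (hl : 0 < lam) (hq : 0 < q) (n : ℕ) (f : Data) :
    S.instances.vrfyProb lam q n f =
      (S.atBound (2 ^ level lam n)).vrfyProb lam q (2 ^ level lam n) f := by
  have hk0 : 0 < level lam n := level_pos hl n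
  have hkl := level_le lam n
  unfold SKL.vrfyProb
  refine Eq.trans ?_ (expect_instances_setup hT hl hq (fun a =>
    (((S.atBound (2 ^ level lam n)).kg a f (2 ^ level lam n)).map fun k =>
      (((S.atBound (2 ^ level lam n)).cert k.1.fst k.2).map fun z => z.2.normSq *
        ((((S.atBound (2 ^ level lam n)).vrfy k.1.snd z.1).filter fun r => r.1 ≠ .nil).map
          fun r => r.2.normSq).sum).sum).sum) hk0 hkl)
  unfold Ens.expect
  refine congrArg List.sum (List.map_congr_left fun s hs => congrArg (s.2.normSq * ·) ?_)
  obtain ⟨h1, h2⟩ := mem_instances_setup hs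
  rw [instances_kg, h1]
  simp only [Ens.mapVal, List.map_map]
  rfl

end Algs

theorem Negligible.abs {ν : ℕ → ℝ} (h : Negligible ν) : Negligible fun lam => |ν lam| := by
  refine Asymptotics.SuperpolynomialDecay.trans_abs_le h fun n => ?_
  rw [abs_abs]

theorem Negligible.sum {ν : ℕ → ℕ → ℝ} (K : ℕ) (h : ∀ k, Negligible (ν k)) :
    Negligible fun lam => ∑ k ∈ Finset.range K, ν k lam := by
  induction K with
  | zero =>
    simp only [Finset.range_zero, Finset.sum_empty]
    exact Asymptotics.superpolynomialDecay_zero _ _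
  | succ K ih =>
    simp only [Finset.sum_range_succ]
    exact Asymptotics.SuperpolynomialDecay.add ih (h K)

/-- The sum of the absolute values of finitely many negligible errors is a common error for all of
them. The index `i` stands for plaintexts and functions, over which the bounds are already uniform.
-/
theorem exists_negligible {ι : ℕ → Type*} {P : ∀ lam, ℕ → ι lam → ℝ} (K : ℕ)
    (h : ∀ k, ∃ ν : ℕ → ℝ, Negligible ν ∧ ∀ lam, 0 < lam → ∀ i, 1 - ν lam ≤ P lam k i) :
    ∃ ν : ℕ → ℝ, Negligible ν ∧ ∀ lam, 0 < lam → ∀ k < K, ∀ i, 1 - ν lam ≤ P lam k i := by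
  choose ν hν h using h
  refine ⟨_, Negligible.sum K fun k => (hν k).abs, fun lam hl k hk i => ?_⟩
  have h1 := h k lam hl i
  have h2 : |ν k lam| ≤ ∑ k ∈ Finset.range K, |ν k lam| :=
    Finset.single_le_sum (f := fun k => |ν k lam|) (fun _ _ => abs_nonneg _)
      (Finset.mem_range.2 hk)
  have := le_abs_self (ν k lam)
  linarith

/-- For fixed `n` the level is at most `max 1 (Nat.clog 2 n)`, whatever `lam` is. Only finitely many
static schemes are involved, and their errors can be added. -/
theorem Algs.instances_correct {S : Algs} {𝓕 : FunClass} {c : ℕ} (hT : S.Times 𝓕 c)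
    (hS : ∀ q n : ℕ, 0 < q → 0 < n → (S.atBound n).CorrectAt 𝓕 q n) {q : ℕ} (hq : 0 < q) (n : ℕ) :
    S.instances.CorrectAt 𝓕 q n := by
  have hk : ∀ lam, level lam n < max 1 (Nat.clog 2 n) + 1 := fun lam =>
    Nat.lt_succ_of_le (min_le_right _ _)
  have hC := fun k => hS q (2 ^ k) hq (Nat.two_pow_pos k)
  constructor
  · obtain ⟨ν, hν, h⟩ := exists_negligible (ι := fun lam => 𝓕.X lam × 𝓕.F lam)
      (P := fun lam k i => (S.atBound (2 ^ k)).decProb lam q (2 ^ k) i.2 i.1 (𝓕.ev lam i.2 i.1))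
      (max 1 (Nat.clog 2 n) + 1) (fun k => by
        obtain ⟨ν, hν, h⟩ := (hC k).1
        exact ⟨ν, hν, fun lam hl i => h lam hl _ i.1.2 _ i.2.2⟩)
    refine ⟨ν, hν, fun lam hl x hx f hf => ?_⟩
    rw [instances_decProb hT hl hq n f hx]
    exact h lam hl _ (hk lam) (⟨x, hx⟩, ⟨f, hf⟩)
  · obtain ⟨ν, hν, h⟩ := exists_negligible (ι := fun lam => 𝓕.F lam)
      (P := fun lam k i => (S.atBound (2 ^ k)).vrfyProb lam q (2 ^ k) i)
      (max 1 (Nat.clog 2 n) + 1) (fun k => by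
        obtain ⟨ν, hν, h⟩ := (hC k).2
        exact ⟨ν, hν, fun lam hl i => h lam hl _ i.2⟩)
    refine ⟨ν, hν, fun lam hl f hf => ?_⟩
    rw [instances_vrfyProb hT hl hq n f]
    exact h lam hl _ (hk lam) ⟨f, hf⟩

/-- The construction is an SKFE-SKL scheme. -/
theorem Algs.instances_isScheme {S : Algs} {𝓕 : FunClass} (hS : S.IsStaticScheme 𝓕) :
    S.instances.IsScheme 𝓕 := by
  obtain ⟨c, hT⟩ := hS.exists_times
  exact ⟨instances_polyTime hT hS.1, fun q n hq _ => instances_correct hT hS.2.2.2 hq n⟩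

end KeyLeasing

namespace KeyLeasing

open Data (unary binary ofList)

/-! ## Deterministic decision procedures -/

namespace Prog

theorem derand_derand (p : Prog) : p.derand.derand = p.derand := by
  induction p <;> simp_all [derand]

theorem IsClassical.derand {p : Prog} (hp : p.IsClassical) : p.derand.IsClassical := by
  induction p <;> simp_all [Prog.derand, IsClassical]

/-- The branch in which all coins are `false` is a genuine outcome of the random program, so its
answer has the properties that are known of all outcomes. -/
theorem IsClassical.derand_det {p : Prog} (hp : p.IsClassical) {v : Data} {C : ℕ}
    (h : p.HaltsIn v QMem.empty C) :
    ∃ a, (∃ m, (a, m) ∈ p.out v QMem.empty) ∧ p.derand.Det v a C := by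
  obtain ⟨val, cost, he, r, hr, rfl, rfl⟩ := hp.selects_derand C v QMem.empty QMem.empty
  obtain ⟨s, hs, hv, -, hc⟩ := (h.gives le_rfl).exists_of_mem hr
  refine ⟨s.1, ⟨s.2, hs⟩, fun m T hT => ?_⟩
  rw [hv] at he
  have h1 := run_mono hT p.derand v QMem.empty (by simp [he, Branch.AllReturn])
  -- The derandomised program is its own derandomisation. Comparing it with itself carries the run
  -- from the empty memory over to `m`.
  obtain ⟨val, cost, he', r', hr', rfl, rfl⟩ :=
    hp.derand.selects_derand T v m QMem.empty
  rw [derand_derand] at he'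
  rw [h1, he, List.mem_singleton] at hr'
  subst hr'
  rw [he', Ens.after_pure]
  exact .cons ⟨rfl, rfl, hc⟩ .nil

end Prog

/-- Deterministic programs, with running time `D`, for membership in the plaintext and function
spaces and for the evaluation of functions. -/
structure Deciders (𝓕 : FunClass) (pX pF pE : Prog) (lam D : ℕ) : Prop where
  plaintext : ∀ d, ∃ a, (a ≠ .nil ↔ d ∈ 𝓕.X lam) ∧ pX.Det (.cons (unary lam) d) a D
  function : ∀ d, ∃ a, (a ≠ .nil ↔ d ∈ 𝓕.F lam) ∧ pF.Det (.cons (unary lam) d) a D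
  eval : ∀ f ∈ 𝓕.F lam, ∀ x ∈ 𝓕.X lam,
    pE.Det (.cons (unary lam) (.cons f x)) (𝓕.ev lam f x) D

/-- Correctness on every branch survives derandomisation. Deterministic deciders test the conditions
of the simulated oracles without splitting the state. -/
theorem FunClass.Efficient.exists_deciders {𝓕 : FunClass} (h : 𝓕.Efficient) :
    ∃ (pX pF pE : Prog) (c : ℕ), ∀ lam, 0 < lam → Deciders 𝓕 pX pF pE lam (poly c lam) := by
  obtain ⟨pX, pF, pE, c, hX, hF, hE, h⟩ := h
  refine ⟨pX.derand, pF.derand, pE.derand, c, fun lam hl => ⟨fun d => ?_, fun d => ?_,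
    fun f hf x hx => ?_⟩⟩
  · obtain ⟨a, ⟨m, hm⟩, ha⟩ := hX.derand_det ((h lam hl).1 d).1
    exact ⟨a, ((h lam hl).1 d).2 _ hm, ha⟩
  · obtain ⟨a, ⟨m, hm⟩, ha⟩ := hF.derand_det ((h lam hl).2.1 d).1
    exact ⟨a, ((h lam hl).2.1 d).2 _ hm, ha⟩
  · obtain ⟨a, ⟨m, hm⟩, ha⟩ := hE.derand_det ((h lam hl).2.2 f hf x hx).1
    have := ((h lam hl).2.2 f hf x hx).2 _ hm
    rwa [show a = 𝓕.ev lam f x from this] at ha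

/-! ## The reduction -/

/-- What the reduction remembers of a key: function, availability bound, verification key (if the
key is one of a simulated instance), number of the instance, and whether the key forbids the
challenge. -/
structure SimKey where
  f : Data
  n : Data
  idx : ℕ
  vk : Data
  bad : Bool

/-- The state of the reduction: master secret keys of the simulated instances, below and above the
instance in charge of the challenger, and the data of the session. -/
structure Sim where
  keys : List SimKey
  encs : ℕ
  challenged : Bool
  lam : ℕ
  x₀ : Data
  x₁ : Data
  q : ℕ
  pre : List Data
  suf : List Data

/-- The tree with two leaves. -/
def Data.one : Data := .cons .nil .nil

def SimKey.code (e : SimKey) : Data :=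
  .cons e.f (.cons e.n (.cons (unary e.idx) (.cons e.vk (Data.bit e.bad))))

namespace Sim

/-- The master secret keys, with `nil` for that of the challenger. -/
def all (b : Sim) : List Data := b.pre ++ .nil :: b.suf

/-- The length of `pre` and the list `all` are redundant. They are stored so that the index of the
challenger's instance can be compared, and the key of a simulated instance looked up by its index,
directly. -/
def code (b : Sim) : Data :=
  .cons (ofList (b.keys.map SimKey.code)) (.cons (unary b.encs) (.cons (Data.bit b.challenged)
    (.cons (unary b.lam) (.cons b.x₀ (.cons b.x₁ (.cons (unary b.q) (.cons (unary b.pre.length)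
      (.cons (ofList b.all) (.cons (ofList b.pre) (ofList b.suf))))))))))

end Sim

namespace Reduction

open Prog

/-! ### States and messages

The classical state of the reduction contains that of the adversary, its own state and the reply to
the adversary in case the challenger refuses, and its own state, a mode and a payload from which the
reply to the adversary is made up otherwise. -/

def st (aS body rep mode body' payload : Data) : Data :=
  .cons .one (.cons aS (.cons (.cons body rep) (.cons mode (.cons body' payload))))

/-- The reply `rep` to the adversary does not depend on the challenger, who receives a message that
is always refused. -/
def answer (aS body rep : Data) : Data :=
  .cons (st aS body rep .nil body rep) (.cons .one .nil)

/-- The reply to the adversary depends on the reply of the challenger to the message `msg`. -/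
def ask (aS body mode body' payload msg : Data) : Data :=
  .cons (st aS body .nil mode body' payload) msg

/-- The payload is the reply to the adversary. -/
def plain : Data := .nil

/-- The reply to the adversary is a key of the instance of the challenger. -/
def keyMode : Data := .one

/-- The reply to the adversary is a list of ciphertexts, with that of the challenger. -/
def encMode : Data := .cons .one .nil

/-! ### Access to parts of the input -/

def sndN : ℕ → Prog
  | 0 => id
  | n + 1 => seq snd (sndN n)

def fld (n : ℕ) : Prog := seq (sndN n) fst

def up : ℕ → Prog
  | 0 => id
  | n + 1 => seq fst (up n)

/-- An intermediate result. -/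
def res (j : ℕ) : Prog := seq (up j) snd

/-- A part of the state of the reduction, after `j` intermediate results. -/
def own (j : ℕ) (p : Prog) : Prog := seq (up j) (seq (seq fst snd) p)

/-- The state of the adversary. -/
def advSt (j : ℕ) : Prog := seq (up j) (seq snd fst)

/-- A part of the message of the adversary, without its tag. -/
def arg (j : ℕ) (p : Prog) : Prog := seq (up j) (seq (seq snd (seq snd snd)) p)

/-! ### Preparation of the reply to the adversary -/

/-- The first test separates the initial input `1^lam`, whose first entry is `nil`, from a state of
the reduction, which starts with a mark. The second one separates `nil` from the other replies. The
remaining two distinguish the modes. The result is the information for `postP`, paired with the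
input for the adversary. -/
def preP : Prog :=
  cond (seq fst fst)
    (cond snd
      (cond (seq fst (fld 3))
        (cond (seq fst (seq (fld 3) fst))
          (call (pair (seq fst (seq (sndN 5) fst)) (pair (seq snd snd) (seq fst (seq (sndN 5) snd))))
            appendP (pair (pair tt (seq fst (seq fst (fld 4))))
              (pair (seq fst (seq fst (fld 1))) (pair zero snd))))
          (pair (pair tt (seq fst (fld 4)))
            (pair (seq fst (fld 1)) (pair zero (pair (seq fst (sndN 5)) (seq snd snd))))))
        (pair (pair tt (seq fst (fld 4))) (pair (seq fst (fld 1)) (seq fst (sndN 5)))))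
      (pair (pair tt (seq fst (seq (fld 2) fst)))
        (pair (seq fst (fld 1)) (seq fst (seq (fld 2) snd)))))
    (pair (pair zero fst) id)

theorem preP_start {lam : ℕ} (hl : 0 < lam) :
    preP.Det (.cons (unary lam) .nil) (.cons (.cons .nil (unary lam)) (.cons (unary lam) .nil))
      50 := by
  obtain ⟨n, rfl⟩ := Nat.exists_eq_succ_of_ne_zero hl.ne'
  refine Det.mono (Framed.cond_false (det_of_eval rfl ?_) (det_of_eval rfl ?_)) ?_
  · rw [Data.unary_succ]; rfl
  · rfl
  · simp [weight]

theorem preP_refused (aS body rep mode body' payload : Data) :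
    preP.Det (.cons (st aS body rep mode body' payload) .nil)
      (.cons (.cons .one body) (.cons aS rep)) 100 := by
  refine Det.mono (Framed.cond_true (a := .one) (det_of_eval rfl ?_) (by simp [Data.one])
    (Framed.cond_false (det_of_eval rfl ?_) (det_of_eval rfl ?_))) ?_
  · rfl
  · rfl
  · rfl
  · simp [weight, fld, sndN, tt]

theorem preP_plain (aS body rep body' payload r : Data) (hr : r ≠ .nil) :
    preP.Det (.cons (st aS body rep plain body' payload) r)
      (.cons (.cons .one body') (.cons aS payload)) 150 := by
  refine Det.mono (Framed.cond_true (a := .one) (det_of_eval rfl ?_) (by simp [Data.one])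
    (Framed.cond_true (a := r) (det_of_eval rfl ?_) hr
      (Framed.cond_false (det_of_eval rfl ?_) (det_of_eval rfl ?_)))) ?_
  · rfl
  · rfl
  · rfl
  · rfl
  · simp [weight, fld, sndN, tt]

theorem preP_key (aS body rep body' payload r : Data) (hr : r ≠ .nil) :
    preP.Det (.cons (st aS body rep keyMode body' payload) r)
      (.cons (.cons .one body') (.cons aS (Data.ok (.cons payload r.snd)))) 150 := by
  refine Det.mono (Framed.cond_true (a := .one) (det_of_eval rfl ?_) (by simp [Data.one])
    (Framed.cond_true (a := r) (det_of_eval rfl ?_) hr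
      (Framed.cond_true (a := .one) (det_of_eval rfl ?_) (by simp [Data.one])
        (Framed.cond_false (det_of_eval rfl ?_) (det_of_eval rfl ?_))))) ?_
  · rfl
  · rfl
  · rfl
  · rfl
  · rfl
  · simp [weight, fld, sndN, tt]

theorem preP_enc (aS body rep body' P Q r : Data) (hr : r ≠ .nil) :
    preP.Det (.cons (st aS body rep encMode body' (.cons P Q)) r)
      (.cons (.cons .one body') (.cons aS (Data.ok (P.append (.cons r.snd Q)))))
      (40 * P.len + 300) := by
  refine Det.mono (Framed.cond_true (a := .one) (det_of_eval rfl ?_) (by simp [Data.one])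
    (Framed.cond_true (a := r) (det_of_eval rfl ?_) hr
      (Framed.cond_true (a := encMode) (det_of_eval rfl ?_) (by simp [encMode])
        (Framed.cond_true (a := .one) (det_of_eval rfl ?_) (by simp [Data.one])
          (Framed.call_det rfl ?_ (appendP_det P (.cons r.snd Q)) (det_of_eval rfl ?_)))))) ?_
  · rfl
  · rfl
  · rfl
  · rfl
  · rfl
  · rfl
  · simp [weight, fld, sndN, tt]
    omega

/-! ### Treatment of the messages of the adversary -/

def ansP (j : ℕ) (body rep : Prog) : Prog :=
  pair (pair tt (pair (advSt j) (pair (pair body rep) (pair zero (pair body rep))))) (pair tt zero)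

def askP (j : ℕ) (mode body payload msg : Prog) : Prog :=
  pair (pair tt (pair (advSt j) (pair (pair (own j id) zero) (pair mode (pair body payload))))) msg

/-- The final guess `0`. -/
def guessP : Prog := pair zero zero

def refuseP (j : ℕ) : Prog := ansP j (own j id) zero

def encP (S : Algs) (pX : Prog) : Prog :=
  call (pair (own 0 (fld 3)) (arg 0 id)) pX
    (cond (res 0)
      (call (pair (own 1 (fld 9)) (arg 1 id)) (mapP S.enc)
        (call (pair (own 2 (sndN 10)) (arg 2 id)) (mapP S.enc)
          (askP 3 (pair tt zero)
            (pair (own 3 (fld 0)) (pair (pair zero (own 3 (fld 1))) (own 3 (sndN 2))))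
            (pair (res 1) (res 0)) (pair (pair zero tt) (arg 3 id)))))
      (refuseP 1))

/-- Is the second component an entry for the function in the first component? -/
def sameFun : Prog := seq (pair fst (seq snd fst)) eq

/-- Does the key in the second component forbid the challenge? -/
def isBad : Prog := seq snd (sndN 4)

def chalP (S : Algs) : Prog :=
  cond (own 0 (fld 2)) (refuseP 0)
    (call (pair zero (pair zero (own 0 (fld 0)))) (splitP isBad)
      (cond (seq (res 0) snd) guessP
        (call (pair (own 1 (fld 9)) (own 1 (fld 5))) (mapP S.enc)
          (call (pair (own 2 (sndN 10)) (own 2 (fld 4))) (mapP S.enc)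
            (askP 3 (pair tt zero)
              (pair (own 3 (fld 0)) (pair (own 3 (fld 1)) (pair tt (own 3 (sndN 3)))))
              (pair (res 1) (res 0)) (pair (pair zero (pair zero (pair zero (pair zero tt)))) zero))))))

/-- The list of keys with a new entry at its end. -/
def addKey (j : ℕ) (idx vk bad : Prog) : Prog :=
  pair (own j (fld 0)) (pair (pair (arg j fst) (pair (arg j snd) (pair idx (pair vk bad)))) zero)

/-- The tests are those of the simulated challenger, so the static challenger is asked only for keys
that the simulation grants. For such a key the verification key remains unknown and `nil` is stored
instead; certificates for it are checked by the challenger. -/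
def kgP (S : Algs) (pF pE : Prog) : Prog :=
  call (pair (own 0 (fld 3)) (arg 0 fst)) pF
    (cond (res 0)
      (call (pair (own 1 (fld 0)) (own 1 (fld 6))) ltP
        (cond (cond (res 0) (arg 2 snd) zero)
          (call (pair (own 2 (fld 3)) (pair (arg 2 fst) (own 2 (fld 4)))) pE
            (call (pair (own 3 (fld 3)) (pair (arg 3 fst) (own 3 (fld 5)))) pE
              (call (pair (res 1) (res 0)) (cond eq zero tt)
                (cond (cond (own 5 (fld 2)) (res 0) zero)
                  (refuseP 5)
                  (call (pair (own 5 (fld 3)) (arg 5 snd)) levelP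
                    (cond (seq (pair (res 0) (own 6 (fld 7))) eq)
                      (call (addKey 6 (res 0) zero (res 1)) appendP
                        (askP 7 tt (pair (res 0) (own 7 (sndN 1))) (pair zero (res 1))
                          (pair (pair zero (pair zero tt)) (pair (arg 7 fst) zero))))
                      (call (pair (res 0) (own 6 (fld 8))) nthP
                        (call (pair (res 0) (arg 7 fst)) (frame S.kg)
                          (call (addKey 8 (res 2) (seq (res 0) snd) (res 3)) appendP
                            (ansP 9 (pair (res 0) (own 9 (sndN 1)))
                              (pair zero (pair (pair zero (res 3)) (seq (res 1) fst)))))))))))))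
          (refuseP 2)))
      (refuseP 1))

/-- The first entry found by the search, after `j` further results. -/
def found (j : ℕ) (p : Prog) : Prog := seq (res j) (seq (seq snd fst) p)

/-- A certificate for a key of the challenger's instance is forwarded even if the bound of this key
is exhausted. In that case the adversary gets a refusal whatever the challenger replies. -/
def vrfyP (S : Algs) : Prog :=
  call (pair (arg 0 fst) (pair zero (own 0 (fld 0)))) (splitP sameFun)
    (cond (seq (res 0) snd)
      (call (pair (own 1 (fld 1)) (found 0 (fld 1))) ltP
        (call (pair (seq (res 1) fst) (pair (pair (found 1 (fld 0)) (pair (found 1 (fld 1))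
            (pair (found 1 (fld 2)) (pair (found 1 (fld 3)) zero)))) (seq (res 1) (seq snd snd))))
            revAppP
          (cond (seq (pair (found 2 (fld 2)) (own 3 (fld 7))) eq)
            (askP 3 zero (cond (res 1) (pair (res 0) (own 3 (sndN 1))) (own 3 id))
              (cond (res 1) (pair zero zero) zero)
              (pair (pair zero (pair zero (pair zero tt))) (arg 3 id)))
            (call (pair (found 2 (fld 3)) (arg 3 snd)) (frame S.vrfy)
              (cond (cond (res 0) (res 2) zero)
                (ansP 4 (pair (res 1) (own 4 (sndN 1))) (pair zero zero))
                (refuseP 4))))))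
      (refuseP 1))

/-- The number `1` in binary. -/
def oneP : Prog := pair tt zero

/-- The security parameter, in the first activation. -/
def lamP (j : ℕ) : Prog := own j id

/-- Openings that would end the experiment are answered by the guess `0`, and so is a random index
that is not below `lam`. The availability bound declared by the adversary plays no role; the power
of two belonging to the random index is declared in its place. -/
def startP (S : Algs) (pX : Prog) : Prog :=
  cond (cond (seq snd (seq snd fst)) (cond (seq snd (seq snd (seq fst snd))) zero (arg 0 fst)) zero)
    (call (pair (lamP 0) (arg 0 (fld 2))) pX
      (call (pair (lamP 1) (arg 1 (sndN 3))) pX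
        (cond (cond (res 1) (res 0) zero)
          (call (pair (arg 2 fst) zero) normP
            (call (lamP 3) sampleP
              (call (pair (res 0) (lamP 4)) ltP
                (cond (res 0)
                  (call (pair (res 1) (pair oneP zero)) genP
                    (call (pair (seq (res 0) (sndN 2)) (pair (lamP 6) (res 3))) (setupListP S)
                      (call (pair (pair zero (res 3)) (lamP 7)) dropP
                        (call (pair (res 0) (pair (pair zero (seq (res 2) (fld 1))) zero)) genP
                          (call (pair (seq (res 0) (sndN 2)) (pair (lamP 9) (res 6))) (setupListP S)
                            (call (pair (res 3) (pair zero (res 0))) appendP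
                              (pair (pair tt (pair (advSt 11)
                                (pair (pair (startBody) zero) (pair zero (pair (startBody) zero)))))
                                (pair tt (pair (res 8) (pair (pair zero (seq (res 5) (fld 1)))
                                  (pair (arg 11 (fld 2)) (arg 11 (sndN 3)))))))))))))
                  guessP))))
          guessP)))
    guessP
where
  /-- The state of the reduction after the opening message. -/
  startBody : Prog :=
    pair zero (pair zero (pair zero (pair (lamP 11) (pair (arg 11 (fld 2)) (pair (arg 11 (sndN 3))
      (pair (res 8) (pair (res 7) (pair (res 0) (pair (res 4) (res 1))))))))))

/-- The tag of the message. -/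
def tagP (p : Prog) : Prog := seq snd (seq snd (seq fst p))

def postP (S : Algs) (pX pF pE : Prog) : Prog :=
  cond (seq fst fst)
    (cond (tagP id)
      (cond (tagP (sndN 1))
        (cond (tagP (sndN 2))
          (cond (tagP (sndN 3))
            (cond (tagP (sndN 4)) (chalP S) (vrfyP S))
            (kgP S pF pE))
          (encP S pX))
        (refuseP 0))
      (pair zero (seq snd snd)))
    (startP S pX)

/-- The adversary against the scheme with static availability bound. -/
def adversary (S : Algs) (pX pF pE A : Prog) : Prog :=
  seq preP (seq (pair fst (seq snd A)) (postP S pX pF pE))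

end Reduction

end KeyLeasing

namespace KeyLeasing

open Data (unary binary ofList)

namespace Reduction

open Prog

theorem _root_.KeyLeasing.Prog.Framed.call_le {arg q r : Prog} {v w : Data} {C C' T : ℕ} {E : Ens}
    {K : Data → Ens} (harg : arg.simple = true) (hw : arg.eval v = w) (hq : q.Framed w C E)
    (hr : ∀ s ∈ E, r.Framed (.cons v s.1) C' (K s.1)) (hT : arg.weight + C + C' + 5 ≤ T) :
    (Prog.call arg q r).Framed v T (E.bind K) := (Framed.call harg hw hq hr).mono hT

theorem _root_.KeyLeasing.Prog.det_le {p : Prog} {v a : Data} {T : ℕ} (hp : p.simple = true)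
    (h : p.eval v = a) (hT : p.weight ≤ T) : p.Framed v T (Ens.pure a) :=
  (det_of_eval hp h).mono hT

/-! ### Behaviour of the reduction -/

/-- A polynomial budget for one activation of the reduction. -/
def budget (D N : ℕ) : ℕ := (D + 1) * (N + 1) ^ 2

theorem le_budget (D N : ℕ) : 1 ≤ budget D N ∧ N ≤ budget D N ∧ D ≤ budget D N := by
  unfold budget
  refine ⟨Nat.one_le_iff_ne_zero.2 (by positivity), ?_, ?_⟩ <;> nlinarith [Nat.zero_le (D * N ^ 2),
    Nat.zero_le (D * N), Nat.zero_le (N ^ 2)]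

theorem mul_le_budget {D N a c : ℕ} (ha : a ≤ N) :
    (D + c) * (a + 2) ≤ 2 * (c + 1) * budget D N := by
  have h1 : D + c ≤ (c + 1) * (D + 1) := by nlinarith [Nat.zero_le (c * D)]
  have h2 : a + 2 ≤ 2 * (N + 1) ^ 2 := by nlinarith
  calc (D + c) * (a + 2) ≤ ((c + 1) * (D + 1)) * (2 * (N + 1) ^ 2) := Nat.mul_le_mul h1 h2
    _ = _ := by unfold budget; ring

theorem level_le_budget {D N a n : ℕ} (ha : a ≤ N) (hn : n ≤ N) :
    (a + 1) * (80 * n + 200) ≤ 200 * budget D N := by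
  calc (a + 1) * (80 * n + 200) ≤ (N + 1) * (200 * (N + 1)) :=
        Nat.mul_le_mul (by omega) (by omega)
    _ = 200 * (N + 1) ^ 2 := by ring
    _ ≤ _ := by
      refine Nat.mul_le_mul_left _ ?_
      unfold budget
      exact Nat.le_mul_of_pos_left _ (Nat.succ_pos D)

/-- What is needed for the running time of an activation: the sizes of all numbers are at most `N`,
and the subroutines run in time `D`. -/
structure Fits (S : Algs) (𝓕 : FunClass) (D N : ℕ) (b : Sim) : Prop where
  lam_pos : 0 < b.lam
  lam_le : b.lam ≤ N
  keys_le : b.keys.length ≤ N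
  encs_le : b.encs ≤ N
  length_eq : b.pre.length + (b.suf.length + 1) = b.lam
  mem₀ : b.x₀ ∈ 𝓕.X b.lam
  mem₁ : b.x₁ ∈ 𝓕.X b.lam
  enc : ∀ k ∈ b.pre ++ b.suf, ∀ x ∈ 𝓕.X b.lam, S.enc.HaltsIn (.cons k x) QMem.empty D
  kg : ∀ k < b.lam, k ≠ b.pre.length → 2 ^ (k + 1) ≤ 2 * N → ∀ f ∈ 𝓕.F b.lam,
    S.kg.HaltsIn (.cons (b.all.getD k .nil) f) QMem.empty D ∧
      ∀ r ∈ S.kg.out (.cons (b.all.getD k .nil) f) QMem.empty, ∀ z,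
        S.vrfy.HaltsIn (.cons r.1.snd z) QMem.empty D
  vrfy : ∀ e ∈ b.keys, e.idx ≠ b.pre.length → ∀ z,
    S.vrfy.HaltsIn (.cons e.vk z) QMem.empty D

section

variable (S : Algs) (𝓕 : FunClass)

/-- Encryptions of `x` under the master secret keys `l`. -/
noncomputable def encs (l : List Data) (x : Data) : Ens :=
  Ens.lists (l.map fun k => S.enc.out (.cons k x) QMem.empty)

open Classical in
noncomputable def reactEnc (b : Sim) (aS x : Data) : Ens :=
  if x ∈ 𝓕.X b.lam then
    (encs S b.pre x).bind fun P => (encs S b.suf x).bind fun Q =>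
      Ens.pure (ask aS b.code encMode { b with encs := b.encs + 1 }.code (.cons P Q)
        (.cons (unary 2) x))
  else Ens.pure (answer aS b.code .nil)

noncomputable def reactChal (b : Sim) (aS : Data) : Ens :=
  if b.challenged then Ens.pure (answer aS b.code .nil)
  else if ∃ e ∈ b.keys, e.bad then Ens.pure (.cons .nil .nil)
  else (encs S b.pre b.x₁).bind fun P => (encs S b.suf b.x₀).bind fun Q =>
    Ens.pure (ask aS b.code encMode { b with challenged := true }.code (.cons P Q)
      (.cons (unary 5) .nil))

def _root_.KeyLeasing.Sim.addKey (b : Sim) (e : SimKey) : Sim := { b with keys := b.keys ++ [e] }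

open Classical in
noncomputable def reactKg (b : Sim) (aS f n : Data) : Ens :=
  if f ∈ 𝓕.F b.lam ∧ 0 < n.len ∧ b.keys.length < b.q ∧
      (b.challenged = true → 𝓕.ev b.lam f b.x₀ = 𝓕.ev b.lam f b.x₁) then
    let k := level b.lam n.len - 1
    let bad := decide (𝓕.ev b.lam f b.x₀ ≠ 𝓕.ev b.lam f b.x₁)
    if k = b.pre.length then
      Ens.pure (ask aS b.code keyMode (b.addKey ⟨f, n, k, .nil, bad⟩).code (unary (k + 1))
        (.cons (unary 3) (.cons f .nil)))
    else (S.kg.out (.cons (b.all.getD k .nil) f) QMem.empty).bind fun r =>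
      Ens.pure (answer aS (b.addKey ⟨f, n, k, r.snd, bad⟩).code
        (.ok (.cons (unary (k + 1)) r.fst)))
  else Ens.pure (answer aS b.code .nil)

/-- Removes the prohibition of the challenge from the first key for `f`. -/
def clearFirst (f : Data) : List SimKey → List SimKey
  | [] => []
  | e :: es => if e.f = f then { e with bad := false } :: es else e :: clearFirst f es

def _root_.KeyLeasing.Sim.clear (b : Sim) (f : Data) : Sim :=
  { b with keys := clearFirst f b.keys }

noncomputable def reactVrfy (b : Sim) (aS d : Data) : Ens :=
  match b.keys.find? fun e => e.f = d.fst with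
  | none => Ens.pure (answer aS b.code .nil)
  | some e =>
    if e.idx = b.pre.length then
      Ens.pure (if b.encs < e.n.len then
          ask aS b.code plain (b.clear d.fst).code (.ok .nil) (.cons (unary 4) d)
        else ask aS b.code plain b.code .nil (.cons (unary 4) d))
    else (S.vrfy.out (.cons e.vk d.snd) QMem.empty).bind fun r =>
      Ens.pure (if r ≠ .nil ∧ b.encs < e.n.len then answer aS (b.clear d.fst).code (.ok .nil)
        else answer aS b.code .nil)

end

theorem refuseP_det (b info a : Data) :
    (refuseP 0).Det (.cons (.cons info b) a) (answer a.fst b .nil) 100 :=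
  (det_of_eval rfl rfl).mono (by simp [weight, refuseP, ansP, own, advSt, up, tt])

variable {S : Algs} {𝓕 : FunClass} {pX pF pE : Prog} {D N : ℕ} {b : Sim}

theorem encs_framed {l : List Data} {x : Data}
    (h : ∀ k ∈ l, S.enc.HaltsIn (.cons k x) QMem.empty D) :
    (mapP S.enc).Framed (.cons (ofList l) x) ((D + 70) * (l.length + 2)) (encs S l x) :=
  mapP_framed l fun k hk => (h k hk).computes

theorem encP_framed (hD : Deciders 𝓕 pX pF pE b.lam D) (hb : Fits S 𝓕 D N b) (a : Data) :
    (encP S pX).Framed (.cons (.cons .one b.code) a) (9000 * budget D N)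
      (reactEnc S 𝓕 b a.fst a.snd.snd) := by
  obtain ⟨h1, h2, h3⟩ := le_budget D N
  have hl := hb.length_eq
  have hl' := hb.lam_le
  have e1 := mul_le_budget (D := D) (N := N) (a := b.pre.length) (c := 70) (by omega)
  have e2 := mul_le_budget (D := D) (N := N) (a := b.suf.length) (c := 70) (by omega)
  obtain ⟨y, hy, hX⟩ := hD.plaintext a.snd.snd
  unfold reactEnc
  split_ifs with hx
  · refine (Framed.call_det rfl rfl hX (Framed.cond_true (a := y) (det_of_eval rfl rfl) (hy.2 hx)
      (Framed.call (w := .cons (ofList b.pre) a.snd.snd) (C' := 1000 * budget D N) rfl rfl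
        (encs_framed fun k hk => hb.enc k (by simp [hk]) _ hx) fun s _ => ?_))).mono ?_
    on_goal 1 =>
      refine Framed.call_le (w := .cons (ofList b.suf) a.snd.snd) (C' := 500) rfl rfl
        (encs_framed fun k hk => hb.enc k (by simp [hk]) _ hx) (fun s' _ => ?_) ?_
    on_goal 1 => refine det_le rfl rfl ?_
    all_goals simp [weight, askP, own, advSt, arg, res, up, sndN, fld, tt]
    all_goals omega
  · have hy0 : y = .nil := by
      by_contra h
      exact hx (hy.1 h)
    subst hy0
    refine (Framed.call_det rfl rfl hX (Framed.cond_false (det_of_eval rfl rfl)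
      (det_of_eval rfl rfl))).mono ?_
    simp [weight, refuseP, ansP, own, advSt, arg, res, up, sndN, fld, tt]
    omega

theorem split_isBad (pre : List Data) (l : List SimKey) :
    (Data.split (fun x => decide (isBad.eval (.cons .nil x) ≠ .nil)) (ofList pre)
      (ofList (l.map SimKey.code))).snd ≠ .nil ↔ ∃ e ∈ l, e.bad := by
  induction l generalizing pre with
  | nil => simp [ofList, Data.split, Data.snd]
  | cons e l ih =>
    have h : isBad.eval (.cons .nil e.code) = Data.bit e.bad := rfl
    simp only [List.map_cons, ofList, Data.split, h]
    cases he : e.bad with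
    | true => simp [Data.bit, he, Data.snd]
    | false => simpa [Data.bit, he, ofList] using ih (e.code :: pre)

theorem splitP_isBad_det (l : List SimKey) : ∃ z, (z.snd ≠ .nil ↔ ∃ e ∈ l, e.bad) ∧
    (splitP isBad).Det (.cons .nil (.cons .nil (ofList (l.map SimKey.code)))) z
      (100 * (l.length + 1)) := by
  refine ⟨_, split_isBad [] l, (splitP_det (t := isBad) rfl .nil .nil _).mono ?_⟩
  rw [Data.len_ofList, List.length_map]
  exact Nat.mul_le_mul_right _ (by simp [isBad, weight, sndN])

theorem chalP_framed (hb : Fits S 𝓕 D N b) (a : Data) :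
    (chalP S).Framed (.cons (.cons .one b.code) a) (9000 * budget D N)
      (reactChal S b a.fst) := by
  obtain ⟨h1, h2, h3⟩ := le_budget D N
  have hl := hb.length_eq
  have hl' := hb.lam_le
  have hk := hb.keys_le
  have e1 := mul_le_budget (D := D) (N := N) (a := b.pre.length) (c := 70) (by omega)
  have e2 := mul_le_budget (D := D) (N := N) (a := b.suf.length) (c := 70) (by omega)
  obtain ⟨z, hz, hs⟩ := splitP_isBad_det b.keys
  unfold reactChal
  split_ifs with hc hbad
  · refine (Framed.cond_true (a := Data.bit b.challenged) (det_of_eval rfl rfl)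
      (by simp [hc, Data.bit]) (refuseP_det b.code .one a)).mono ?_
    simp [weight, own, up, sndN, fld]
    omega
  · refine (Framed.cond_false (det_of_eval rfl
      (by show Data.bit b.challenged = _; simp [hc, Data.bit]))
      (Framed.call_det rfl rfl hs (Framed.cond_true (a := z.snd) (det_of_eval rfl rfl) (hz.2 hbad)
        (det_of_eval rfl rfl)))).mono ?_
    simp [weight, guessP, own, res, up, sndN, fld]
    omega
  · refine (Framed.cond_false (det_of_eval rfl
      (by show Data.bit b.challenged = _; simp [hc, Data.bit]))
      (Framed.call_det rfl rfl hs (Framed.cond_false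
        (det_of_eval rfl (by show z.snd = .nil; exact by_contra fun h => hbad (hz.1 h)))
          (Framed.call (w := .cons (ofList b.pre) b.x₁) (C' := 1000 * budget D N) rfl rfl
            (encs_framed fun k hk => hb.enc k (by simp [hk]) _ hb.mem₁) fun s _ => ?_)))).mono ?_
    on_goal 1 =>
      refine Framed.call_le (w := .cons (ofList b.suf) b.x₀) (C' := 500) rfl rfl
        (encs_framed fun k hk => hb.enc k (by simp [hk]) _ hb.mem₀) (fun s' _ => ?_) ?_
    on_goal 1 => refine det_le rfl rfl ?_
    all_goals simp [weight, askP, own, advSt, res, up, sndN, fld, tt]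
    all_goals omega

theorem keys_code_append (b : Sim) (e : SimKey) :
    (ofList (b.keys.map SimKey.code)).append (.cons e.code .nil) =
      ofList ((b.addKey e).keys.map SimKey.code) := by
  rw [show Data.cons e.code .nil = ofList [e.code] from rfl, Data.append_ofList]
  simp [Sim.addKey]

theorem ite_bit_eq_nil {c d : Bool} (h : ¬ (c = true ∧ d = true)) :
    (if Data.bit c = .nil then Data.nil else Data.bit d) = .nil := by
  cases c <;> cases d <;> simp_all [Data.bit]

theorem kgP_framed (hD : Deciders 𝓕 pX pF pE b.lam D) (hb : Fits S 𝓕 D N b) (a : Data)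
    (hn : a.snd.snd.snd.len ≤ N) :
    (kgP S pF pE).Framed (.cons (.cons .one b.code) a) (9000 * budget D N)
      (reactKg S 𝓕 b a.fst a.snd.snd.fst a.snd.snd.snd) := by
  obtain ⟨h1, h2, h3⟩ := le_budget D N
  have hl := hb.length_eq
  have hl' := hb.lam_le
  have hk := hb.keys_le
  have e1 := level_le_budget (D := D) hl' hn
  obtain ⟨y, hy, hF⟩ := hD.function a.snd.snd.fst
  have hlt := ltP_det (ofList (b.keys.map SimKey.code)) (unary b.q)
  simp only [Data.len_ofList, List.length_map, Data.len_unary] at hlt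
  by_cases hf : a.snd.snd.fst ∈ 𝓕.F b.lam
  swap
  · rw [reactKg, if_neg fun h => hf h.1]
    have hy0 : y = .nil := by
      by_contra h
      exact hf (hy.1 h)
    subst hy0
    refine (Framed.call_det rfl rfl hF (Framed.cond_false (det_of_eval rfl rfl)
      (det_of_eval rfl rfl))).mono ?_
    simp [weight, refuseP, ansP, own, advSt, arg, res, up, sndN, fld, tt]
    omega
  by_cases hq : b.keys.length < b.q ∧ a.snd.snd.snd ≠ .nil
  swap
  · rw [reactKg, if_neg fun h => hq ⟨h.2.2.1, fun h' => by simp [h', Data.len] at h⟩]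
    refine (Framed.call_det rfl rfl hF (Framed.cond_true (a := y) (det_of_eval rfl rfl) (hy.2 hf)
      (Framed.call_det rfl rfl hlt (Framed.cond_false (det_of_eval rfl ?_)
        (det_of_eval rfl rfl))))).mono ?_
    · show (if Data.bit _ = .nil then Data.nil else a.snd.snd.snd) = .nil
      by_cases h : b.keys.length < b.q
      · simpa [h, Data.bit] using hq
      · simp [h, Data.bit]
    · simp [weight, refuseP, ansP, own, advSt, arg, res, up, sndN, fld, tt]
      omega
  have hn0 : 0 < a.snd.snd.snd.len := by
    cases h : a.snd.snd.snd with
    | nil => exact absurd h hq.2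
    | cons => simp [Data.len]
  have hE₀ := hD.eval _ hf _ hb.mem₀
  have hE₁ := hD.eval _ hf _ hb.mem₁
  have hne : ∀ u v : Data, (cond eq zero tt).Det (.cons u v) (Data.bit (decide (u ≠ v))) 7 := by
    intro u v
    refine det_of_eval rfl ?_
    by_cases h : u = v <;> simp [eval, h, Data.bit, Data.fst, Data.snd, tt]
  have hlev := levelP_det hb.lam_pos a.snd.snd.snd
  generalize hbad : decide (𝓕.ev b.lam a.snd.snd.fst b.x₀ ≠ 𝓕.ev b.lam a.snd.snd.fst b.x₁) = bad
  have hbit := hne (𝓕.ev b.lam a.snd.snd.fst b.x₀) (𝓕.ev b.lam a.snd.snd.fst b.x₁)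
  rw [hbad] at hbit
  refine (Framed.call_det rfl rfl hF (Framed.cond_true (a := y) (det_of_eval rfl rfl) (hy.2 hf)
    (Framed.call_det rfl rfl hlt (Framed.cond_true (a := a.snd.snd.snd) (det_of_eval rfl ?_) hq.2
    (Framed.call_det rfl rfl hE₀ (Framed.call_det rfl rfl hE₁ (Framed.call_det rfl rfl hbit
      (C' := 7000 * budget D N) ?_))))))).mono ?_
  · show (if Data.bit _ = .nil then Data.nil else a.snd.snd.snd) = _
    simp [hq.1, Data.bit]
  swap
  · simp [weight, own, arg, res, up, sndN, fld]
    omega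
  by_cases hch : b.challenged = true ∧ bad = true
  · obtain ⟨hch, rfl⟩ := hch
    rw [reactKg, if_neg fun h => (of_decide_eq_true hbad) (h.2.2.2 hch)]
    refine (Framed.cond_true (a := .one) (det_of_eval rfl ?_) (by simp [Data.one])
      (det_of_eval rfl rfl)).mono ?_
    · show (if Data.bit b.challenged = .nil then Data.nil else Data.bit true) = .one
      simp [hch, Data.bit, Data.one]
    · simp [weight, refuseP, ansP, own, advSt, res, up, sndN, fld, tt]
      omega
  have hcond : a.snd.snd.fst ∈ 𝓕.F b.lam ∧ 0 < a.snd.snd.snd.len ∧ b.keys.length < b.q ∧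
      (b.challenged = true →
        𝓕.ev b.lam a.snd.snd.fst b.x₀ = 𝓕.ev b.lam a.snd.snd.fst b.x₁) := by
    refine ⟨hf, hn0, hq.1, fun h => ?_⟩
    by_contra h'
    exact hch ⟨h, by rw [← hbad]; exact decide_eq_true h'⟩
  rw [reactKg, if_pos hcond]
  simp only [hbad]
  have hkl : level b.lam a.snd.snd.snd.len - 1 < b.lam := by
    have := level_le b.lam a.snd.snd.snd.len
    have := hb.lam_pos
    omega
  -- This restricts key generation to instances with a polynomial static bound, the only ones for
  -- which a running time is assumed in `Fits`.
  have hk2 : 2 ^ (level b.lam a.snd.snd.snd.len - 1 + 1) ≤ 2 * N := by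
    rw [Nat.sub_add_cancel (level_pos hb.lam_pos _)]
    exact (two_pow_level_le hn0).trans (by omega)
  generalize level b.lam a.snd.snd.snd.len - 1 = k at *
  have happ : ∀ e : SimKey, appendP.Det (.cons (ofList (b.keys.map SimKey.code)) (.cons e.code .nil))
      (ofList ((b.addKey e).keys.map SimKey.code)) (40 * (b.keys.length + 1) + 12) := by
    intro e
    have := appendP_det (ofList (b.keys.map SimKey.code)) (.cons e.code .nil)
    rwa [keys_code_append, Data.len_ofList, List.length_map] at this
  refine (Framed.cond_false (C := 500)
    (det_le rfl (by exact ite_bit_eq_nil hch) (by simp [weight, own, res, up, sndN, fld]))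
    (Framed.call_det (w := .cons (unary b.lam) a.snd.snd.snd) rfl rfl hlev (C' := 6000 * budget D N) ?_)).mono ?_
  swap
  · simp [weight, own, arg, up, sndN, fld]
    omega
  by_cases hkp : k = b.pre.length
  · subst hkp
    rw [if_pos rfl]
    refine (Framed.cond_true (a := .one) (det_of_eval rfl ?_) (by simp [Data.one])
      (Framed.call_det (w := .cons (ofList (b.keys.map SimKey.code)) (.cons (SimKey.code _) .nil))
        rfl rfl (happ ⟨a.snd.snd.fst, a.snd.snd.snd, b.pre.length, .nil, bad⟩) (det_of_eval rfl rfl))).mono ?_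
    · show Data.bit (decide (unary b.pre.length = unary b.pre.length)) = .one
      simp [Data.bit, Data.one]
    · simp [weight, addKey, askP, own, arg, advSt, res, up, sndN, fld, tt]
      omega
  · rw [if_neg hkp]
    have hnth := nthP_det (unary k) (ofList b.all)
    rw [Data.toList_ofList, Data.len_unary] at hnth
    refine (Framed.cond_false (det_of_eval rfl ?_)
      (Framed.call_det (w := .cons (unary k) (ofList b.all)) rfl rfl hnth
      (Framed.call (w := .cons (b.all.getD k .nil) a.snd.snd.fst) (C' := 4000 * budget D N) rfl rfl
        (hb.kg k hkl hkp hk2 _ hf).1.framed fun r _ => ?_))).mono ?_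
    · show Data.bit (decide (unary k = unary b.pre.length)) = .nil
      rw [decide_eq_false fun h => hkp (Data.unary_injective h)]
      rfl
    · refine (Framed.call_det (w := .cons (ofList (b.keys.map SimKey.code)) (.cons (SimKey.code _) .nil))
        rfl rfl (happ ⟨a.snd.snd.fst, a.snd.snd.snd, k, r.1.snd, bad⟩) (det_of_eval rfl rfl)).mono ?_
      simp [weight, addKey, ansP, own, arg, advSt, res, up, sndN, fld, tt]
      omega
    · simp [weight, own, arg, res, up, sndN, fld]
      omega

/-- The entries passed by the search are kept in reversed order. Moving them back with `revAppP` in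
front of the changed entry and the rest gives the updated list. -/
theorem splitP_sameFun_det (f : Data) (l : List SimKey) : ∃ z,
    (splitP sameFun).Det (.cons f (.cons .nil (ofList (l.map SimKey.code)))) z
      (100 * (l.length + 1)) ∧
    match l.find? fun e => e.f = f with
    | none => z.snd = .nil
    | some e => ∃ l₁ l₂, l = l₁ ++ e :: l₂ ∧ clearFirst f l = l₁ ++ { e with bad := false } :: l₂ ∧
      z = .cons (ofList (l₁.map SimKey.code).reverse)
        (.cons e.code (ofList (l₂.map SimKey.code))) := by
  refine ⟨_, (splitP_det (t := sameFun) rfl f .nil _).mono ?_, ?_⟩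
  · rw [Data.len_ofList, List.length_map]
    exact Nat.mul_le_mul_right _ (by simp [sameFun, weight])
  suffices h : ∀ l₀ : List SimKey,
      match l.find? fun e => e.f = f with
      | none => (Data.split (fun x => decide (sameFun.eval (.cons f x) ≠ .nil))
          (ofList (l₀.map SimKey.code).reverse) (ofList (l.map SimKey.code))).snd = .nil
      | some e => ∃ l₁ l₂, l = l₁ ++ e :: l₂ ∧
        clearFirst f l = l₁ ++ { e with bad := false } :: l₂ ∧
        Data.split (fun x => decide (sameFun.eval (.cons f x) ≠ .nil))
          (ofList (l₀.map SimKey.code).reverse) (ofList (l.map SimKey.code)) =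
          .cons (ofList ((l₀ ++ l₁).map SimKey.code).reverse)
            (.cons e.code (ofList (l₂.map SimKey.code))) from h []
  induction l with
  | nil => intro l₀; rfl
  | cons e l ih =>
    intro l₀
    have he : sameFun.eval (.cons f e.code) = Data.bit (decide (f = e.f)) := rfl
    by_cases hf : e.f = f
    · simp only [List.find?_cons_of_pos (p := fun e : SimKey => decide (e.f = f)) (by simpa using hf)]
      exact ⟨[], l, rfl, by simp [clearFirst, hf], by
        simp [Data.split, ofList, he, hf, Data.bit]⟩
    · have h := ih (l₀ ++ [e])
      rw [List.find?_cons_of_neg (by simpa using hf)]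
      have hs : Data.split (fun x => decide (sameFun.eval (.cons f x) ≠ .nil))
          (ofList (l₀.map SimKey.code).reverse) (ofList ((e :: l).map SimKey.code)) =
          Data.split (fun x => decide (sameFun.eval (.cons f x) ≠ .nil))
          (ofList ((l₀ ++ [e]).map SimKey.code).reverse) (ofList (l.map SimKey.code)) := by
        simp [Data.split, ofList, he, Ne.symm hf, Data.bit]
      rw [hs]
      revert h
      cases l.find? fun e => e.f = f with
      | none => exact id
      | some e' =>
        rintro ⟨l₁, l₂, h1, h2, h3⟩
        exact ⟨e :: l₁, l₂, by rw [h1]; rfl, by simp [clearFirst, hf, h2], by rw [h3]; simp⟩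

theorem vrfyP_framed (hb : Fits S 𝓕 D N b) (a : Data) :
    (vrfyP S).Framed (.cons (.cons .one b.code) a) (9000 * budget D N)
      (reactVrfy S b a.fst a.snd.snd) := by
  obtain ⟨h1, h2, h3⟩ := le_budget D N
  have hl := hb.length_eq
  have hl' := hb.lam_le
  have hk := hb.keys_le
  have he := hb.encs_le
  obtain ⟨z, hs, hz⟩ := splitP_sameFun_det a.snd.snd.fst b.keys
  unfold reactVrfy
  split
  next hf =>
    simp only [hf] at hz
    refine (Framed.call_det (w := .cons a.snd.snd.fst (.cons .nil (ofList (b.keys.map SimKey.code))))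
      rfl rfl hs (Framed.cond_false (det_of_eval rfl (by exact hz)) (det_of_eval rfl rfl))).mono ?_
    simp [weight, refuseP, ansP, own, advSt, arg, res, up, sndN, fld, tt]
    omega
  next e hf =>
    simp only [hf] at hz
    obtain ⟨l₁, l₂, hl₁, hcl, rfl⟩ := hz
    have hmem : e ∈ b.keys := by simp [hl₁]
    have hle : l₁.length ≤ b.keys.length := by simp [hl₁]
    have hlt := ltP_det (unary b.encs) e.n
    rw [Data.len_unary] at hlt
    have hrev := revAppP_det (ofList (l₁.map SimKey.code).reverse)
      (.cons (SimKey.code { e with bad := false }) (ofList (l₂.map SimKey.code)))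
    rw [show Data.cons (SimKey.code { e with bad := false }) (ofList (l₂.map SimKey.code)) =
      ofList ((SimKey.code { e with bad := false }) :: l₂.map SimKey.code) from rfl,
      Data.revApp_ofList, List.reverse_reverse, ← List.map_cons, ← List.map_append, ← hcl,
      Data.len_ofList, List.length_reverse, List.length_map] at hrev
    refine (Framed.call_det (w := .cons a.snd.snd.fst (.cons .nil (ofList (b.keys.map SimKey.code))))
      rfl rfl hs (Framed.cond_true
        (a := .cons e.code (ofList (l₂.map SimKey.code))) (det_of_eval rfl rfl) (by simp)
      (Framed.call_det (w := .cons (unary b.encs) e.n) rfl rfl hlt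
        (Framed.call_det (w := .cons (ofList (l₁.map SimKey.code).reverse)
          (ofList (({ e with bad := false } :: l₂).map SimKey.code))) rfl rfl hrev
          (C' := 5000 * budget D N) ?_)))).mono ?_
    swap
    · simp [weight, found, own, res, arg, up, sndN, fld]
      omega
    by_cases hidx : e.idx = b.pre.length
    · rw [if_pos hidx]
      refine (Framed.cond_true (a := .one) (det_of_eval rfl ?_) (by simp [Data.one])
        (det_of_eval rfl ?_)).mono ?_
      · show Data.bit (decide (unary e.idx = unary b.pre.length)) = .one
        simp [hidx, Data.bit, Data.one]
      · by_cases hn : b.encs < e.n.len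
        · simp only [hn, decide_true, if_true]
          rfl
        · simp only [hn, decide_false, if_false]
          rfl
      · simp [weight, askP, found, own, advSt, arg, res, up, sndN, fld, tt]
        omega
    · rw [if_neg hidx]
      refine (Framed.cond_false (det_of_eval rfl ?_)
        (Framed.call (w := .cons e.vk a.snd.snd.snd) (C' := 2000 * budget D N) rfl rfl
          (hb.vrfy e hmem hidx _).framed fun r _ => ?_)).mono ?_
      · show Data.bit (decide (unary e.idx = unary b.pre.length)) = .nil
        rw [decide_eq_false fun h => hidx (Data.unary_injective h)]
        rfl
      · by_cases hr : r.1 ≠ .nil ∧ b.encs < e.n.len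
        · rw [if_pos hr, decide_eq_true hr.2]
          refine (Framed.cond_true (a := .one) (det_of_eval rfl ?_) (by simp [Data.one])
            (det_of_eval rfl rfl)).mono ?_
          · show (if r.1 = .nil then Data.nil else Data.bit true) = .one
            simp [hr.1, Data.bit, Data.one]
          · simp [weight, ansP, own, advSt, res, up, sndN, tt]
            omega
        · rw [if_neg hr]
          refine (Framed.cond_false (det_of_eval rfl ?_) (det_of_eval rfl rfl)).mono ?_
          · show (if r.1 = .nil then Data.nil else Data.bit _) = .nil
            by_cases h : r.1 = .nil
            · simp [h]
            · simp [h, Data.bit, decide_eq_false fun h' => hr ⟨h, h'⟩]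
          · simp [weight, refuseP, ansP, own, advSt, res, up, tt]
            omega
      · simp [weight, found, own, arg, res, up, sndN, fld]
        omega

section

variable (S 𝓕)

/-- The reaction of the reduction to a message in a running session. -/
noncomputable def react (b : Sim) (aS : Data) : Data → Ens
  | .nil => Ens.pure (.cons .nil .nil)
  | .cons t d =>
    match t.len with
    | 0 => Ens.pure (.cons .nil (.cons t d))
    | 1 => Ens.pure (answer aS b.code .nil)
    | 2 => reactEnc S 𝓕 b aS d
    | 3 => reactKg S 𝓕 b aS d.fst d.snd
    | 4 => reactVrfy S b aS d
    | _ => reactChal S b aS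

end

theorem postP_framed (hD : Deciders 𝓕 pX pF pE b.lam D) (hb : Fits S 𝓕 D N b) (a : Data)
    (hn : (Query.decode a.snd).cost ≤ N) :
    (postP S pX pF pE).Framed (.cons (.cons .one b.code) a) (10000 * budget D N)
      (react S 𝓕 b a.fst a.snd) := by
  obtain ⟨h1, h2, h3⟩ := le_budget D N
  refine (Framed.cond_true (a := .one) (det_of_eval rfl rfl) (by simp [Data.one])
    (C' := 9900 * budget D N) ?_).mono (by simp [weight]; omega)
  have e₂ := encP_framed hD hb a
  have e₃ := kgP_framed hD hb a
  have e₄ := vrfyP_framed hb a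
  have e₅ := chalP_framed hb a
  cases hm : a.snd with
  | nil =>
    refine (Framed.cond_false (det_of_eval rfl (by show a.snd.fst = .nil; rw [hm]; rfl))
      (det_of_eval rfl (by show Data.cons .nil a.snd = _; rw [hm]))).mono ?_
    simp [weight, tagP]
    omega
  | cons t d =>
    rw [hm] at e₂ e₃ e₄ hn
    have ht : ∀ p : Prog, p.simple = true → (tagP p).Det (.cons (.cons .one b.code) a) (p.eval t)
        (p.weight + 6) := by
      intro p hp
      refine (det_of_eval (a := p.eval t) (by simp [tagP, simple, hp]) ?_).mono ?_
      · show p.eval a.snd.fst = _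
        rw [hm]
        rfl
      · simp [weight, tagP]
        omega
    have c₀ := ht Prog.id rfl
    have c₁ := ht (sndN 1) rfl
    have c₂ := ht (sndN 2) rfl
    have c₃ := ht (sndN 3) rfl
    have c₄ := ht (sndN 4) rfl
    clear ht
    rcases t with _ | ⟨_, _ | ⟨_, _ | ⟨_, _ | ⟨_, _ | ⟨_, t⟩⟩⟩⟩⟩
    · refine (Framed.cond_false c₀
        (det_of_eval rfl (by show Data.cons .nil a.snd = _; rw [hm]))).mono ?_
      simp [weight]
      omega
    · refine (Framed.cond_true c₀ (by simp [eval]) (Framed.cond_false c₁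
        (refuseP_det b.code .one a))).mono ?_
      simp [weight, sndN]
      omega
    · refine (Framed.cond_true c₀ (by simp [eval]) (Framed.cond_true c₁
        (by simp [eval, sndN, Data.snd]) (Framed.cond_false c₂ e₂))).mono ?_
      simp [weight, sndN]
      omega
    · refine (Framed.cond_true c₀ (by simp [eval]) (Framed.cond_true c₁
        (by simp [eval, sndN, Data.snd]) (Framed.cond_true c₂ (by simp [eval, sndN, Data.snd])
          (Framed.cond_false c₃ (e₃ hn))))).mono ?_
      simp [weight, sndN]
      omega
    · refine (Framed.cond_true c₀ (by simp [eval]) (Framed.cond_true c₁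
        (by simp [eval, sndN, Data.snd]) (Framed.cond_true c₂ (by simp [eval, sndN, Data.snd])
          (Framed.cond_true c₃ (by simp [eval, sndN, Data.snd]) (Framed.cond_false c₄ e₄))))).mono ?_
      simp [weight, sndN]
      omega
    · refine (Framed.cond_true c₀ (by simp [eval]) (Framed.cond_true c₁
        (by simp [eval, sndN, Data.snd]) (Framed.cond_true c₂ (by simp [eval, sndN, Data.snd])
          (Framed.cond_true c₃ (by simp [eval, sndN, Data.snd])
            (Framed.cond_true c₄ (by simp [eval, sndN, Data.snd]) e₅))))).mono ?_
      simp [weight, sndN]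
      omega

end Reduction

end KeyLeasing

/-! ### The opening of a session by the reduction -/

namespace KeyLeasing

open Data (unary binary ofList)

namespace Reduction

open Prog

section

variable (S : Algs) (𝓕 : FunClass)

/-- The start of a session, with the opening message for the challenger. -/
def opened (b : Sim) (aS : Data) : Data :=
  .cons (st aS b.code .nil .nil b.code .nil) (.cons .one (.cons (unary b.q)
    (.cons (binary (2 ^ (b.pre.length + 1))) (.cons b.x₀ b.x₁))))

/-- Master secret keys of the instances above the first `i`. -/
noncomputable def setups (lam q i k : ℕ) : Ens :=
  Ens.lists ((List.range k).map fun j => (S.atBound (2 ^ (i + j + 1))).setup lam q)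

/-- The start of a session in which the challenger is in charge of instance `i`. -/
noncomputable def openAt (lam : ℕ) (aS d : Data) (i : ℕ) : Ens :=
  (setups S lam d.fst.len 0 i).bind fun P =>
    (setups S lam d.fst.len (i + 1) (lam - (i + 1))).bind fun Q =>
      Ens.pure (opened ⟨[], 0, false, lam, d.snd.snd.fst, d.snd.snd.snd, d.fst.len, P.toList,
        Q.toList⟩ aS)

open Classical in
/-- The reaction of the reduction to the first message. -/
noncomputable def reactStart (lam : ℕ) (aS : Data) : Data → Ens
  | .nil => Ens.pure (.cons .nil .nil)
  | .cons t d =>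
    if t.len = 1 ∧ 0 < d.fst.len ∧ d.snd.snd.fst ∈ 𝓕.X lam ∧ d.snd.snd.snd ∈ 𝓕.X lam then
      (uniform (Nat.clog 2 lam)).bind fun w =>
        if w.len < lam then openAt S lam aS d w.len else Ens.pure (.cons .nil .nil)
    else Ens.pure (.cons .nil .nil)

end

variable {S : Algs} {𝓕 : FunClass} {pX pF pE : Prog} {D N : ℕ}

theorem two_pow_clog_le {n : ℕ} (hn : 0 < n) : 2 ^ Nat.clog 2 n ≤ 2 * n := by
  by_contra! h
  have h1 : Nat.clog 2 n ≠ 0 := by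
    intro h0
    rw [h0] at h
    omega
  obtain ⟨k, hk⟩ := Nat.exists_eq_succ_of_ne_zero h1
  have h2 : 2 ^ k < n := (Nat.lt_clog_iff_pow_lt (by norm_num)).1 (by omega)
  rw [hk, pow_succ] at h
  omega

theorem guessP_det (v : Data) : guessP.Det v (.cons .nil .nil) 10 :=
  (det_of_eval rfl rfl).mono (by simp [weight, guessP])

theorem len_eq_length (d : Data) : d.len = d.toList.length := by
  conv_lhs => rw [← Data.ofList_toList d, Data.len_ofList]

theorem setups_framed {lam q i k : ℕ} (h : ∀ j, j ≤ i + k →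
      S.setup.HaltsIn (.cons (unary lam) (.cons (unary q) (binary (2 ^ j)))) QMem.empty D) :
    (setupListP S).Framed
      (.cons (ofList (((List.range k).map fun t => binary (2 ^ (i + t + 1))).reverse ++ []))
        (.cons (unary lam) (unary q)))
      ((D + 120) * (k + 2)) (setups S lam q i k) := by
  have := setupListP_framed (S := S) (lam := lam) (q := q) (C := D)
    ((List.range k).map fun t => i + t + 1) (by
      intro j hj
      obtain ⟨t, ht, rfl⟩ := List.mem_map.1 hj
      have := List.mem_range.1 ht
      exact h _ (by omega))
  simpa only [List.map_map, Function.comp_def, List.length_map, List.length_range,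
    List.append_nil, setups] using this

theorem startP_framed {lam : ℕ} (hl : 0 < lam) (hlN : lam ≤ N)
    (hD : Deciders 𝓕 pX pF pE lam D) (a : Data) (hq : (Query.decode a.snd).cost ≤ N)
    (hset : ∀ q, 0 < q → q ≤ N → ∀ j ≤ lam,
      S.setup.HaltsIn (.cons (unary lam) (.cons (unary q) (binary (2 ^ j)))) QMem.empty D) :
    (startP S pX).Framed (.cons (.cons .nil (unary lam)) a) (9000 * budget D N)
      (reactStart S 𝓕 lam a.fst a.snd) := by
  obtain ⟨h1, h2, h3⟩ := le_budget D N
  cases hm : a.snd with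
  | nil =>
    refine (Framed.cond_false (C := 200) (det_le rfl ?_ ?_) (guessP_det _)).mono (by omega)
    · show (if a.snd.fst = .nil then .nil else
          if a.snd.fst.snd = .nil then a.snd.snd.fst else .nil) = Data.nil
      simp [hm, Data.fst]
    · simp [weight, arg, up]
  | cons t d =>
    by_cases ht : t.len = 1 ∧ 0 < d.fst.len
    swap
    · rw [reactStart, if_neg fun h => ht ⟨h.1, h.2.1⟩]
      refine (Framed.cond_false (C := 200) (det_le rfl ?_ ?_) (guessP_det _)).mono (by omega)
      · show (if a.snd.fst = .nil then .nil else
          if a.snd.fst.snd = .nil then a.snd.snd.fst else .nil) = Data.nil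
        rw [hm]
        show (if t = .nil then .nil else if t.snd = .nil then d.fst else .nil) = Data.nil
        rcases t with _ | ⟨t₀, _ | _⟩
        · simp
        · have : d.fst = .nil := by
            by_contra h
            refine ht ⟨rfl, ?_⟩
            cases hd : d.fst with
            | nil => exact absurd hd h
            | cons => simp [Data.len]
          simp [this]
        · simp [Data.snd]
      · simp [weight, arg, up]
    obtain ⟨aS, rfl⟩ : ∃ aS, a = .cons aS (.cons t d) := by
      cases a with
      | nil => simp [Data.snd] at hm
      | cons aS m => exact ⟨aS, by rw [← hm]; rfl⟩
    change (startP S pX).Framed _ _ (reactStart S 𝓕 lam aS (.cons t d))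
    obtain ⟨t₀, rfl⟩ : ∃ t₀, t = .cons t₀ .nil := by
      rcases t with _ | ⟨t₀, _ | _⟩ <;> simp [Data.len] at ht
      exact ⟨t₀, rfl⟩
    have hqN : d.fst.len ≤ N := le_trans (Nat.le_add_right _ _) hq
    have hd : d.fst ≠ .nil := by
      intro h
      simp [h, Data.len] at ht
    obtain ⟨y₀, hy₀, hX₀⟩ := hD.plaintext d.snd.snd.fst
    obtain ⟨y₁, hy₁, hX₁⟩ := hD.plaintext d.snd.snd.snd
    refine (Framed.cond_true (C := 200) (a := d.fst) (det_le rfl (by rfl) (by simp [weight, arg, up]))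
      hd (Framed.call_det (w := .cons (unary lam) d.snd.snd.fst) rfl rfl hX₀
        (Framed.call_det (w := .cons (unary lam) d.snd.snd.snd) rfl rfl hX₁
        (C' := 8000 * budget D N) ?_))).mono ?_
    swap
    · simp [weight, arg, lamP, own, up, sndN, fld]
      omega
    by_cases hx : d.snd.snd.fst ∈ 𝓕.X lam ∧ d.snd.snd.snd ∈ 𝓕.X lam
    swap
    · rw [reactStart, if_neg fun h => hx h.2.2]
      refine (Framed.cond_false (C := 200) (det_le rfl ?_ (by simp [weight, res, up]))
        (guessP_det _)).mono (by omega)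
      show (if y₀ = .nil then .nil else y₁) = Data.nil
      by_cases h : y₀ = .nil
      · rw [if_pos h]
      · rw [if_neg h]
        exact by_contra fun h' => hx ⟨hy₀.1 h, hy₁.1 h'⟩
    rw [reactStart, if_pos ⟨ht.1, ht.2, hx⟩]
    have hnorm := normP_det d.fst.toList .nil
    rw [Data.ofList_toList, ← len_eq_length] at hnorm
    have e1 := mul_le_budget (D := D) (a := lam) (c := 120) hlN
    have e2 := level_le_budget (D := D) hlN (le_refl N)
    have e3 : (lam + 2) * (120 * lam + 200) ≤ 400 * budget D N := by
      calc (lam + 2) * (120 * lam + 200) ≤ (2 * (N + 1)) * (200 * (N + 1)) :=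
            Nat.mul_le_mul (by omega) (by omega)
        _ = 400 * (N + 1) ^ 2 := by ring
        _ ≤ _ := Nat.mul_le_mul_left _ (Nat.le_mul_of_pos_left _ (Nat.succ_pos D))
    refine (Framed.cond_true (C := 200) (a := y₁) (det_le rfl ?_ (by simp [weight, res, up]))
      (hy₁.2 hx.2) (Framed.call_det (w := .cons d.fst .nil) rfl rfl hnorm
        (Framed.call (w := unary lam) (C' := 6000 * budget D N) rfl rfl (sampleP_framed lam)
          fun r hr => ?_))).mono ?_
    · show (if y₀ = .nil then .nil else y₁) = y₁
      rw [if_neg (hy₀.2 hx.1)]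
    swap
    · simp [weight, arg, lamP, own, up]
      omega
    obtain ⟨i, hi', rfl⟩ := List.mem_map.1 hr
    -- Even a random index that is too large is below `2 * lam`, which bounds the cost of comparing
    -- it with `lam`.
    replace hi' := (List.mem_range.1 hi').trans_le (two_pow_clog_le hl)
    simp only [Data.len_unary]
    have hlt := ltP_det (unary i) (unary lam)
    simp only [Data.len_unary] at hlt
    by_cases hi : i < lam
    swap
    · rw [if_neg hi]
      rw [decide_eq_false hi] at hlt
      refine (Framed.call_det (w := .cons (unary i) (unary lam)) rfl rfl hlt
        (Framed.cond_false (C := 200) (det_le rfl (by rfl) (by simp [weight, res, up]))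
          (guessP_det _))).mono ?_
      simp [weight, lamP, own, res, up]
      omega
    rw [if_pos hi]
    rw [decide_eq_true hi] at hlt
    have hg := genP_det i 0 []
    have hg' := genP_det (lam - (i + 1)) (i + 1) []
    have hs := fun q hq hqN => setups_framed (S := S) (D := D) (lam := lam) (q := q) (i := 0) (k := i)
      fun j hj => hset q hq hqN j (by omega)
    have hs' := fun q hq hqN => setups_framed (S := S) (D := D) (lam := lam) (q := q) (i := i + 1)
      (k := lam - (i + 1)) fun j hj => hset q hq hqN j (by omega)
    -- The number `lam - (i + 1)` of instances above the challenger's one is obtained in unary by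
    -- dropping entries of `1^lam`.
    have hdr := dropP_det (unary (i + 1)) (unary lam)
    rw [Data.len_unary, Data.drop_unary] at hdr
    have e4 := mul_le_budget (D := D) (N := N) (a := i) (c := 120) (by omega)
    have e5 := mul_le_budget (D := D) (N := N) (a := lam - (i + 1)) (c := 120) (by omega)
    refine (Framed.call_det (w := .cons (unary i) (unary lam)) rfl rfl hlt
      (Framed.cond_true (C := 200) (a := .one) (det_le rfl (by rfl) (by simp [weight, res, up]))
      (by simp [Data.one])
      (Framed.call_det (w := .cons (unary i) (.cons (binary (2 ^ 0)) (ofList []))) rfl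
        (by rw [Data.binary_two_pow_zero]; rfl) hg
        (Framed.call (w := .cons (ofList (((List.range i).map
          fun t => binary (2 ^ (0 + t + 1))).reverse ++ [])) (.cons (unary lam) (unary d.fst.len)))
          (C' := 5000 * budget D N) rfl rfl (hs _ ht.2 hqN) fun s hs₀ => ?_)))).mono ?_
    swap
    · simp [weight, lamP, oneP, own, res, up, sndN, tt]
      omega
    refine (Framed.call_det (w := .cons (unary (i + 1)) (unary lam)) rfl rfl hdr
      (Framed.call_det (w := .cons (unary (lam - (i + 1))) (.cons (binary (2 ^ (i + 1))) (ofList [])))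
        rfl (by
          show Data.cons _ (Data.cons (Data.cons .nil (binary (2 ^ (0 + i)))) .nil) = _
          rw [Nat.zero_add, Data.binary_two_pow_succ]; rfl) hg'
        (Framed.call (w := .cons (ofList (((List.range (lam - (i + 1))).map
          fun t => binary (2 ^ (i + 1 + t + 1))).reverse ++ []))
          (.cons (unary lam) (unary d.fst.len)))
          (C' := 4000 * budget D N) rfl rfl (hs' _ ht.2 hqN) fun s' hs₀' => ?_))).mono ?_
    swap
    · simp [weight, lamP, own, res, up, fld, sndN]
      omega
    have hlen : s.1.toList.length = i := by
      rw [(Ens.mem_lists hs₀).length_eq]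
      simp
    have happ := appendP_det s.1 (.cons .nil s'.1)
    rw [len_eq_length, hlen, ← Data.ofList_toList s.1, ← Data.ofList_toList s'.1,
      show Data.cons .nil (ofList s'.1.toList) = ofList (.nil :: s'.1.toList) from rfl,
      Data.append_ofList] at happ
    refine (Framed.call_det (w := .cons (ofList s.1.toList) (ofList (.nil :: s'.1.toList))) rfl
      (by rw [Data.ofList_toList, ofList, Data.ofList_toList]; rfl) happ
      (det_of_eval rfl ?_)).mono ?_
    · rw [Nat.zero_add]
      simp only [opened, Sim.code, Sim.all, hlen, Data.binary_two_pow_succ, Data.ofList_toList]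
      rfl
    · simp [weight, advSt, startP.startBody, lamP, arg, own, res, up, fld, sndN, tt]
      omega

theorem postP_start_framed {lam : ℕ} (hl : 0 < lam) (hlN : lam ≤ N)
    (hD : Deciders 𝓕 pX pF pE lam D) (a : Data) (hq : (Query.decode a.snd).cost ≤ N)
    (hset : ∀ q, 0 < q → q ≤ N → ∀ j ≤ lam,
      S.setup.HaltsIn (.cons (unary lam) (.cons (unary q) (binary (2 ^ j)))) QMem.empty D) :
    (postP S pX pF pE).Framed (.cons (.cons .nil (unary lam)) a) (10000 * budget D N)
      (reactStart S 𝓕 lam a.fst a.snd) := by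
  obtain ⟨h1, h2, h3⟩ := le_budget D N
  refine (Framed.cond_false (C := 100) (det_le rfl (by rfl) (by simp [weight]))
    (startP_framed hl hlN hD a hq hset)).mono (by omega)

end Reduction

end KeyLeasing

/-! ### Running time of the reduction -/

namespace KeyLeasing

open Data (unary binary ofList)

theorem Prog.Computes.pair_det_left {p q : Prog} {v a : Data} {m : QMem} {C C' : ℕ} {E : Ens}
    (h : p.Det v a C) (hq : q.Computes v m C' E) :
    (Prog.pair p q).Computes v m (C + C' + 2) (E.mapVal (Data.cons a)) := by
  intro T hT
  have hp := h m T (by omega)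
  rw [Ens.after_pure] at hp
  have h1 := hp.bind
    (k := fun a m' => Branch.bind (q.run T v m') fun b m'' => [Branch.done (Data.cons a b) m''])
    (K := fun a k => E.flatMap fun s => [(Data.cons a s.1, s.2)]) (C' := C' + 1)
    fun s hs => by
      obtain rfl := List.mem_singleton.1 hs
      exact (hq T (by omega)).bind (K := fun b m'' => [(Data.cons a b, m'')])
        fun t _ => Branch.gives_done _ _
  have h2 := (h1.map_tick 1).mono (show 1 + (C + (C' + 1)) ≤ C + C' + 2 by omega)
  simp only [List.flatMap_singleton, ← List.map_eq_flatMap] at h2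
  exact h2

namespace Reduction

open Prog

/-- What is known about the adversary and the algorithms, for one value of the security
parameter. -/
structure Setting (S : Algs) (𝓕 : FunClass) (pX pF pE A : Prog) (lam TA D N : ℕ) : Prop where
  lam_pos : 0 < lam
  adv : ∀ v m t, Reach A TA lam v m t → ∀ r ∈ A.run TA v m,
    ∃ a : Data, r.val = some a ∧ t + r.cost + (Query.decode a.snd).cost ≤ TA
  le_N : TA + lam ≤ N
  deciders : Deciders 𝓕 pX pF pE lam D
  setup : ∀ q, 0 < q → q ≤ N → ∀ j ≤ lam,
    S.setup.HaltsIn (.cons (unary lam) (.cons (unary q) (binary (2 ^ j)))) QMem.empty D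
  enc : ∀ q, 0 < q → q ≤ N → ∀ j ≤ lam, ∀ s ∈ (S.atBound (2 ^ j)).setup lam q, ∀ x ∈ 𝓕.X lam,
    S.enc.HaltsIn (.cons s.1 x) QMem.empty D
  keyTime : ∀ q, 0 < q → q ≤ N → ∀ j ≤ lam, 2 ^ j ≤ 2 * N → S.KeyTime 𝓕 lam q (2 ^ j) D

variable {S : Algs} {𝓕 : FunClass} {pX pF pE A : Prog} {lam TA D N : ℕ}

theorem adversary_computes {v info vA : Data} {m : QMem} {C₁ C C₂ : ℕ} {E : Ens} {K : Data → Ens}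
    (hpre : preP.Det v (.cons info vA) C₁) (hA : A.Computes vA m C E)
    (hpost : ∀ o ∈ E, (postP S pX pF pE).Framed (.cons info o.1) C₂ (K o.1)) :
    (adversary S pX pF pE A).Computes v m (C₁ + C + C₂ + 10)
      (E.flatMap fun o => (K o.1).after o.2) := by
  have h1 := Computes.pair_det_left (det_of_eval (p := Prog.fst) (v := .cons info vA) rfl rfl)
    (Computes.seq_det (det_of_eval (p := Prog.snd) (v := .cons info vA) rfl rfl) hA)
  have h2 := Computes.seq_det hpre (h1.seq (q := postP S pX pF pE) (C' := C₂)
    (K := fun a k => (K a.snd).after k) fun s hs => by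
      simp only [Ens.mapVal, List.mem_map] at hs
      obtain ⟨o, ho, rfl⟩ := hs
      exact hpost o ho _)
  rw [Ens.mapVal, List.flatMap_map] at h2
  exact h2.mono (by simp only [weight]; omega)

theorem Setting.computes (h : Setting S 𝓕 pX pF pE A lam TA D N) {v : Data} {m : QMem} {t : ℕ}
    (hr : Reach A TA lam v m t) : A.Computes v m TA (A.out v m) := by
  refine HaltsIn.computes fun r hr' => ?_
  obtain ⟨a, ha, hc⟩ := h.adv v m t hr r hr'
  exact ⟨by rw [ha]; rfl, by omega⟩

theorem Setting.exists_branch (h : Setting S 𝓕 pX pF pE A lam TA D N) {v : Data} {m : QMem} {t : ℕ}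
    (hr : Reach A TA lam v m t) {o : Data × QMem} (ho : o ∈ A.out v m) :
    ∃ r ∈ A.run TA v m, r.val = some o.1 ∧ r.mem = o.2 ∧ 1 ≤ r.cost ∧
      t + r.cost + (Query.decode o.1.snd).cost ≤ TA := by
  rw [(h.computes hr).haltsIn.out_eq] at ho
  obtain ⟨r, hr', he⟩ := List.mem_filterMap.1 ho
  obtain ⟨a, ha, hc⟩ := h.adv v m t hr r hr'
  simp only [ha, Option.map_some, Option.some.injEq] at he
  subst he
  exact ⟨r, hr', ha, rfl, cost_pos hr' (by rw [ha]; rfl), hc⟩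

/-- The invariant of a session after `t` steps of the adversary. -/
structure Inv (S : Algs) (𝓕 : FunClass) (lam D N t : ℕ) (b : Sim) : Prop where
  lam_eq : b.lam = lam
  fits : Fits S 𝓕 D N b
  keys_le : b.keys.length ≤ t
  encs_le : b.encs ≤ t

/-- The information that the reduction has at the beginning of an activation. -/
def InvInfo (S : Algs) (𝓕 : FunClass) (lam D N t : ℕ) (info : Data) : Prop :=
  info = .cons .nil (unary lam) ∨ ∃ b : Sim, info = .cons .one b.code ∧ Inv S 𝓕 lam D N t b

/-- The value `v`, with which the reduction returns, leads to the invariant, whatever the reply to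
its message is. -/
def Leads (S : Algs) (𝓕 : FunClass) (lam D N t : ℕ) (aS v : Data) : Prop :=
  (Query.decode v.snd).cost ≤ 3 * N ∧ ((Query.decode v.snd).IsGuess ∨ ∀ reply, ∃ info replyA,
    preP.Det (.cons v.fst reply) (.cons info (.cons aS replyA)) (1000 * budget D N) ∧
    InvInfo S 𝓕 lam D N t info)

theorem leads_guess {t : ℕ} {aS : Data} : Leads S 𝓕 lam D N t aS (.cons .nil .nil) :=
  ⟨Nat.zero_le _, .inl trivial⟩

theorem leads_answer {t : ℕ} {b : Sim} (hb : Inv S 𝓕 lam D N t b) (aS rep : Data) :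
    Leads S 𝓕 lam D N t aS (answer aS b.code rep) := by
  obtain ⟨h1, h2, h3⟩ := le_budget D N
  refine ⟨Nat.zero_le _, .inr fun reply => ?_⟩
  by_cases hr : reply = .nil
  · subst hr
    exact ⟨_, _, Det.mono (preP_refused _ _ _ _ _ _) (by omega), .inr ⟨b, rfl, hb⟩⟩
  · exact ⟨_, _, Det.mono (preP_plain _ _ _ _ _  _ hr) (by omega), .inr ⟨b, rfl, hb⟩⟩

theorem leads_ask {t : ℕ} {b b' : Sim} (hb : Inv S 𝓕 lam D N t b) (hb' : Inv S 𝓕 lam D N t b')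
    (aS mode payload msg : Data) (hc : (Query.decode msg).cost ≤ 3 * N)
    (hm : mode = plain ∨ mode = keyMode ∨ mode = encMode ∧
      ∃ P Q : Data, payload = .cons P Q ∧ P.len ≤ N) :
    Leads S 𝓕 lam D N t aS (ask aS b.code mode b'.code payload msg) := by
  obtain ⟨h1, h2, h3⟩ := le_budget D N
  refine ⟨hc, .inr fun reply => ?_⟩
  by_cases hr : reply = .nil
  · subst hr
    exact ⟨_, _, Det.mono (preP_refused _ _ _ _ _ _) (by omega), .inr ⟨b, rfl, hb⟩⟩
  · rcases hm with rfl | rfl | ⟨rfl, P, Q, rfl, hP⟩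
    · exact ⟨_, _, Det.mono (preP_plain _ _ _ _ _  _ hr) (by omega), .inr ⟨b', rfl, hb'⟩⟩
    · exact ⟨_, _, Det.mono (preP_key _ _ _ _ _  _ hr) (by omega), .inr ⟨b', rfl, hb'⟩⟩
    · exact ⟨_, _, Det.mono (preP_enc _ _ _ _ _ _  _ hr) (by omega), .inr ⟨b', rfl, hb'⟩⟩

theorem Inv.mono {t t' : ℕ} {b : Sim} (hb : Inv S 𝓕 lam D N t b) (ht : t ≤ t') :
    Inv S 𝓕 lam D N t' b :=
  ⟨hb.lam_eq, hb.fits, hb.keys_le.trans ht, hb.encs_le.trans ht⟩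

theorem InvInfo.mono {t t' : ℕ} {info : Data} (h : InvInfo S 𝓕 lam D N t info) (ht : t ≤ t') :
    InvInfo S 𝓕 lam D N t' info :=
  h.imp id fun ⟨b, hi, hb⟩ => ⟨b, hi, hb.mono ht⟩

/-- A query costs the adversary at least one step, so the counter may grow by one together with `t`.
-/
theorem Inv.enc {t : ℕ} {b : Sim} (hb : Inv S 𝓕 lam D N t b) (ht : t + 1 ≤ N) :
    Inv S 𝓕 lam D N (t + 1) { b with encs := b.encs + 1 } :=
  ⟨hb.lam_eq, { hb.fits with encs_le := (Nat.succ_le_succ hb.encs_le).trans ht },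
    hb.keys_le.trans (Nat.le_succ t), Nat.succ_le_succ hb.encs_le⟩

theorem Inv.chal {t : ℕ} {b : Sim} (hb : Inv S 𝓕 lam D N t b) :
    Inv S 𝓕 lam D N t { b with challenged := true } :=
  ⟨hb.lam_eq, { hb.fits with }, hb.keys_le, hb.encs_le⟩

theorem Inv.addKey {t : ℕ} {b : Sim} (hb : Inv S 𝓕 lam D N t b) (ht : t + 1 ≤ N) {e : SimKey}
    (he : e.idx ≠ b.pre.length → ∀ z, S.vrfy.HaltsIn (.cons e.vk z) QMem.empty D) :
    Inv S 𝓕 lam D N (t + 1) (b.addKey e) := by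
  have hlen : (b.addKey e).keys.length ≤ t + 1 := by
    simpa [Sim.addKey] using hb.keys_le
  refine ⟨hb.lam_eq, { hb.fits with keys_le := hlen.trans ht, vrfy := ?_ }, hlen,
    hb.encs_le.trans (Nat.le_succ t)⟩
  intro e' he'
  rcases List.mem_append.1 he' with h | h
  · exact hb.fits.vrfy e' h
  · rw [List.mem_singleton.1 h]
    exact he

/-- Clearing a mark changes neither the index nor the verification key of an entry, and the running
times in `Fits` depend on nothing else in the list. -/
theorem forall₂_clearFirst (f : Data) (l : List SimKey) :
    List.Forall₂ (fun e e' => e.idx = e'.idx ∧ e.vk = e'.vk) l (clearFirst f l) := by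
  induction l with
  | nil => exact .nil
  | cons e l ih =>
    rw [clearFirst]
    split_ifs
    · exact .cons ⟨rfl, rfl⟩ (List.forall₂_same.2 fun _ _ => ⟨rfl, rfl⟩)
    · exact .cons ⟨rfl, rfl⟩ ih

theorem Inv.clear {t : ℕ} {b : Sim} (hb : Inv S 𝓕 lam D N t b) (f : Data) :
    Inv S 𝓕 lam D N t (b.clear f) := by
  have h := forall₂_clearFirst f b.keys
  have hlen : (b.clear f).keys.length = b.keys.length := h.length_eq.symm
  refine ⟨hb.lam_eq, { hb.fits with keys_le := hlen.le.trans hb.fits.keys_le, vrfy := ?_ },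
    hlen.le.trans hb.keys_le, hb.encs_le⟩
  intro e' he' hi
  obtain ⟨e, he, h1, h2⟩ : ∃ e ∈ b.keys, e.idx = e'.idx ∧ e.vk = e'.vk := by
    change e' ∈ clearFirst f b.keys at he'
    clear hi hlen
    generalize clearFirst f b.keys = l' at h he'
    generalize b.keys = l at h
    induction h with
    | nil => cases he'
    | cons h _ ih =>
      rcases List.mem_cons.1 he' with rfl | h'
      · exact ⟨_, List.mem_cons_self .., h⟩
      · obtain ⟨e, he, h⟩ := ih h'
        exact ⟨e, List.mem_cons_of_mem _ he, h⟩
  rw [← h2]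
  exact hb.fits.vrfy e he (by rw [h1]; exact hi)

theorem _root_.KeyLeasing.Ens.mem_bind_fst {E : Ens} {K : Data → Ens} {s : Data × QMem}
    (h : s ∈ E.bind K) : ∃ r ∈ E, ∃ t, t ∈ K r.1 ∧ s.1 = t.1 := by
  obtain ⟨r, hr, t, ht, rfl⟩ := Ens.mem_bind.1 h
  exact ⟨r, hr, t, ht, rfl⟩

theorem mem_pure {s : Data × QMem} {a : Data} (h : s ∈ Ens.pure a) : s.1 = a := by
  rw [List.mem_singleton.1 h]

theorem len_of_mem_encs {l : List Data} {x : Data} {r : Data × QMem} (h : r ∈ encs S l x) :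
    r.1.len = l.length := by
  rw [len_eq_length, (Ens.mem_lists h).length_eq, List.length_map]

theorem leads_react {t : ℕ} {b : Sim} (hb : Inv S 𝓕 lam D N t b) (ht : t + 1 ≤ N)
    (aS : Data) {msg : Data} (hn : (Query.decode msg).cost ≤ N) {s : Data × QMem}
    (hs : s ∈ react S 𝓕 b aS msg) : Leads S 𝓕 lam D N (t + 1) aS s.1 := by
  have hb' := hb.mono (Nat.le_succ t)
  have hpre : b.pre.length ≤ N := by
    have := hb.fits.length_eq
    have := hb.fits.lam_le
    omega
  rcases msg with _ | ⟨t, d⟩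
  · rw [mem_pure hs]
    exact leads_guess
  rcases t with _ | ⟨_, _ | ⟨_, _ | ⟨_, _ | ⟨_, _ | ⟨_, t⟩⟩⟩⟩⟩
  · rw [mem_pure hs]
    exact ⟨Nat.zero_le _, .inl trivial⟩
  · rw [mem_pure hs]
    exact leads_answer hb' _ _
  · change s ∈ reactEnc S 𝓕 b aS d at hs
    rw [reactEnc] at hs
    split_ifs at hs
    · obtain ⟨P, hP, s, hs, hv⟩ := Ens.mem_bind_fst hs
      rw [hv]
      clear hv
      obtain ⟨Q, -, s, hs, hv⟩ := Ens.mem_bind_fst hs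
      rw [hv]
      clear hv
      rw [mem_pure hs]
      exact leads_ask hb' (hb.enc ht) _ _ _ _ (Nat.zero_le _)
        (.inr (.inr ⟨rfl, _, _, rfl, (len_of_mem_encs hP).trans_le hpre⟩))
    · rw [mem_pure hs]
      exact leads_answer hb' _ _
  · change s ∈ reactKg S 𝓕 b aS d.fst d.snd at hs
    rw [reactKg] at hs
    split_ifs at hs with hc
    · dsimp only at hs
      split_ifs at hs with hk
      · rw [mem_pure hs]
        refine leads_ask hb' (hb.addKey ht fun h => absurd hk h) _ _ _ _ (Nat.zero_le _)
          (.inr (.inl rfl))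
      · obtain ⟨r, hr, s, hs, hv⟩ := Ens.mem_bind_fst hs
        rw [hv]
        clear hv
        rw [mem_pure hs]
        refine leads_answer (hb.addKey ht fun _ => ?_) _ _
        have hlev := level_le b.lam d.snd.len
        have hlev' := level_pos hb.fits.lam_pos d.snd.len
        refine (hb.fits.kg _ (by omega) hk ?_ _ hc.1).2 r hr
        rw [Nat.sub_add_cancel hlev']
        exact (two_pow_level_le hc.2.1).trans (Nat.mul_le_mul_left 2 hn)
    · rw [mem_pure hs]
      exact leads_answer hb' _ _
  · change s ∈ reactVrfy S b aS d at hs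
    rw [reactVrfy] at hs
    split at hs
    · rw [mem_pure hs]
      exact leads_answer hb' _ _
    · split_ifs at hs
      · rw [mem_pure hs]
        exact leads_ask hb' (hb'.clear _) _ _ _ _ (Nat.zero_le _) (.inl rfl)
      · rw [mem_pure hs]
        exact leads_ask hb' hb' _ _ _ _ (Nat.zero_le _) (.inl rfl)
      · obtain ⟨r, -, s, hs, hv⟩ := Ens.mem_bind_fst hs
        rw [hv]
        clear hv
        rw [mem_pure hs]
        split_ifs
        · exact leads_answer (hb'.clear _) _ _
        · exact leads_answer hb' _ _
  · change s ∈ reactChal S b aS at hs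
    rw [reactChal] at hs
    split_ifs at hs
    · rw [mem_pure hs]
      exact leads_answer hb' _ _
    · rw [mem_pure hs]
      exact leads_guess
    · obtain ⟨P, hP, s, hs, hv⟩ := Ens.mem_bind_fst hs
      rw [hv]
      clear hv
      obtain ⟨Q, -, s, hs, hv⟩ := Ens.mem_bind_fst hs
      rw [hv]
      clear hv
      rw [mem_pure hs]
      exact leads_ask hb' hb'.chal _ _ _ _ (Nat.zero_le _)
        (.inr (.inr ⟨rfl, _, _, rfl, (len_of_mem_encs hP).trans_le hpre⟩))

theorem mem_setups {lam q i k : ℕ} {s : Data × QMem} (h : s ∈ setups S lam q i k) :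
    s.1.toList.length = k ∧ ∀ j, j < k → ∃ m,
      (s.1.toList.getD j .nil, m) ∈ (S.atBound (2 ^ (i + j + 1))).setup lam q := by
  have h' := Ens.mem_lists h
  have hlen : s.1.toList.length = k := by simpa using h'.length_eq
  refine ⟨hlen, fun j hj => ?_⟩
  have := (List.forall₂_iff_get.1 h').2 j (by omega) (by simpa using hj)
  simpa [List.getD_eq_getElem, hlen, hj] using this

/-- The session that is opened in state `b`, if the lists of master secret keys are honest. -/
theorem Setting.inv_start (h : Setting S 𝓕 pX pF pE A lam TA D N) {q : ℕ} (hq : 0 < q)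
    (hqN : q ≤ N) {x₀ x₁ : Data} (h₀ : x₀ ∈ 𝓕.X lam) (h₁ : x₁ ∈ 𝓕.X lam) {i : ℕ} (hi : i < lam)
    {P Q : Data × QMem} (hP : P ∈ setups S lam q 0 i)
    (hQ : Q ∈ setups S lam q (i + 1) (lam - (i + 1))) (t : ℕ) :
    Inv S 𝓕 lam D N t ⟨[], 0, false, lam, x₀, x₁, q, P.1.toList, Q.1.toList⟩ := by
  obtain ⟨hP₁, hP₂⟩ := mem_setups hP
  obtain ⟨hQ₁, hQ₂⟩ := mem_setups hQ
  have hN := h.le_N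
  have hl := h.lam_pos
  have hall : ∀ k < lam, k ≠ i → ∃ m,
      ((P.1.toList ++ .nil :: Q.1.toList).getD k .nil, m) ∈
        (S.atBound (2 ^ (k + 1))).setup lam q := by
    intro k hk hki
    rcases lt_or_gt_of_ne hki with hlt | hgt
    · obtain ⟨m, hm⟩ := hP₂ k hlt
      refine ⟨m, ?_⟩
      rw [List.getD_append _ _ _ _ (by omega)]
      rwa [Nat.zero_add] at hm
    · obtain ⟨j, rfl⟩ := Nat.exists_eq_add_of_lt hgt
      obtain ⟨m, hm⟩ := hQ₂ j (by omega)
      refine ⟨m, ?_⟩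
      rw [List.getD_append_right _ _ _ _ (by omega), hP₁,
        show i + j + 1 - i = j + 1 by omega, List.getD_cons_succ]
      rwa [show i + 1 + j + 1 = i + j + 1 + 1 by omega] at hm
  refine ⟨rfl, ⟨hl, by simp only; omega, Nat.zero_le _, Nat.zero_le _, by simp only; omega, h₀, h₁,
    ?_, ?_, ?_⟩, Nat.zero_le _, Nat.zero_le _⟩
  · intro k hk x hx
    simp only at hk hx
    rcases List.mem_append.1 hk with hk | hk
    · obtain ⟨j, hj, rfl⟩ := List.getElem_of_mem hk
      obtain ⟨m, hm⟩ := hP₂ j (by omega)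
      rw [List.getD_eq_getElem _ _ hj] at hm
      exact h.enc q hq hqN _ (by omega) _ hm x hx
    · obtain ⟨j, hj, rfl⟩ := List.getElem_of_mem hk
      obtain ⟨m, hm⟩ := hQ₂ j (by omega)
      rw [List.getD_eq_getElem _ _ hj] at hm
      exact h.enc q hq hqN _ (by omega) _ hm x hx
  · intro k hk hki hkN f hf
    simp only [hP₁] at hk hki hf
    obtain ⟨m, hm⟩ := hall k hk hki
    exact h.keyTime q hq hqN (k + 1) (by omega) hkN _ hm f hf
  · intro e he
    cases he

theorem size_decode_opened (b : Sim) (aS : Data) :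
    Query.decode (opened b aS).snd = .start b.q (2 ^ (b.pre.length + 1)) b.x₀ b.x₁ := by
  show Query.start (unary b.q).len (binary (2 ^ (b.pre.length + 1))).ofBinary b.x₀ b.x₁ = _
  rw [Data.len_unary, Data.ofBinary_binary_two_pow]

theorem leads_opened {t : ℕ} {b : Sim} (hb : Inv S 𝓕 lam D N t b) (hq : b.q ≤ N) (aS : Data) :
    Leads S 𝓕 lam D N t aS (opened b aS) := by
  obtain ⟨h1, h2, h3⟩ := le_budget D N
  refine ⟨?_, .inr fun reply => ?_⟩
  -- Being written in binary, the declared bound costs at most `lam + 1` steps, in addition to the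
  -- `q` steps for `1^q`.
  · rw [size_decode_opened, Query.cost, Algs.size_two_pow]
    have := hb.fits.length_eq
    have := hb.fits.lam_le
    omega
  by_cases hr : reply = .nil
  · subst hr
    exact ⟨_, _, Det.mono (preP_refused _ _ _ _ _ _) (by omega), .inr ⟨b, rfl, hb⟩⟩
  · exact ⟨_, _, Det.mono (preP_plain _ _ _ _ _ _ hr) (by omega), .inr ⟨b, rfl, hb⟩⟩

theorem Setting.leads_start (h : Setting S 𝓕 pX pF pE A lam TA D N) (t : ℕ) (aS : Data) {msg : Data}
    (hn : (Query.decode msg).cost ≤ N) {s : Data × QMem} (hs : s ∈ reactStart S 𝓕 lam aS msg) :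
    Leads S 𝓕 lam D N t aS s.1 := by
  rcases msg with _ | ⟨u, d⟩
  · rw [mem_pure hs]
    exact leads_guess
  rw [reactStart] at hs
  split_ifs at hs with hc
  · obtain ⟨w, hw, s, hs, hv⟩ := Ens.mem_bind_fst hs
    rw [hv]
    clear hv
    split_ifs at hs with hlt
    · rw [openAt] at hs
      obtain ⟨P, hP, s, hs, hv⟩ := Ens.mem_bind_fst hs
      rw [hv]
      clear hv
      obtain ⟨Q, hQ, s, hs, hv⟩ := Ens.mem_bind_fst hs
      rw [hv]
      clear hv
      rw [mem_pure hs]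
      have hq : d.fst.len ≤ N := by
        simp only [Query.decode, hc.1] at hn
        exact (Nat.le_add_right _ _).trans hn
      exact leads_opened (h.inv_start hc.2.1 hq hc.2.2.1 hc.2.2.2 hlt hP hQ t) hq aS
    · rw [mem_pure hs]
      exact leads_guess
  · rw [mem_pure hs]
    exact leads_guess

theorem isGuess_react {b : Sim} {aS msg : Data} (hg : (Query.decode msg).IsGuess)
    {s : Data × QMem} (hs : s ∈ react S 𝓕 b aS msg) : s.1 = .cons .nil msg := by
  rcases msg with _ | ⟨t, d⟩
  · exact mem_pure hs
  rcases t with _ | ⟨_, _ | ⟨_, _ | ⟨_, _ | ⟨_, _ | ⟨_, t⟩⟩⟩⟩⟩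
  · exact mem_pure hs
  all_goals exact hg.elim

theorem isGuess_start {aS msg : Data} (hg : (Query.decode msg).IsGuess)
    {s : Data × QMem} (hs : s ∈ reactStart S 𝓕 lam aS msg) : s.1 = .cons .nil .nil := by
  rcases msg with _ | ⟨t, d⟩
  · exact mem_pure hs
  rw [reactStart] at hs
  split_ifs at hs with hc
  · simp [Query.decode, hc.1, Query.IsGuess] at hg
  · exact mem_pure hs

theorem Setting.postP_framed (h : Setting S 𝓕 pX pF pE A lam TA D N) {t : ℕ} {info : Data}
    (hi : InvInfo S 𝓕 lam D N t info) (a : Data) (hn : (Query.decode a.snd).cost ≤ N) :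
    (postP S pX pF pE).Framed (.cons info a) (10000 * budget D N)
      ((postP S pX pF pE).out (.cons info a) QMem.empty) := by
  rcases hi with rfl | ⟨b, rfl, hb⟩
  · have hp := postP_start_framed h.lam_pos ((Nat.le_add_left _ _).trans h.le_N) h.deciders a hn
      h.setup
    rwa [hp.computes_empty.out_eq]
  · have hp := Reduction.postP_framed (a := a) (by rw [hb.lam_eq]; exact h.deciders) hb.fits hn
    rwa [hp.computes_empty.out_eq]

theorem Setting.leads_post (h : Setting S 𝓕 pX pF pE A lam TA D N) {t : ℕ} (ht : t + 1 ≤ N)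
    {info : Data} (hi : InvInfo S 𝓕 lam D N t info) {a : Data}
    (hn : (Query.decode a.snd).cost ≤ N) {s : Data × QMem}
    (hs : s ∈ (postP S pX pF pE).out (.cons info a) QMem.empty) :
    Leads S 𝓕 lam D N (t + 1) a.fst s.1 ∧
      ((Query.decode a.snd).IsGuess → (Query.decode s.1.snd).IsGuess) := by
  rcases hi with rfl | ⟨b, rfl, hb⟩
  · have hp := postP_start_framed h.lam_pos ((Nat.le_add_left _ _).trans h.le_N) h.deciders a hn
      h.setup
    rw [hp.computes_empty.out_eq] at hs
    exact ⟨h.leads_start _ _ hn hs, fun hg => by rw [isGuess_start hg hs]; trivial⟩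
  · have hp := Reduction.postP_framed (a := a) (by rw [hb.lam_eq]; exact h.deciders) hb.fits hn
    rw [hp.computes_empty.out_eq] at hs
    exact ⟨leads_react hb ht _ hn hs, fun hg => by rw [isGuess_react hg hs]; exact hg⟩

/-- The reduction is about to be run on `v`, and to run the adversary on `vA` and `m`. -/
structure Good (S : Algs) (𝓕 : FunClass) (A : Prog) (lam TA D N : ℕ) (v vA info : Data) (m : QMem)
    (t : ℕ) : Prop where
  pre : preP.Det v (.cons info vA) (1000 * budget D N)
  inv : InvInfo S 𝓕 lam D N t info
  reach : Reach A TA lam vA m t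

theorem Setting.lt_of_reach (h : Setting S 𝓕 pX pF pE A lam TA D N) {v : Data} {m : QMem} {t : ℕ}
    (hr : Reach A TA lam v m t) {o : Data × QMem} (ho : o ∈ A.out v m) :
    t + 1 ≤ N ∧ (Query.decode o.1.snd).cost ≤ N := by
  obtain ⟨r, -, -, -, hc, hT⟩ := h.exists_branch hr ho
  have := h.le_N
  omega

theorem Setting.computes_round (h : Setting S 𝓕 pX pF pE A lam TA D N) {v vA info : Data} {m : QMem}
    {t : ℕ} (hg : Good S 𝓕 A lam TA D N v vA info m t) :
    (adversary S pX pF pE A).Computes v m (TA + 12000 * budget D N)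
      ((A.out vA m).flatMap fun o =>
        ((postP S pX pF pE).out (.cons info o.1) QMem.empty).after o.2) := by
  refine (adversary_computes (K := fun a => (postP S pX pF pE).out (.cons info a) QMem.empty) hg.pre
    (h.computes hg.reach) fun o ho =>
    h.postP_framed hg.inv o.1 (h.lt_of_reach hg.reach ho).2).mono ?_
  have := (le_budget D N).1
  omega

/-- The time bound of the adversary holds for arbitrary replies. It therefore applies inside the
reduction without any knowledge that the simulation is faithful. -/
theorem Setting.good_next (h : Setting S 𝓕 pX pF pE A lam TA D N) {v vA info : Data} {m : QMem}
    {t : ℕ} (hg : Good S 𝓕 A lam TA D N v vA info m t) {o : Data × QMem} (ho : o ∈ A.out vA m)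
    {s : Data × QMem} (hs : s ∈ (postP S pX pF pE).out (.cons info o.1) QMem.empty) :
    (Query.decode s.1.snd).cost ≤ 3 * N ∧ ∃ t', t < t' ∧ t' ≤ TA ∧
      (¬ (Query.decode s.1.snd).IsGuess → ∀ (reply : Data) (φ : QMem), φ.normSq ≠ 0 →
        ∃ info' replyA, Good S 𝓕 A lam TA D N (.cons s.1.fst reply) (.cons o.1.fst replyA) info'
          ((o.2.tensor s.2).tensor φ) t') := by
  obtain ⟨hlt, hcost⟩ := h.lt_of_reach hg.reach ho
  obtain ⟨hL, hgu⟩ := h.leads_post hlt hg.inv hcost hs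
  obtain ⟨r, hr, hv, hm, hc, hT⟩ := h.exists_branch hg.reach ho
  refine ⟨hL.1, _, ?_, hT, fun hn reply φ hφ => ?_⟩
  · omega
  obtain ⟨info', replyA, hpre, hinv⟩ := (hL.2.resolve_left hn) reply
  refine ⟨info', replyA, hpre, hinv.mono (by omega), ?_⟩
  -- What the reduction leaves in the memory and the reply of its challenger together form the
  -- quantum reply to the adversary. `Reach` asks for a nonzero reply, which is why outcomes of norm
  -- zero had to be excluded.
  rw [QMem.tensor_assoc, ← hm]
  refine Reach.next replyA _ hg.reach hr hv (fun h' => hn (hgu h')) ?_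
  rw [QMem.normSq_tensor]
  exact mul_ne_zero (out_ne_zero (by simp [QMem.normSq_empty]) hs) hφ

theorem good_start (hl : 0 < lam) : Good S 𝓕 A lam TA D N (.cons (unary lam) .nil)
    (.cons (unary lam) .nil) (.cons .nil (unary lam)) QMem.empty 0 :=
  ⟨(preP_start hl).mono (by have := (le_budget D N).1; omega), .inl rfl, .start⟩

/-- An activation of the reduction, including its message of cost at most `3 * N`, takes at most `TA
+ 20000 * budget D N` steps, and it contains at least one step of the adversary. So the time is
bounded by this number times the time `tA` of the adversary. -/
theorem Setting.good_of_reach (h : Setting S 𝓕 pX pF pE A lam TA D N) {T : ℕ}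
    (hT : (TA + 20000 * budget D N) * (TA + 1) ≤ T) {v : Data} {m : QMem} {t : ℕ}
    (hr : Reach (adversary S pX pF pE A) T lam v m t) :
    ∃ vA info tA, Good S 𝓕 A lam TA D N v vA info m tA ∧
      t ≤ (TA + 20000 * budget D N) * tA := by
  obtain ⟨h1, h2, h3⟩ := le_budget D N
  induction hr with
  | start => exact ⟨_, _, 0, good_start h.lam_pos, Nat.zero_le _⟩
  | @next v m t r a reply φ hr hrun hv hng hφ ih =>
    obtain ⟨vA, info, tA, hg, ht⟩ := ih
    have hle : TA + 12000 * budget D N ≤ T :=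
      le_trans (by omega) ((Nat.le_mul_of_pos_right _ (Nat.succ_pos TA)).trans hT)
    obtain ⟨s', hs', hv', hm', hc'⟩ := (h.computes_round hg T hle).exists_of_mem hrun
    obtain ⟨o, ho, hs'⟩ := List.mem_flatMap.1 hs'
    obtain ⟨s, hs, rfl⟩ := List.mem_map.1 hs'
    rw [hv] at hv'
    obtain rfl := Option.some.inj hv'
    obtain ⟨hq, t', htt, htT, hnext⟩ := h.good_next hg ho hs
    obtain ⟨info', replyA, hg'⟩ := hnext hng reply φ hφ
    refine ⟨_, _, t', by rw [hm']; exact hg', ?_⟩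
    calc t + r.cost + (Query.decode s.1.snd).cost
        ≤ (TA + 20000 * budget D N) * tA + (TA + 20000 * budget D N) := by omega
      _ = (TA + 20000 * budget D N) * (tA + 1) := by ring
      _ ≤ _ := Nat.mul_le_mul_left _ htt

theorem Setting.adversary_time (h : Setting S 𝓕 pX pF pE A lam TA D N) {T : ℕ}
    (hT : (TA + 20000 * budget D N) * (TA + 1) ≤ T) {v : Data} {m : QMem} {t : ℕ}
    (hr : Reach (adversary S pX pF pE A) T lam v m t) {r : Branch}
    (hrun : r ∈ (adversary S pX pF pE A).run T v m) :
    ∃ a : Data, r.val = some a ∧ t + r.cost + (Query.decode a.snd).cost ≤ T := by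
  obtain ⟨h1, h2, h3⟩ := le_budget D N
  obtain ⟨vA, info, tA, hg, ht⟩ := h.good_of_reach hT hr
  have hle : TA + 12000 * budget D N ≤ T :=
    le_trans (by omega) ((Nat.le_mul_of_pos_right _ (Nat.succ_pos TA)).trans hT)
  obtain ⟨s', hs', hv', hm', hc'⟩ := (h.computes_round hg T hle).exists_of_mem hrun
  obtain ⟨o, ho, hs'⟩ := List.mem_flatMap.1 hs'
  obtain ⟨s, hs, rfl⟩ := List.mem_map.1 hs'
  obtain ⟨hq, t', htt, htT, -⟩ := h.good_next hg ho hs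
  refine ⟨_, hv', ?_⟩
  calc t + r.cost + (Query.decode s.1.snd).cost
      ≤ (TA + 20000 * budget D N) * tA + (TA + 20000 * budget D N) := by omega
    _ = (TA + 20000 * budget D N) * (tA + 1) := by ring
    _ ≤ (TA + 20000 * budget D N) * (TA + 1) := Nat.mul_le_mul_left _ (by omega)
    _ ≤ T := hT

theorem Deciders.mono {D D' : ℕ} (h : Deciders 𝓕 pX pF pE lam D) (hD : D ≤ D') :
    Deciders 𝓕 pX pF pE lam D' where
  plaintext d := (h.plaintext d).imp fun _ ha => ⟨ha.1, ha.2.mono hD⟩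
  function d := (h.function d).imp fun _ ha => ⟨ha.1, ha.2.mono hD⟩
  eval f hf x hx := (h.eval f hf x hx).mono hD

/-- For all values of the security parameter, the subroutines run in polynomial time. -/
theorem exists_setting {c cS : ℕ} (hD : ∀ lam, 0 < lam → Deciders 𝓕 pX pF pE lam (poly c lam))
    (hS : S.Times 𝓕 cS) (hA : QPT A) : ∃ TA D N : ℕ → ℕ, PolyBdd TA ∧ PolyBdd D ∧ PolyBdd N ∧
      ∀ lam, 0 < lam → Setting S 𝓕 pX pF pE A lam (TA lam) (D lam) (N lam) := by
  obtain ⟨cA, hA⟩ := hA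
  have hTA : PolyBdd fun lam => poly cA lam := PolyBdd.comp_poly .id _
  have hN : PolyBdd fun lam => poly cA lam + lam := hTA.add .id
  -- With `N` denoting the bound `poly cA lam + lam`, the arguments to be dominated are `lam + q +
  -- (j + 1)` with `q ≤ N` and `j ≤ lam`, and `lam + q + 2 ^ j` with `2 ^ j ≤ 2 * N`. Both are at
  -- most `5 * N`.
  refine ⟨_, fun lam => poly c lam + poly cS (5 * (poly cA lam + lam)), _, hTA,
    (PolyBdd.comp_poly .id _).add (((PolyBdd.const 5).mul hN).comp_poly _), hN, fun lam hl => ?_⟩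
  have hp : ∀ {a}, a ≤ 5 * (poly cA lam + lam) →
      poly cS a ≤ poly c lam + poly cS (5 * (poly cA lam + lam)) := fun ha =>
    (poly_mono ha).trans (Nat.le_add_left _ _)
  exact
    { lam_pos := hl
      adv := hA lam hl
      le_N := le_rfl
      deciders := Deciders.mono (hD lam hl) (Nat.le_add_right _ _)
      setup := fun q hq hqN j hj => (hS.setup hl hq).mono (hp (by omega))
      enc := fun q hq hqN j hj s hs x hx => (hS.enc hl hq hs hx).mono (hp (by omega))
      keyTime := fun q hq hqN j hj hjN s hs f hf =>
        ⟨(hS.keyTime hl hq s hs f hf).1.mono (hp (by omega)), fun k hk z =>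
          ((hS.keyTime hl hq s hs f hf).2 k hk z).mono (hp (by omega))⟩ }

theorem qpt_adversary {TA D N : ℕ → ℕ} (hTA : PolyBdd TA) (hD : PolyBdd D) (hN : PolyBdd N)
    (h : ∀ lam, 0 < lam → Setting S 𝓕 pX pF pE A lam (TA lam) (D lam) (N lam)) :
    QPT (adversary S pX pF pE A) := by
  have hb : PolyBdd fun lam => budget (D lam) (N lam) :=
    (hD.add (.const 1)).mul ((hN.add (.const 1)).pow 2)
  obtain ⟨c, hc⟩ := PolyBdd.exists_poly
    ((hTA.add ((PolyBdd.const 20000).mul hb)).mul (hTA.add (.const 1)))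
  exact ⟨c, fun lam hl v m t hr r hrun => (h lam hl).adversary_time (hc lam hl) hr hrun⟩

end Reduction

end KeyLeasing

namespace KeyLeasing

open Data (unary binary ofList)

/-! ## Experiments with an arbitrary challenger -/

/-- A challenger: its reaction to a message. -/
abbrev Challenger := Option Session → Query → List (Option Session × Data × QMem)

namespace Challenger

/-- The probability that an experiment outputs `1`, continued from a message of the adversary. -/
noncomputable def after (𝒞 : Challenger) (K : Option Session → Data → QMem → ENNReal)
    (σ : Option Session) (o : Data × QMem) : ENNReal :=
  match Query.decode o.1.snd with
  | .guess b => if b then ENNReal.ofReal o.2.normSq else 0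
  | msg => ((𝒞 σ msg).map fun a => K a.1 (.cons o.1.fst a.2.1) (o.2.tensor a.2.2)).sum

/-- As `play`, for an arbitrary challenger. -/
noncomputable def play (𝒞 : Challenger) (A : Prog) :
    ℕ → Option Session → Data → QMem → ENNReal
  | 0, _, _, _ => 0
  | R + 1, σ, v, m => ((A.out v m).map (𝒞.after (𝒞.play A R) σ)).sum

theorem after_guess {𝒞 : Challenger} {K : Option Session → Data → QMem → ENNReal}
    {σ : Option Session} {o : Data × QMem} {b : Bool} (h : Query.decode o.1.snd = .guess b) :
    𝒞.after K σ o = if b then ENNReal.ofReal o.2.normSq else 0 := by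
  rw [after, h]

theorem after_of_not_guess {𝒞 : Challenger} {K : Option Session → Data → QMem → ENNReal}
    {σ : Option Session} {o : Data × QMem} (h : ¬ (Query.decode o.1.snd).IsGuess) :
    𝒞.after K σ o = ((𝒞 σ (Query.decode o.1.snd)).map fun a =>
      K a.1 (.cons o.1.fst a.2.1) (o.2.tensor a.2.2)).sum := by
  rw [after]
  cases hq : Query.decode o.1.snd with
  | guess b => simp [hq, Query.IsGuess] at h
  | _ => rfl

theorem _root_.KeyLeasing.play_eq (G : Game) (𝓕 : FunClass) (lam : ℕ) (coin : Bool) (A : Prog) (R : ℕ) :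
    KeyLeasing.play G 𝓕 lam coin A R = Challenger.play (respond G 𝓕 lam coin) A R := by
  induction R with
  | zero => rfl
  | succ R ih =>
    funext σ v m
    rw [KeyLeasing.play, Challenger.play, ih]
    congr 2

theorem after_mono {𝒞 : Challenger} {K K' : Option Session → Data → QMem → ENNReal}
    (h : ∀ σ v m, K σ v m ≤ K' σ v m) (σ : Option Session) (o : Data × QMem) :
    𝒞.after K σ o ≤ 𝒞.after K' σ o := by
  by_cases hg : (Query.decode o.1.snd).IsGuess
  · cases hq : Query.decode o.1.snd with
    | guess b => rw [after_guess hq, after_guess hq]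
    | _ => rw [hq] at hg; exact hg.elim
  · rw [after_of_not_guess hg, after_of_not_guess hg]
    exact List.sum_le_sum fun a _ => h _ _ _

theorem play_mono (𝒞 : Challenger) (A : Prog) : Monotone (𝒞.play A) := by
  refine monotone_nat_of_le_succ fun R => ?_
  induction R with
  | zero => intro σ v m; exact zero_le
  | succ R ih => intro σ v m; exact List.sum_le_sum fun o _ => after_mono ih σ o

/-- Probabilities are quadratic in the amplitudes. This extracts the probability of the random index
from the rest of the experiment. -/
theorem play_scale (𝒞 : Challenger) (A : Prog) (R : ℕ) (σ : Option Session) (v : Data) (m : QMem)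
    {z : ℂ} (hz : z ≠ 0) :
    𝒞.play A R σ v (m.scale z) = ENNReal.ofReal (Complex.normSq z) * 𝒞.play A R σ v m := by
  induction R generalizing σ v m with
  | zero => simp [play]
  | succ R ih =>
    rw [play, play, Prog.out_scale hz, List.map_map, ← List.sum_map_mul_left]
    congr 1
    refine List.map_congr_left fun o _ => ?_
    by_cases hg : (Query.decode o.1.snd).IsGuess
    · cases hq : Query.decode o.1.snd with
      | guess b =>
        rw [Function.comp_apply, after_guess (o := (o.1, o.2.scale z)) hq, after_guess hq,
          QMem.normSq_scale,
          ENNReal.ofReal_mul (Complex.normSq_nonneg z)]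
        split_ifs <;> simp
      | _ => rw [hq] at hg; exact hg.elim
    · rw [Function.comp_apply, after_of_not_guess (o := (o.1, o.2.scale z)) hg,
        after_of_not_guess hg,
        ← List.sum_map_mul_left]
      congr 1
      refine List.map_congr_left fun a _ => ?_
      rw [QMem.scale_tensor, ih]

/-- The reactions to a message have total probability at most one. -/
def Bounded (𝒞 : Challenger) : Prop :=
  ∀ σ q, ((𝒞 σ q).map fun a => ENNReal.ofReal a.2.2.normSq).sum ≤ 1

/-- By induction, neither the adversary nor a bounded challenger creates probability. It makes all
values finite, so that they can be subtracted as real numbers. -/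
theorem play_le {𝒞 : Challenger} (h𝒞 : 𝒞.Bounded) (A : Prog) (R : ℕ) (σ : Option Session) (v : Data)
    (m : QMem) : 𝒞.play A R σ v m ≤ ENNReal.ofReal m.normSq := by
  induction R generalizing σ v m with
  | zero => exact zero_le
  | succ R ih =>
    have h1 : ∀ o : Data × QMem, 𝒞.after (𝒞.play A R) σ o ≤ ENNReal.ofReal o.2.normSq := by
      intro o
      by_cases hg : (Query.decode o.1.snd).IsGuess
      · cases hq : Query.decode o.1.snd with
        | guess b =>
          rw [after_guess hq]
          split_ifs
          · exact le_rfl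
          · exact zero_le
        | _ => rw [hq] at hg; exact hg.elim
      · rw [after_of_not_guess hg]
        calc _ ≤ ((𝒞 σ (Query.decode o.1.snd)).map fun a =>
              ENNReal.ofReal o.2.normSq * ENNReal.ofReal a.2.2.normSq).sum := by
                refine List.sum_le_sum fun a _ => (ih _ _ _).trans_eq ?_
                rw [QMem.normSq_tensor, ENNReal.ofReal_mul (QMem.normSq_nonneg _)]
          _ = ENNReal.ofReal o.2.normSq *
              ((𝒞 σ (Query.decode o.1.snd)).map fun a => ENNReal.ofReal a.2.2.normSq).sum :=
                List.sum_map_mul_left ..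
          _ ≤ ENNReal.ofReal o.2.normSq * 1 := by gcongr; exact h𝒞 _ _
          _ = _ := mul_one _
    calc _ ≤ ((A.out v m).map fun o => ENNReal.ofReal o.2.normSq).sum :=
          List.sum_le_sum fun o _ => h1 o
      _ = ENNReal.ofReal ((A.out v m).map fun o => o.2.normSq).sum := by
          generalize A.out v m = L
          induction L with
          | nil => simp
          | cons o L ih =>
            simp only [List.map_cons, List.sum_cons]
            rw [ih, ENNReal.ofReal_add (QMem.normSq_nonneg _)]
            exact List.sum_nonneg fun x hx => by
              obtain ⟨o, -, rfl⟩ := List.mem_map.1 hx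
              exact QMem.normSq_nonneg _
      _ ≤ _ := ENNReal.ofReal_le_ofReal (A.mass_out_le v m)

end Challenger

end KeyLeasing

namespace KeyLeasing

open Data (unary binary ofList)

/-! ## Sums over ensembles -/

namespace Ens

/-- The sum of a function over an ensemble. -/
noncomputable def total (E : Ens) (Φ : Data → QMem → ENNReal) : ENNReal :=
  (E.map fun r => Φ r.1 r.2).sum

theorem total_congr {E : Ens} {Φ Ψ : Data → QMem → ENNReal} (h : ∀ r ∈ E, Φ r.1 r.2 = Ψ r.1 r.2) :
    E.total Φ = E.total Ψ := by
  rw [total, total, List.map_congr_left h]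

theorem total_pure (a : Data) (Φ : Data → QMem → ENNReal) : (pure a).total Φ = Φ a QMem.empty := by
  simp [total, pure]

theorem total_mapVal (g : Data → Data) (E : Ens) (Φ : Data → QMem → ENNReal) :
    (E.mapVal g).total Φ = E.total fun a => Φ (g a) := by
  simp [total, mapVal, Function.comp_def]

theorem total_flatMap {α : Type*} (L : List α) (F : α → Ens) (Φ : Data → QMem → ENNReal) :
    total (L.flatMap F) Φ = (L.map fun a => (F a).total Φ).sum := by
  induction L with
  | nil => rfl
  | cons a L ih =>
    simp only [total, List.flatMap_cons, List.map_append, List.sum_append, List.map_cons,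
      List.sum_cons] at ih ⊢
    rw [ih]

theorem total_after (E : Ens) (m : QMem) (Φ : Data → QMem → ENNReal) :
    (E.after m).total Φ = E.total fun a k => Φ a (m.tensor k) := by
  simp [total, after, Function.comp_def]

theorem total_bind (E : Ens) (K : Data → Ens) (Φ : Data → QMem → ENNReal) :
    (E.bind K).total Φ = E.total fun a m => (K a).total fun b k => Φ b (m.tensor k) := by
  rw [bind, total_flatMap]
  simp only [total_after]
  rfl

theorem total_comm (E F : Ens) (Φ : Data → QMem → Data → QMem → ENNReal) :
    (E.total fun a m => F.total (Φ a m)) = F.total fun b k => E.total fun a m => Φ a m b k := by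
  induction E with
  | nil => simp [total]
  | cons r E ih =>
    simp only [total, List.map_cons, List.sum_cons] at ih ⊢
    rw [ih, List.sum_map_add]

theorem total_mul_left (E : Ens) (c : ENNReal) (Φ : Data → QMem → ENNReal) :
    (E.total fun a m => c * Φ a m) = c * E.total Φ := List.sum_map_mul_left ..

theorem total_lists_append (es fs : List Ens) (Φ : Data → QMem → ENNReal) :
    (lists (es ++ fs)).total Φ = (lists es).total fun P m => (lists fs).total fun Q k =>
      Φ (ofList (P.toList ++ Q.toList)) (m.tensor k) := by
  induction es generalizing Φ with
  | nil => simp [lists_nil, total_pure, Data.toList, Data.ofList_toList, QMem.empty_tensor]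
  | cons e es ih =>
    simp only [List.cons_append, lists_cons, total_bind, total_mapVal, ih]
    simp only [Data.toList, List.cons_append, ofList, QMem.tensor_assoc]

/-- The quantum memory is without qubits. -/
def Scalar (E : Ens) : Prop := ∀ r ∈ E, r.2.size = 0

theorem scalar_lists {es : List Ens} (h : ∀ e ∈ es, Scalar e) : Scalar (lists es) := by
  induction es with
  | nil =>
    intro r hr
    rw [lists_nil, pure, List.mem_singleton] at hr
    rw [hr]
    rfl
  | cons e es ih =>
    intro r hr
    rw [lists_cons] at hr
    obtain ⟨s, hs, t, ht, rfl⟩ := mem_bind.1 hr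
    obtain ⟨u, hu, rfl⟩ := List.mem_map.1 ht
    have h1 := h e (List.mem_cons_self ..) s hs
    have h2 := ih (fun e he => h e (List.mem_cons_of_mem _ he)) u hu
    show s.2.size + u.2.size = 0
    omega

/-- Independent samples may be summed in any order, so the entry `e` can be drawn after all others.
Its memory then stands behind that of `fs`, which makes no difference because both are scalars. -/
theorem total_lists_split {es fs : List Ens} {e : Ens} (he : Scalar e) (hf : Scalar (lists fs))
    (Φ : Data → QMem → ENNReal) :
    (lists (es ++ e :: fs)).total Φ = (lists es).total fun P m => (lists fs).total fun Q k =>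
      e.total fun a l => Φ (ofList (P.toList ++ a :: Q.toList)) ((m.tensor k).tensor l) := by
  rw [total_lists_append]
  refine total_congr fun P _ => ?_
  rw [lists_cons, total_bind]
  simp only [total_mapVal]
  rw [total_comm]
  refine total_congr fun Q hQ => ?_
  refine total_congr fun a ha => ?_
  rw [QMem.tensor_assoc, QMem.tensor_comm_of_size (hf Q hQ) (he a ha)]
  rfl

/-- The total probability. -/
noncomputable def mass (E : Ens) : ENNReal := E.total fun _ m => ENNReal.ofReal m.normSq

theorem mass_mapVal (g : Data → Data) (E : Ens) : (E.mapVal g).mass = E.mass := total_mapVal ..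

theorem mass_bind_le {E : Ens} {K : Data → Ens} (hE : E.mass ≤ 1) (hK : ∀ a, (K a).mass ≤ 1) :
    (E.bind K).mass ≤ 1 := by
  refine le_trans ?_ hE
  rw [mass, total_bind]
  refine List.sum_le_sum fun r _ => ?_
  calc _ = ENNReal.ofReal r.2.normSq * (K r.1).mass := by
        rw [mass, ← total_mul_left]
        refine total_congr fun s _ => ?_
        rw [QMem.normSq_tensor, ENNReal.ofReal_mul (QMem.normSq_nonneg _)]
    _ ≤ ENNReal.ofReal r.2.normSq * 1 := by gcongr; exact hK _
    _ = _ := mul_one _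

theorem mass_pure (a : Data) : (pure a).mass = 1 := by
  simp [mass, total_pure, QMem.normSq_empty]

theorem mass_lists_le {es : List Ens} (h : ∀ e ∈ es, e.mass ≤ 1) : (lists es).mass ≤ 1 := by
  induction es with
  | nil => exact (mass_pure _).le
  | cons e es ih =>
    rw [lists_cons]
    refine mass_bind_le (h e (List.mem_cons_self ..)) fun a => ?_
    rw [mass_mapVal]
    exact ih fun e he => h e (List.mem_cons_of_mem _ he)

theorem mass_eq_ofReal (E : Ens) : E.mass = ENNReal.ofReal (E.map fun r => r.2.normSq).sum := by
  induction E with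
  | nil => simp [mass, total]
  | cons o L ih =>
    simp only [mass, total, List.map_cons, List.sum_cons] at ih ⊢
    rw [ih, ENNReal.ofReal_add (QMem.normSq_nonneg _)]
    exact List.sum_nonneg fun x hx => by
      obtain ⟨o, -, rfl⟩ := List.mem_map.1 hx
      exact QMem.normSq_nonneg _

end Ens

theorem Prog.mass_out_empty_le (p : Prog) (v : Data) : (p.out v QMem.empty).mass ≤ 1 := by
  rw [Ens.mass_eq_ofReal]
  refine (ENNReal.ofReal_le_ofReal (p.mass_out_le v _)).trans ?_
  simp [QMem.normSq_empty]

theorem Prog.IsClassical.scalar_out {p : Prog} (hp : p.IsClassical) (v : Data) :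
    Ens.Scalar (p.out v QMem.empty) := fun _ hr => hp.out_size hr

/-! ## Hybrid challengers -/

section

variable (S : Algs) (𝓕 : FunClass) (lam h : ℕ)

/-- A challenge ciphertext of which the first `h` components encrypt `x₁`, and the others `x₀`. -/
noncomputable def hybridEnc (msk x₀ x₁ : Data) : Ens :=
  Ens.lists (msk.toList.mapIdx fun j a =>
    S.enc.out (.cons a (if j < h ∨ lam ≤ h then x₁ else x₀)) QMem.empty)

open Classical in
/-- The challenger for dynamic availability bounds, with a hybrid challenge ciphertext. -/
noncomputable def hybrid : Challenger
  | some σ, .chal =>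
    if σ.challenged then refuse σ
    else if ∀ e ∈ σ.keys, 𝓕.ev lam e.f σ.x₀ ≠ 𝓕.ev lam e.f σ.x₁ → e.returned = true then
      (hybridEnc S lam h σ.msk σ.x₀ σ.x₁).map fun e =>
        (some { σ with challenged := true }, .ok e.1, e.2)
    else []
  | σ, q => respond S.instances.game 𝓕 lam false σ q

end

variable (S : Algs) (𝓕 : FunClass) {lam : ℕ}

theorem mapIdx_const {α β : Type*} (f : α → β) (l : List α) : l.mapIdx (fun _ a => f a) = l.map f := by
  induction l with
  | nil => rfl
  | cons a l ih => simp [List.mapIdx_cons, ih]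

theorem hybrid_zero (hl : 0 < lam) : hybrid S 𝓕 lam 0 = respond S.instances.game 𝓕 lam false := by
  funext σ q
  rcases σ with _ | σ <;> cases q <;> try rfl
  simp only [hybrid, respond]
  have : hybridEnc S lam 0 σ.msk σ.x₀ σ.x₁ = S.instances.enc σ.msk σ.x₀ := by
    rw [hybridEnc, Algs.instances_enc, ← mapIdx_const]
    simp [hl.ne']
  rw [this]
  rfl

/-- The alternative `lam ≤ h` in `hybridEnc` makes all components encrypt `x₁` even if the list of
master keys does not have length `lam`. The challengers are therefore equal as functions, not just
on honest keys. The price is the assumption `0 < lam` in `hybrid_zero`. -/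
theorem hybrid_lam : hybrid S 𝓕 lam lam = respond S.instances.game 𝓕 lam true := by
  funext σ q
  rcases σ with _ | σ <;> cases q <;> try rfl
  simp only [hybrid, respond]
  have : hybridEnc S lam lam σ.msk σ.x₀ σ.x₁ = S.instances.enc σ.msk σ.x₁ := by
    rw [hybridEnc, Algs.instances_enc, ← mapIdx_const]
    simp
  rw [this]
  rfl

variable (lam)

theorem hybrid_bounded (h : ℕ) : (hybrid S 𝓕 lam h).Bounded := by
  have hr : ∀ σ : Session,
      ((refuse σ).map fun a => ENNReal.ofReal a.2.2.normSq).sum ≤ 1 := fun σ => by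
    simp [refuse, QMem.normSq_empty]
  have hm : ∀ {E : Ens} (g : Data × QMem → Option Session × Data), E.mass ≤ 1 →
      (((E.map fun r => ((g r).1, (g r).2, r.2)) : List (Option Session × Data × QMem)).map
        fun a => ENNReal.ofReal a.2.2.normSq).sum ≤ 1 := by
    intro E g h
    simpa [Function.comp_def, Ens.mass, Ens.total] using h
  have h0 : (([] : List (Option Session × Data × QMem)).map
      fun a => ENNReal.ofReal a.2.2.normSq).sum ≤ 1 := by simp
  have henc : ∀ msk x, (S.instances.enc msk x).mass ≤ 1 := by
    intro msk x
    rw [Algs.instances_enc]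
    refine Ens.mass_lists_le fun e he => ?_
    obtain ⟨a, -, rfl⟩ := List.mem_map.1 he
    exact Prog.mass_out_empty_le _ _
  intro σ q
  rcases σ with _ | σ <;> cases q <;> try exact h0
  · simp only [hybrid, respond]
    split_ifs
    · refine hm (fun s => (some _, _)) ?_
      show (S.instances.setup lam _).mass ≤ 1
      rw [Algs.instances_setup]
      refine Ens.mass_lists_le fun e he => ?_
      obtain ⟨a, -, rfl⟩ := List.mem_map.1 he
      exact Prog.mass_out_empty_le _ _
    · exact h0
  · exact hr σ
  · simp only [hybrid, respond]
    split_ifs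
    · exact hm (fun s => (some _, _)) (henc _ _)
    · exact hr σ
  · simp only [hybrid, respond]
    split_ifs
    · refine hm (fun s => (some _, _)) ?_
      show (S.instances.kg _ _ _).mass ≤ 1
      rw [Algs.instances_kg, Ens.mass_mapVal]
      exact Prog.mass_out_empty_le _ _
    · exact hr σ
  · simp only [hybrid, respond]
    split_ifs
    · split
      · exact hr σ
      · rename_i f z _ _ e _
        refine le_trans (le_of_eq ?_) (S.vrfy.mass_out_empty_le (.cons e.vk z))
        rw [List.map_map]
        refine congrArg List.sum (List.map_congr_left fun r _ => ?_)
        rw [Function.comp_apply]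
        split_ifs <;> rfl
    · exact hr σ
  · simp only [hybrid]
    split_ifs
    · exact hr σ
    · refine hm (fun s => (some _, _)) (Ens.mass_lists_le fun e he => ?_)
      obtain ⟨j, hj, rfl⟩ := List.mem_mapIdx.1 he
      exact Prog.mass_out_empty_le _ _
    · exact h0

end KeyLeasing

namespace KeyLeasing

open Data (unary binary ofList)

theorem Prog.Det.unique {p : Prog} {v a a' : Data} {C C' : ℕ} (h : p.Det v a C)
    (h' : p.Det v a' C') : a = a' := by
  have := (Framed.computes_empty h).out_eq.symm.trans (Framed.computes_empty h').out_eq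
  simpa [Ens.pure] using this

theorem Data.ofList_injective : Function.Injective ofList := fun l l' h => by
  rw [← Data.toList_ofList l, h, Data.toList_ofList]

theorem Data.bit_injective : Function.Injective Data.bit := by
  intro a b h
  cases a <;> cases b <;> simp_all [Data.bit]

theorem SimKey.code_injective : Function.Injective SimKey.code := by
  rintro ⟨f, n, idx, vk, bad⟩ ⟨f', n', idx', vk', bad'⟩ h
  simp only [SimKey.code, Data.cons.injEq] at h
  obtain ⟨rfl, rfl, h₁, rfl, h₂⟩ := h
  rw [Data.unary_injective h₁, Data.bit_injective h₂]

/-- The redundant parts of the code are not needed. With injectivity, the state provided by the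
invariant `InvInfo` is the one that is known explicitly. -/
theorem Sim.code_injective : Function.Injective Sim.code := by
  rintro ⟨keys, encs, chal, lam, x₀, x₁, q, pre, suf⟩ ⟨keys', encs', chal', lam', x₀', x₁', q',
    pre', suf'⟩ h
  simp only [Sim.code, Data.cons.injEq] at h
  obtain ⟨h₁, h₂, h₃, h₄, rfl, rfl, h₅, -, -, h₆, h₇⟩ := h
  rw [SimKey.code_injective.list_map (Data.ofList_injective h₁), Data.unary_injective h₂,
    Data.bit_injective h₃, Data.unary_injective h₄, Data.unary_injective h₅,
    Data.ofList_injective h₆, Data.ofList_injective h₇]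

/-! ## The simulated session -/

section

variable (𝓕 : FunClass) (lam i N : ℕ) (x₀ x₁ : Data)

/-- The keys known to the reduction, the keys of the simulated challenger, and those of the
challenger of the instance `i`. -/
inductive KeysRel : List SimKey → List Entry → List Entry → Prop
  | nil : KeysRel [] [] []
  | own {e : SimKey} {a c : Entry} {es : List SimKey} {as cs : List Entry} (idx : e.idx = i)
      (fun_left : a.f = e.f) (fun_right : c.f = e.f) (bound_left : a.n = e.n.len)
      (bound_right : c.n = 2 ^ (i + 1)) (vk : c.vk = a.vk)
      (returned : a.returned = true → c.returned = true)
      (bad : e.bad = true ↔ 𝓕.ev lam e.f x₀ ≠ 𝓕.ev lam e.f x₁ ∧ ¬ a.returned = true)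
      (le : e.n.len ≤ 2 ^ (i + 1)) (le_N : 2 ^ (i + 1) ≤ 2 * N) (tail : KeysRel es as cs) :
      KeysRel (e :: es) (a :: as) (c :: cs)
  | other {e : SimKey} {a : Entry} {es : List SimKey} {as cs : List Entry} (idx : e.idx ≠ i)
      (fun_left : a.f = e.f) (bound_left : a.n = e.n.len) (vk : a.vk = e.vk)
      (bad : e.bad = true ↔ 𝓕.ev lam e.f x₀ ≠ 𝓕.ev lam e.f x₁ ∧ ¬ a.returned = true)
      (tail : KeysRel es as cs) : KeysRel (e :: es) (a :: as) cs

end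

namespace KeysRel

variable {𝓕 : FunClass} {lam i N : ℕ} {x₀ x₁ : Data} {es es' : List SimKey}
  {as as' cs cs' : List Entry}

theorem length_eq (h : KeysRel 𝓕 lam i N x₀ x₁ es as cs) :
    as.length = es.length ∧ cs.length ≤ es.length := by
  induction h with
  | nil => simp
  | own => simp only [List.length_cons]; omega
  | other => simp only [List.length_cons]; omega

theorem append (h : KeysRel 𝓕 lam i N x₀ x₁ es as cs) (h' : KeysRel 𝓕 lam i N x₀ x₁ es' as' cs') :
    KeysRel 𝓕 lam i N x₀ x₁ (es ++ es') (as ++ as') (cs ++ cs') := by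
  induction h with
  | nil => exact h'
  | own h₁ h₂ h₃ h₄ h₅ h₆ h₇ h₈ h₉ h₁₀ _ ih => exact .own h₁ h₂ h₃ h₄ h₅ h₆ h₇ h₈ h₉ h₁₀ ih
  | other h₁ h₂ h₃ h₄ h₅ _ ih => exact .other h₁ h₂ h₃ h₄ h₅ ih

/-- The flags record exactly the entries that make the simulated challenger end the experiment, so
the reduction guesses `0` precisely in this case. -/
theorem exists_bad (h : KeysRel 𝓕 lam i N x₀ x₁ es as cs) : (∃ e ∈ es, e.bad = true) ↔
    ¬ ∀ a ∈ as, 𝓕.ev lam a.f x₀ ≠ 𝓕.ev lam a.f x₁ → a.returned = true := by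
  induction h with
  | nil => simp
  | own _ h₂ _ _ _ _ _ h₈ _ _ _ ih =>
    simp only [List.mem_cons, exists_eq_or_imp, forall_eq_or_imp, ih, h₈, h₂]
    tauto
  | other _ h₂ _ _ h₅ _ ih =>
    simp only [List.mem_cons, exists_eq_or_imp, forall_eq_or_imp, ih, h₅, h₂]
    tauto

/-- Marks are related in one direction only: the static challenger accepts certificates for longer
and may have marked more keys. This direction suffices to conclude that it grants every challenge
that the simulation grants. -/
theorem returned (h : KeysRel 𝓕 lam i N x₀ x₁ es as cs)
    (hb : ∀ a ∈ as, 𝓕.ev lam a.f x₀ ≠ 𝓕.ev lam a.f x₁ → a.returned = true) :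
    ∀ a ∈ cs, 𝓕.ev lam a.f x₀ ≠ 𝓕.ev lam a.f x₁ → a.returned = true := by
  induction h with
  | nil => exact hb
  | own _ h₂ h₃ _ _ _ h₇ _ _ _ _ ih =>
    simp only [List.mem_cons, forall_eq_or_imp] at hb ⊢
    exact ⟨fun h => h₇ (hb.1 (by rwa [h₂, ← h₃])), ih hb.2⟩
  | other _ _ _ _ _ _ ih =>
    exact ih fun a ha => hb a (List.mem_cons_of_mem _ ha)

variable {f : Data} {e : SimKey}

theorem find_none (h : KeysRel 𝓕 lam i N x₀ x₁ es as cs)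
    (he : es.find? (fun e => e.f = f) = none) : as.find? (fun a => a.f = f) = none := by
  induction h with
  | nil => rfl
  | own _ h₂ _ _ _ _ _ _ _ _ _ ih =>
    rw [List.find?_cons] at he ⊢
    rw [h₂]
    split at he
    · cases he
    · exact ih he
  | other _ h₂ _ _ _ _ ih =>
    rw [List.find?_cons] at he ⊢
    rw [h₂]
    split at he
    · cases he
    · exact ih he

/-- The list of the static challenger consists of the entries of its instance in the same order, so
a first entry for `f` that belongs to this instance is first in that list too. The two final
relations cover an acceptance that the simulation suppresses, which marks on the right only, and one
that it passes on. -/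
theorem find_own (h : KeysRel 𝓕 lam i N x₀ x₁ es as cs)
    (he : es.find? (fun e => e.f = f) = some e) (hi : e.idx = i) :
    ∃ a c : Entry, as.find? (fun a => a.f = f) = some a ∧ cs.find? (fun a => a.f = f) = some c ∧
      a.n = e.n.len ∧ c.n = 2 ^ (i + 1) ∧ c.vk = a.vk ∧ e.n.len ≤ 2 ^ (i + 1) ∧
      2 ^ (i + 1) ≤ 2 * N ∧
      KeysRel 𝓕 lam i N x₀ x₁ es as (markFirst f cs) ∧
      KeysRel 𝓕 lam i N x₀ x₁ (Reduction.clearFirst f es) (markFirst f as) (markFirst f cs) := by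
  induction h with
  | nil => cases he
  | @own e' a c es as cs h₁ h₂ h₃ h₄ h₅ h₆ h₇ h₈ h₉ h₁₀ ht ih =>
    by_cases hf : e'.f = f
    · simp only [List.find?_cons, hf, decide_true, Option.some.injEq] at he
      subst he
      refine ⟨a, c, by simp [h₂, hf], by simp [h₃, hf], h₄, h₅, h₆, h₉, h₁₀, ?_, ?_⟩
      · rw [markFirst, if_pos (by rw [h₃, hf])]
        exact .own h₁ h₂ h₃ h₄ h₅ h₆ (fun _ => rfl) h₈ h₉ h₁₀ ht
      · rw [markFirst, if_pos (by rw [h₂, hf]), markFirst, if_pos (by rw [h₃, hf]),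
          Reduction.clearFirst, if_pos hf]
        exact .own h₁ h₂ h₃ h₄ h₅ h₆ (fun _ => rfl) (by simp) h₉ h₁₀ ht
    · simp only [List.find?_cons, hf, decide_false] at he
      obtain ⟨a', c', g₁, g₂, g₃, g₄, g₅, g₆, g₇, g₈, g₉⟩ := ih he
      refine ⟨a', c', by simp [h₂, hf, g₁], by simp [h₃, hf, g₂], g₃, g₄, g₅, g₆, g₇, ?_, ?_⟩
      · rw [markFirst, if_neg (by rwa [h₃])]
        exact .own h₁ h₂ h₃ h₄ h₅ h₆ h₇ h₈ h₉ h₁₀ g₈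
      · rw [markFirst, if_neg (by rwa [h₂]), markFirst, if_neg (by rwa [h₃]),
          Reduction.clearFirst, if_neg hf]
        exact .own h₁ h₂ h₃ h₄ h₅ h₆ h₇ h₈ h₉ h₁₀ g₉
  | @other e' a es as cs h₁ h₂ h₃ h₄ h₅ ht ih =>
    by_cases hf : e'.f = f
    · simp only [List.find?_cons, hf, decide_true, Option.some.injEq] at he
      subst he
      exact absurd hi h₁
    · simp only [List.find?_cons, hf, decide_false] at he
      obtain ⟨a', c', g₁, g₂, g₃, g₄, g₅, g₆, g₇, g₈, g₉⟩ := ih he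
      refine ⟨a', c', by simp [h₂, hf, g₁], g₂, g₃, g₄, g₅, g₆, g₇, ?_, ?_⟩
      · exact .other h₁ h₂ h₃ h₄ h₅ g₈
      · rw [markFirst, if_neg (by rwa [h₂]), Reduction.clearFirst, if_neg hf]
        exact .other h₁ h₂ h₃ h₄ h₅ g₉

/-- The first entry for `f` belongs to a simulated instance. A later entry for `f` in the list of
the static challenger is not affected, since the challenger is not asked. -/
theorem find_other (h : KeysRel 𝓕 lam i N x₀ x₁ es as cs)
    (he : es.find? (fun e => e.f = f) = some e) (hi : e.idx ≠ i) :
    ∃ a : Entry, as.find? (fun a => a.f = f) = some a ∧ a.n = e.n.len ∧ a.vk = e.vk ∧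
      KeysRel 𝓕 lam i N x₀ x₁ (Reduction.clearFirst f es) (markFirst f as) cs := by
  induction h with
  | nil => cases he
  | @own e' a c es as cs h₁ h₂ h₃ h₄ h₅ h₆ h₇ h₈ h₉ h₁₀ ht ih =>
    by_cases hf : e'.f = f
    · simp only [List.find?_cons, hf, decide_true, Option.some.injEq] at he
      subst he
      exact absurd h₁ hi
    · simp only [List.find?_cons, hf, decide_false] at he
      obtain ⟨a', g₁, g₂, g₃, g₄⟩ := ih he
      refine ⟨a', by simp [h₂, hf, g₁], g₂, g₃, ?_⟩
      rw [markFirst, if_neg (by rwa [h₂]), Reduction.clearFirst, if_neg hf]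
      exact .own h₁ h₂ h₃ h₄ h₅ h₆ h₇ h₈ h₉ h₁₀ g₄
  | @other e' a es as cs h₁ h₂ h₃ h₄ h₅ ht ih =>
    by_cases hf : e'.f = f
    · simp only [List.find?_cons, hf, decide_true, Option.some.injEq] at he
      subst he
      refine ⟨a, by simp [h₂, hf], h₃, h₄, ?_⟩
      rw [markFirst, if_pos (by rw [h₂, hf]), Reduction.clearFirst, if_pos hf]
      exact .other h₁ h₂ h₃ h₄ (by simp) ht
    · simp only [List.find?_cons, hf, decide_false] at he
      obtain ⟨a', g₁, g₂, g₃, g₄⟩ := ih he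
      refine ⟨a', by simp [h₂, hf, g₁], g₂, g₃, ?_⟩
      rw [markFirst, if_neg (by rwa [h₂]), Reduction.clearFirst, if_neg hf]
      exact .other h₁ h₂ h₃ h₄ h₅ g₄

end KeysRel

/-- The reduction in state `b` and the challenger of the instance `i` in state `τ` simulate the
challenger for dynamic availability bounds in state `σ`. -/
structure Simulates (𝓕 : FunClass) (lam i N : ℕ) (b : Sim) (σ τ : Session) : Prop where
  lam_eq : b.lam = lam
  length_pre : b.pre.length = i
  length_eq : b.pre.length + (b.suf.length + 1) = lam
  msk : σ.msk = ofList (b.pre ++ τ.msk :: b.suf)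
  n : τ.n = 2 ^ (i + 1)
  q_left : σ.q = b.q
  q_right : τ.q = b.q
  q_pos : 0 < b.q
  q_le : b.q ≤ N
  fst_left : σ.x₀ = b.x₀
  fst_right : τ.x₀ = b.x₀
  snd_left : σ.x₁ = b.x₁
  snd_right : τ.x₁ = b.x₁
  encs_left : σ.encs = b.encs
  encs_right : τ.encs = b.encs
  challenged_left : σ.challenged = b.challenged
  challenged_right : τ.challenged = b.challenged
  keys : KeysRel 𝓕 lam i N b.x₀ b.x₁ b.keys σ.keys τ.keys

end KeyLeasing

/-! ### Simulation of encryption queries and of the challenge -/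

namespace KeyLeasing

open Data (unary binary ofList)

namespace Reduction

open Prog

variable {S : Algs} {𝓕 : FunClass} {pX pF pE A : Prog} {lam TA D N i T : ℕ} {coin : Bool}
  {KA KB : Option Session → Data → QMem → ENNReal}

/-- Continuations of the experiments agree after the outcomes in `E` of an activation of the
reduction, during which the adversary has returned `o`. -/
def Matches (𝓕 : FunClass) (lam i N : ℕ) (KA KB : Option Session → Data → QMem → ENNReal) (E : Ens)
    (o : Data × QMem) : Prop :=
  ∀ s ∈ E, ¬ (Query.decode s.1.snd).IsGuess → ∀ (reply : Data) (φ : QMem), φ.normSq ≠ 0 →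
    ∀ (b : Sim) (replyA : Data) (C : ℕ) (σ τ : Session),
      preP.Det (.cons s.1.fst reply) (.cons (.cons .one b.code) (.cons o.1.fst replyA)) C →
      Simulates 𝓕 lam i N b σ τ →
      KB (some τ) (.cons s.1.fst reply) ((o.2.tensor s.2).tensor φ) =
        KA (some σ) (.cons o.1.fst replyA) (o.2.tensor (s.2.tensor φ))

theorem normSq_empty_ne : QMem.empty.normSq ≠ 0 := by simp [QMem.normSq_empty]

theorem normSq_out_ne {p : Prog} {v : Data} {r : Data × QMem} (h : r ∈ p.out v QMem.empty) :
    r.2.normSq ≠ 0 := out_ne_zero normSq_empty_ne h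

/-- The message accompanying a ready answer is a second opening, which the challenger refuses
without changing its state. The round is thus used up on both sides, and the numbers of rounds in
the two experiments stay equal. -/
theorem Matches.answer {E : Ens} {o : Data × QMem} (hM : Matches 𝓕 lam i N KA KB E o) {b : Sim}
    {σ τ : Session} {rep : Data} {k : QMem} (hs : (answer o.1.fst b.code rep, k) ∈ E)
    (hR : Simulates 𝓕 lam i N b σ τ) (G : Game) :
    Challenger.after (respond G 𝓕 lam coin) KB (some τ)
      (Reduction.answer o.1.fst b.code rep, o.2.tensor k) =
    KA (some σ) (.cons o.1.fst rep) (o.2.tensor k) := by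
  rw [Challenger.after_of_not_guess id]
  have h := hM _ hs id .nil QMem.empty normSq_empty_ne b rep 100 σ τ (preP_refused _ _ _ _ _ _) hR
  simp only [QMem.tensor_empty] at h
  rw [← h]
  change List.sum [_] = _
  rw [List.sum_singleton]
  exact congrArg _ (QMem.tensor_empty _)

theorem Matches.total_pure_answer {o : Data × QMem} {b : Sim} {σ τ : Session} {rep : Data}
    (hM : Matches 𝓕 lam i N KA KB (Ens.pure (Reduction.answer o.1.fst b.code rep)) o)
    (hR : Simulates 𝓕 lam i N b σ τ) (G : Game) :
    ((Ens.pure (Reduction.answer o.1.fst b.code rep)).total fun a k =>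
      Challenger.after (respond G 𝓕 lam coin) KB (some τ) (a, o.2.tensor k)) =
    KA (some σ) (.cons o.1.fst rep) o.2 := by
  rw [Ens.total_pure, hM.answer (List.mem_singleton.2 rfl) hR, QMem.tensor_empty]

theorem append_eq (P Q a : Data) : P.append (.cons a Q) = ofList (P.toList ++ a :: Q.toList) := by
  conv_lhs => rw [← Data.ofList_toList P, ← Data.ofList_toList Q]
  exact Data.append_ofList P.toList (a :: Q.toList)

/-- Lists of ciphertexts with one from the challenger. -/
theorem Matches.total_enc {o : Data × QMem} {es fs : List Ens} {e : Ens} {b b' : Sim}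
    {msg : Data} {σ τ τ₀ : Session} {𝒞 : Challenger}
    (hM : Matches 𝓕 lam i N KA KB ((Ens.lists es).bind fun P => (Ens.lists fs).bind fun Q =>
      Ens.pure (ask o.1.fst b.code encMode b'.code (.cons P Q) msg)) o)
    (hmsg : ¬ (Query.decode msg).IsGuess)
    (h𝒞 : 𝒞 (some τ₀) (Query.decode msg) = e.map fun r => (some τ, .ok r.1, r.2))
    (hR : Simulates 𝓕 lam i N b' σ τ) (he : Ens.Scalar e) (hf : ∀ f ∈ fs, Ens.Scalar f)
    (hn : ∀ r ∈ e, r.2.normSq ≠ 0) :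
    (((Ens.lists es).bind fun P => (Ens.lists fs).bind fun Q =>
      Ens.pure (ask o.1.fst b.code encMode b'.code (.cons P Q) msg)).total fun a k =>
        𝒞.after KB (some τ₀) (a, o.2.tensor k)) =
    (Ens.lists (es ++ e :: fs)).total fun a k =>
      KA (some σ) (.cons o.1.fst (.ok a)) (o.2.tensor k) := by
  rw [Ens.total_lists_split he (Ens.scalar_lists hf)]
  simp only [Ens.total_bind, Ens.total_pure]
  refine Ens.total_congr fun P hP => ?_
  refine Ens.total_congr fun Q hQ => ?_
  rw [Challenger.after_of_not_guess (o := (ask o.1.fst b.code encMode b'.code (.cons P.1 Q.1) msg,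
    o.2.tensor (P.2.tensor (Q.2.tensor QMem.empty)))) hmsg]
  change ((𝒞 (some τ₀) (Query.decode msg)).map _).sum = _
  rw [h𝒞, List.map_map]
  refine congrArg List.sum (List.map_congr_left fun r hr => ?_)
  have h := hM _ (Ens.mem_bind.2 ⟨P, hP, _, Ens.mem_bind.2 ⟨Q, hQ, _, List.mem_singleton.2 rfl, rfl⟩,
    rfl⟩) hmsg (.ok r.1) r.2 (hn r hr) b' _ _ σ τ
    (preP_enc _ _ _ _ _ _ (Data.ok r.1) (by simp [Data.ok])) hR
  rw [append_eq, QMem.tensor_empty] at h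
  rw [Function.comp_apply, QMem.tensor_empty]
  exact h

theorem scalar_enc (hS : S.Classical) (l : List Data) (x : Data) :
    ∀ e ∈ l.map fun a => S.enc.out (.cons a x) QMem.empty, Ens.Scalar e := by
  intro e he
  obtain ⟨a, -, rfl⟩ := List.mem_map.1 he
  exact hS.2.1.scalar_out _

theorem total_react_enc (hS : S.Classical) {b : Sim} {σ τ : Session} {o : Data × QMem} {d : Data}
    (hR : Simulates 𝓕 lam i N b σ τ)
    (hM : Matches 𝓕 lam i N KA KB (reactEnc S 𝓕 b o.1.fst d) o) :
    ((reactEnc S 𝓕 b o.1.fst d).total fun a k =>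
      Challenger.after (respond (S.game 𝓕 lam T) 𝓕 lam coin) KB (some τ) (a, o.2.tensor k)) =
    ((hybrid S 𝓕 lam (i + coin.toNat) (some σ) (.enc d)).map fun a =>
      KA a.1 (.cons o.1.fst a.2.1) (o.2.tensor a.2.2)).sum := by
  unfold reactEnc at hM ⊢
  change _ = ((respond S.instances.game 𝓕 lam false (some σ) (.enc d)).map _).sum
  simp only [respond]
  obtain rfl := hR.lam_eq
  split_ifs at hM ⊢ with hx
  · have h := hM.total_enc (τ₀ := τ) (𝒞 := respond (S.game 𝓕 b.lam T) 𝓕 b.lam coin)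
      (e := S.enc.out (.cons τ.msk d) QMem.empty) (τ := { τ with encs := τ.encs + 1 })
      (σ := { σ with encs := σ.encs + 1 }) id (if_pos hx)
      { hR with encs_left := congrArg (· + 1) hR.encs_left
                encs_right := congrArg (· + 1) hR.encs_right }
      (hS.2.1.scalar_out _) (scalar_enc hS _ _) fun r hr => normSq_out_ne hr
    refine h.trans ?_
    rw [List.map_map]
    change _ = (S.instances.enc σ.msk d).total fun a k =>
      KA (some { σ with encs := σ.encs + 1 }) (.cons o.1.fst (.ok a)) (o.2.tensor k)
    rw [Algs.instances_enc, hR.msk, Data.toList_ofList, List.map_append, List.map_cons]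
  · rw [hM.total_pure_answer hR]
    simp [refuse, QMem.tensor_empty]

/-- This is the hybrid step: the reduction encrypts `x₁` in the `i` components below the
challenger's and `x₀` above. The component of the challenger decides between the hybrids `i` and `i
+ 1`. -/
theorem hybridEnc_eq {b : Sim} {σ τ : Session} (hR : Simulates 𝓕 lam i N b σ τ) (x₀ x₁ : Data) :
    hybridEnc S lam (i + coin.toNat) σ.msk x₀ x₁ =
      Ens.lists ((b.pre.map fun a => S.enc.out (.cons a x₁) QMem.empty) ++
        S.enc.out (.cons τ.msk (if coin then x₁ else x₀)) QMem.empty ::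
          b.suf.map fun a => S.enc.out (.cons a x₀) QMem.empty) := by
  have hl := hR.length_eq
  have hi := hR.length_pre
  rw [hybridEnc, hR.msk, Data.toList_ofList, List.mapIdx_append, List.mapIdx_cons,
    ← mapIdx_const _ b.pre, ← mapIdx_const _ b.suf]
  congr 2
  · refine List.mapIdx_eq_mapIdx_iff.2 fun j hj => ?_
    rw [if_pos (Or.inl (by omega))]
  · congr 1
    · cases coin with
      | false => rw [if_neg (by simp; omega)]; rfl
      | true => rw [if_pos (by simp; omega)]; rfl
    · refine List.mapIdx_eq_mapIdx_iff.2 fun j hj => ?_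
      rw [if_neg]
      cases coin <;> simp <;> omega

theorem total_react_chal (hS : S.Classical) {b : Sim} {σ τ : Session} {o : Data × QMem}
    (hR : Simulates 𝓕 lam i N b σ τ)
    (hM : Matches 𝓕 lam i N KA KB (reactChal S b o.1.fst) o) :
    ((reactChal S b o.1.fst).total fun a k =>
      Challenger.after (respond (S.game 𝓕 lam T) 𝓕 lam coin) KB (some τ) (a, o.2.tensor k)) =
    ((hybrid S 𝓕 lam (i + coin.toNat) (some σ) .chal).map fun a =>
      KA a.1 (.cons o.1.fst a.2.1) (o.2.tensor a.2.2)).sum := by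
  have hbad := hR.keys.exists_bad
  have hret := hR.keys.returned
  unfold reactChal at hM ⊢
  simp only [hybrid, hR.challenged_left, hR.fst_left, hR.snd_left]
  by_cases hc : b.challenged = true
  · rw [if_pos hc] at hM ⊢
    rw [if_pos hc, hM.total_pure_answer hR]
    simp [refuse, QMem.tensor_empty]
  rw [if_neg hc] at hM ⊢
  rw [if_neg hc]
  by_cases hb : ∃ e ∈ b.keys, e.bad = true
  -- The guess `0` of the reduction and the end of the simulated experiment both contribute nothing
  -- to the probability of output `1`.
  · rw [if_pos hb, if_neg (hbad.1 hb), Ens.total_pure]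
    rw [Challenger.after_guess (b := false) rfl]
    rfl
  · have hb' := not_not.1 fun h => hb (hbad.2 h)
    rw [if_neg hb] at hM ⊢
    rw [if_pos hb', List.map_map, hybridEnc_eq hR]
    refine Eq.trans (hM.total_enc (τ₀ := τ) (𝒞 := respond (S.game 𝓕 lam T) 𝓕 lam coin)
      (e := S.enc.out (.cons τ.msk (if coin then b.x₁ else b.x₀)) QMem.empty)
      (τ := { τ with challenged := true }) (σ := { σ with challenged := true }) id
      (by
        change (if τ.challenged = true then _ else _) = _
        -- By `hret` every critical key of the static challenger is marked as returned, so it does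
        -- hand out its ciphertext.
        rw [hR.challenged_right, if_neg hc, hR.fst_right, hR.snd_right, if_pos (hret hb'),
          ← hR.fst_right, ← hR.snd_right]
        rfl)
      { hR with challenged_left := rfl, challenged_right := rfl }
      (hS.2.1.scalar_out _) (scalar_enc hS _ _) fun r hr => normSq_out_ne hr) ?_
    rw [← hR.fst_left, ← hR.snd_left]
    rfl

end Reduction

end KeyLeasing

/-! ### Simulation of key generation and verification queries -/

namespace KeyLeasing

open Data (unary binary ofList)

namespace Reduction

open Prog

variable {S : Algs} {𝓕 : FunClass} {pX pF pE A : Prog} {lam TA D N i T : ℕ} {coin : Bool}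
  {KA KB : Option Session → Data → QMem → ENNReal}

/-- The oracles may be closed if the declared bound is large. They are needed only after a request
for a key of this instance, and such a request forces `2 ^ (i + 1) ≤ 2 * N`; then `D` bounds the
time of key generation and verification. -/
theorem Setting.leasing (h : Setting S 𝓕 pX pF pE A lam TA D N) (hDT : D ≤ T) {b : Sim}
    {σ τ : Session} (hR : Simulates 𝓕 lam i N b σ τ) (hi : 2 ^ (i + 1) ≤ 2 * N) :
    (S.game 𝓕 lam T).leasing τ.q τ.n := by
  intro s hs f hf
  rw [hR.q_right, hR.n] at hs
  rw [hR.n]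
  have hl := hR.length_eq
  have hp := hR.length_pre
  have hk := h.keyTime _ hR.q_pos hR.q_le (i + 1) (by omega) hi s hs f hf
  exact ⟨hk.1.mono hDT, fun k hk' z => (hk.2 k hk' z).mono hDT⟩

theorem Setting.total_react_kg (h : Setting S 𝓕 pX pF pE A lam TA D N) (hDT : D ≤ T)
    (hN : N ≤ 2 ^ lam) {b : Sim} {σ τ : Session} {o : Data × QMem} {f n : Data} (hn : n.len ≤ N)
    (hR : Simulates 𝓕 lam i N b σ τ)
    (hM : Matches 𝓕 lam i N KA KB (reactKg S 𝓕 b o.1.fst f n) o) :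
    ((reactKg S 𝓕 b o.1.fst f n).total fun a k =>
      Challenger.after (respond (S.game 𝓕 lam T) 𝓕 lam coin) KB (some τ) (a, o.2.tensor k)) =
    ((hybrid S 𝓕 lam (i + coin.toNat) (some σ) (.kg f n.len)).map fun a =>
      KA a.1 (.cons o.1.fst a.2.1) (o.2.tensor a.2.2)).sum := by
  have hlen := hR.keys.length_eq
  have hl := hR.length_eq
  have hp := hR.length_pre
  have hmsk : σ.msk.toList = b.pre ++ τ.msk :: b.suf := by rw [hR.msk, Data.toList_ofList]
  have hmlen : σ.msk.toList.length = lam := by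
    rw [hmsk, List.length_append, List.length_cons, hl]
  have hlev := level_pos h.lam_pos n.len
  have hlam := hR.lam_eq
  unfold reactKg at hM ⊢
  change _ = ((respond S.instances.game 𝓕 lam false (some σ) (.kg f n.len)).map _).sum
  simp only [respond]
  have hiff : ((S.instances.game.leasing σ.q σ.n ∧ f ∈ 𝓕.F lam ∧
      0 < S.instances.game.bound σ.n n.len ∧ σ.keys.length < σ.q ∧
        (σ.challenged = true → 𝓕.ev lam f σ.x₀ = 𝓕.ev lam f σ.x₁)) ↔
      (f ∈ 𝓕.F b.lam ∧ 0 < n.len ∧ b.keys.length < b.q ∧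
        (b.challenged = true → 𝓕.ev b.lam f b.x₀ = 𝓕.ev b.lam f b.x₁))) := by
    rw [hlam, hlen.1, hR.q_left, hR.challenged_left, hR.fst_left, hR.snd_left]
    exact ⟨fun h => h.2, fun h => ⟨trivial, h⟩⟩
  by_cases hc : f ∈ 𝓕.F b.lam ∧ 0 < n.len ∧ b.keys.length < b.q ∧
      (b.challenged = true → 𝓕.ev b.lam f b.x₀ = 𝓕.ev b.lam f b.x₁)
  swap
  · rw [if_neg hc] at hM ⊢
    rw [if_neg fun h' => hc (hiff.1 h'), hM.total_pure_answer hR]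
    simp [refuse, QMem.tensor_empty]
  rw [if_pos hc] at hM ⊢
  rw [if_pos (hiff.2 hc), List.map_map]
  change _ = (S.instances.kg σ.msk f n.len).total fun a k =>
    KA (some { σ with keys := σ.keys ++ [⟨f, n.len, a.snd, false⟩] })
      (.cons o.1.fst (.ok a.fst)) (o.2.tensor k)
  rw [Algs.instances_kg, hmlen, Ens.total_mapVal]
  rw [hlam] at hc
  simp only [hlam] at hM ⊢
  have hbad : decide (𝓕.ev lam f b.x₀ ≠ 𝓕.ev lam f b.x₁) = true ↔
      𝓕.ev lam f b.x₀ ≠ 𝓕.ev lam f b.x₁ ∧ ¬ (false = true) := by simp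
  have htwo : 2 ^ level lam n.len ≤ 2 * N :=
    (two_pow_level_le hc.2.1).trans (Nat.mul_le_mul_left 2 hn)
  -- The assumption `N ≤ 2 ^ lam` enters the simulation here, giving that the requested bound does
  -- not exceed the static one.
  have hle := le_two_pow_level (hn.trans hN)
  -- Both cases at once: `cs` is what is appended to the list of the static challenger, namely the
  -- new entry if its instance is in charge and nothing otherwise.
  have hrel : ∀ (a vk : Data) (cs : List Entry), (level lam n.len - 1 = i →
      cs = [⟨f, 2 ^ (i + 1), vk, false⟩]) → (level lam n.len - 1 ≠ i → cs = [] ∧ a = vk) →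
      Simulates 𝓕 lam i N (b.addKey ⟨f, n, level lam n.len - 1, a,
          decide (𝓕.ev lam f b.x₀ ≠ 𝓕.ev lam f b.x₁)⟩)
        { σ with keys := σ.keys ++ [⟨f, n.len, vk, false⟩] } { τ with keys := τ.keys ++ cs } := by
    intro a vk cs h₁ h₂
    refine { hR with keys := hR.keys.append ?_ }
    by_cases hi : level lam n.len - 1 = i
    · rw [h₁ hi]
      have hi' : i + 1 = level lam n.len := by omega
      exact .own hi rfl rfl rfl rfl rfl id hbad (by rw [hi']; exact hle) (by rw [hi']; exact htwo)
        .nil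
    · obtain ⟨rfl, rfl⟩ := h₂ hi
      exact .other hi rfl rfl rfl hbad .nil
  split_ifs at hM ⊢ with hi
  · rw [hp] at hi
    have hi' : level lam n.len = i + 1 := by omega
    rw [Ens.total_pure, Challenger.after_of_not_guess (o := (ask _ _ _ _ _ _, _)) id]
    change ((respond (S.game 𝓕 lam T) 𝓕 lam coin (some τ) (.kg f 0)).map _).sum = _
    simp only [respond]
    rw [if_pos, List.map_map, hmsk, hi, List.getD_append_right _ _ _ _ hp.le, hp, Nat.sub_self,
      List.getD_cons_zero]
    · refine congrArg List.sum (List.map_congr_left fun r hr => ?_)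
      have hh := hM _ (List.mem_singleton.2 rfl) id (.ok r.1.fst) r.2 (normSq_out_ne hr) _ _ _ _ _
        (preP_key _ _ _ _ _ (Data.ok r.1.fst) (by simp [Data.ok]))
        (hrel .nil r.1.snd _ (fun _ => rfl) fun h' => absurd hi h')
      simp only [QMem.tensor_empty, QMem.empty_tensor] at hh
      rw [Function.comp_apply, QMem.tensor_empty]
      have hτ : (S.game 𝓕 lam T).bound τ.n 0 = 2 ^ (i + 1) := hR.n
      rw [hi] at hh
      rw [hi', hτ]
      exact hh
    · have hlease := h.leasing hDT hR (by rw [← hi']; exact htwo)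
      refine ⟨hlease, hc.1, ?_, ?_, ?_⟩
      · change 0 < τ.n
        rw [hR.n]
        positivity
      · rw [hR.q_right]
        exact hlen.2.trans_lt hc.2.2.1
      · rw [hR.challenged_right, hR.fst_right, hR.snd_right]
        exact hc.2.2.2
  · rw [hp] at hi
    -- The list of the reduction has `nil` in place of the master key of the challenger and agrees
    -- with the simulated one at every other index.
    have hget : b.all.getD (level lam n.len - 1) .nil =
        σ.msk.toList.getD (level lam n.len - 1) .nil := by
      rw [hmsk, Sim.all]
      rcases lt_or_gt_of_ne hi with hlt | hgt
      · rw [List.getD_append _ _ _ _ (by omega), List.getD_append _ _ _ _ (by omega)]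
      · rw [List.getD_append_right _ _ _ _ (by omega), List.getD_append_right _ _ _ _ (by omega)]
        obtain ⟨j, hj⟩ : ∃ j, level lam n.len - 1 - b.pre.length = j + 1 :=
          ⟨level lam n.len - 1 - b.pre.length - 1, by omega⟩
        rw [hj, List.getD_cons_succ, List.getD_cons_succ]
    rw [Ens.total_bind, ← hget]
    refine Ens.total_congr fun r hr => ?_
    have hrel' := hrel r.1.snd r.1.snd [] (fun h' => absurd h' hi) fun _ => ⟨rfl, rfl⟩
    rw [List.append_nil] at hrel'
    rw [Ens.total_pure, hM.answer (Ens.mem_bind.2 ⟨r, hr, _, List.mem_singleton.2 rfl, rfl⟩) hrel',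
      QMem.tensor_empty, Nat.sub_add_cancel hlev]
    rfl

theorem Setting.total_react_vrfy (h : Setting S 𝓕 pX pF pE A lam TA D N) (hDT : D ≤ T)
    {b : Sim} {σ τ : Session} {o : Data × QMem} {d : Data}
    (hR : Simulates 𝓕 lam i N b σ τ)
    (hM : Matches 𝓕 lam i N KA KB (reactVrfy S b o.1.fst d) o) :
    ((reactVrfy S b o.1.fst d).total fun a k =>
      Challenger.after (respond (S.game 𝓕 lam T) 𝓕 lam coin) KB (some τ) (a, o.2.tensor k)) =
    ((hybrid S 𝓕 lam (i + coin.toNat) (some σ) (.vrfy d.fst d.snd)).map fun a =>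
      KA a.1 (.cons o.1.fst a.2.1) (o.2.tensor a.2.2)).sum := by
  have hp := hR.length_pre
  unfold reactVrfy at hM ⊢
  change _ = ((respond S.instances.game 𝓕 lam false (some σ) (.vrfy d.fst d.snd)).map _).sum
  simp only [respond]
  rw [if_pos (show S.instances.game.leasing σ.q σ.n from trivial)]
  cases he : b.keys.find? fun e => e.f = d.fst with
  | none =>
    simp only [he] at hM ⊢
    rw [hR.keys.find_none he, hM.total_pure_answer hR]
    simp [refuse, QMem.tensor_empty]
  | some e =>
    simp only [he] at hM ⊢
    by_cases hi : e.idx = i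
    · obtain ⟨a, c, h₁, h₂, h₃, h₄, h₅, h₆, h₇, h₈, h₉⟩ := hR.keys.find_own he hi
      -- The situation after a late certificate: marked by the static challenger, ignored in the
      -- simulation.
      have hR₁ : Simulates 𝓕 lam i N b σ { τ with keys := markFirst d.fst τ.keys } :=
        { hR with keys := h₈ }
      have hR₂ : Simulates 𝓕 lam i N (b.clear d.fst) { σ with keys := markFirst d.fst σ.keys }
          { τ with keys := markFirst d.fst τ.keys } := { hR with keys := h₉ }
      rw [if_pos (hi.trans hp.symm)] at hM ⊢
      rw [h₁, Ens.total_pure]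
      have hmsg : ∀ (body mode payload : Data) (m : QMem),
          Challenger.after (respond (S.game 𝓕 lam T) 𝓕 lam coin) KB (some τ)
            (ask o.1.fst b.code mode body payload (.cons (unary 4) d), m) =
          (S.vrfy.out (.cons a.vk d.snd) QMem.empty).total fun r k =>
            if r ≠ .nil ∧ b.encs < 2 ^ (i + 1) then
              KB (some { τ with keys := markFirst d.fst τ.keys })
                (.cons (st o.1.fst b.code .nil mode body payload) (.ok .nil)) (m.tensor k)
            else KB (some τ) (.cons (st o.1.fst b.code .nil mode body payload) .nil)
              (m.tensor k) := by
        intro body mode payload m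
        rw [Challenger.after_of_not_guess (o := (ask _ _ _ _ _ _, _)) id, ← hR.encs_right]
        change ((respond (S.game 𝓕 lam T) 𝓕 lam coin (some τ) (.vrfy d.fst d.snd)).map _).sum = _
        simp only [respond]
        rw [if_pos (h.leasing hDT hR h₇), h₂]
        simp only
        rw [List.map_map, h₅, h₄]
        refine congrArg List.sum (List.map_congr_left fun r _ => ?_)
        rw [Function.comp_apply]
        split_ifs with hc
        · exact (if_pos hc).symm
        · exact (if_neg hc).symm
      simp only
      rw [List.map_map]
      have hiff : σ.encs < a.n ↔ b.encs < e.n.len := by rw [h₃, hR.encs_left]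
      by_cases hn : b.encs < e.n.len
      · rw [if_pos hn] at hM ⊢
        rw [hmsg]
        refine congrArg List.sum (List.map_congr_left fun r hr => ?_)
        have hM' := hM _ (List.mem_singleton.2 rfl) id
        rw [Function.comp_apply]
        by_cases hr' : r.1 = .nil
        · rw [if_neg fun h' => h'.1 hr']
          refine (if_neg fun h' => h'.1 hr').trans ?_
          have hh := hM' .nil r.2 (normSq_out_ne hr) _ _ _ _ _ (preP_refused _ _ _ _ _ _) hR
          rw [QMem.empty_tensor] at hh
          exact hh
        · rw [if_pos ⟨hr', hiff.2 hn⟩]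
          -- Below the bound of the key the static bound is not reached either, as `n ≤ 2 ^ (i +
          -- 1)`, so both challengers accept.
          refine (if_pos ⟨hr', hn.trans_le h₆⟩).trans ?_
          have hh := hM' (.ok .nil) r.2 (normSq_out_ne hr) _ _ _ _ _
            (preP_plain _ _ _ _ _ (Data.ok .nil) (by simp [Data.ok])) hR₂
          rw [QMem.empty_tensor] at hh
          exact hh
      · rw [if_neg hn] at hM ⊢
        rw [hmsg]
        refine congrArg List.sum (List.map_congr_left fun r hr => ?_)
        have hM' := hM _ (List.mem_singleton.2 rfl) id
        rw [Function.comp_apply, if_neg fun h' => hn (hiff.1 h'.2)]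
        by_cases hc : r.1 ≠ .nil ∧ b.encs < 2 ^ (i + 1)
        · refine (if_pos hc).trans ?_
          have hh := hM' (.ok .nil) r.2 (normSq_out_ne hr) _ _ _ _ _
            (preP_plain _ _ _ _ _ (Data.ok .nil) (by simp [Data.ok])) hR₁
          rw [QMem.empty_tensor] at hh
          exact hh
        · refine (if_neg hc).trans ?_
          have hh := hM' .nil r.2 (normSq_out_ne hr) _ _ _ _ _ (preP_refused _ _ _ _ _ _) hR
          rw [QMem.empty_tensor] at hh
          exact hh
    · obtain ⟨a, h₁, h₂, h₃, h₄⟩ := hR.keys.find_other he hi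
      have hR' : Simulates 𝓕 lam i N (b.clear d.fst) { σ with keys := markFirst d.fst σ.keys } τ :=
        { hR with keys := h₄ }
      rw [if_neg fun h' => hi (h'.trans hp)] at hM ⊢
      rw [h₁, Ens.total_bind]
      simp only
      rw [List.map_map, h₃]
      have hiff : σ.encs < a.n ↔ b.encs < e.n.len := by rw [h₂, hR.encs_left]
      refine congrArg List.sum (List.map_congr_left fun r hr => ?_)
      have hmem : ((if r.1 ≠ .nil ∧ b.encs < e.n.len then
            answer o.1.fst (b.clear d.fst).code (.ok .nil) else answer o.1.fst b.code .nil),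
          r.2.tensor QMem.empty) ∈
            (S.vrfy.out (.cons e.vk d.snd) QMem.empty).bind fun r => Ens.pure
              (if r ≠ .nil ∧ b.encs < e.n.len then
                answer o.1.fst (b.clear d.fst).code (.ok .nil)
              else answer o.1.fst b.code .nil) :=
        Ens.mem_bind.2 ⟨r, hr, _, List.mem_singleton.2 rfl, rfl⟩
      rw [Function.comp_apply]
      beta_reduce
      rw [Ens.total_pure]
      by_cases hc : r.1 ≠ .nil ∧ b.encs < e.n.len
      · rw [if_pos hc] at hmem
        rw [if_pos hc, if_pos ⟨hc.1, hiff.2 hc.2⟩, hM.answer hmem hR', QMem.tensor_empty]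
      · rw [if_neg hc] at hmem
        rw [if_neg hc, if_neg fun h' => hc ⟨h'.1, hiff.1 h'.2⟩, hM.answer hmem hR, QMem.tensor_empty]

end Reduction

end KeyLeasing

/-! ### The reduction plays a hybrid experiment -/

namespace KeyLeasing

open Data (unary binary ofList)

namespace Reduction

open Prog

variable {S : Algs} {𝓕 : FunClass} {pX pF pE A : Prog} {lam TA D N i T : ℕ} {coin : Bool}

theorem Setting.post_eq (h : Setting S 𝓕 pX pF pE A lam TA D N) {t : ℕ} {b : Sim}
    (hb : Inv S 𝓕 lam D N t b) {a : Data} (hn : (Query.decode a.snd).cost ≤ N) :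
    (postP S pX pF pE).out (.cons (.cons .one b.code) a) QMem.empty =
      react S 𝓕 b a.fst a.snd :=
  (Reduction.postP_framed (a := a) (by rw [hb.lam_eq]; exact h.deciders) hb.fits
    hn).computes_empty.out_eq

theorem Good.inv_of_code {v vA : Data} {m : QMem} {t : ℕ} {b : Sim}
    (hg : Good S 𝓕 A lam TA D N v vA (.cons .one b.code) m t) : Inv S 𝓕 lam D N t b := by
  rcases hg.inv with h | ⟨b', h, hb⟩
  · cases h
  · rw [Data.cons.injEq] at h
    rwa [Sim.code_injective h.2]

/-- The invariant after the reply to a message, for known values. -/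
theorem Setting.good_of_pre (h : Setting S 𝓕 pX pF pE A lam TA D N) {v vA info : Data} {m : QMem}
    {t : ℕ} (hg : Good S 𝓕 A lam TA D N v vA info m t) {o : Data × QMem} (ho : o ∈ A.out vA m)
    {s : Data × QMem} (hs : s ∈ (postP S pX pF pE).out (.cons info o.1) QMem.empty)
    (hn : ¬ (Query.decode s.1.snd).IsGuess) {reply : Data} {φ : QMem} (hφ : φ.normSq ≠ 0)
    {info' replyA : Data} {C : ℕ}
    (hpre : preP.Det (.cons s.1.fst reply) (.cons info' (.cons o.1.fst replyA)) C) :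
    ∃ t', Good S 𝓕 A lam TA D N (.cons s.1.fst reply) (.cons o.1.fst replyA) info'
      ((o.2.tensor s.2).tensor φ) t' := by
  obtain ⟨-, t', -, -, hnext⟩ := h.good_next hg ho hs
  obtain ⟨info'', replyA', hg'⟩ := hnext hn reply φ hφ
  have := Det.unique hpre hg'.pre
  simp only [Data.cons.injEq, true_and] at this
  obtain ⟨rfl, rfl⟩ := this
  exact ⟨t', hg'⟩

/-- Each activation of the reduction runs the adversary exactly once. Sorting the outcomes by those
of the adversary gives a sum that can be compared term by term with one round of the simulated
experiment. -/
theorem Setting.play_adversary (h : Setting S 𝓕 pX pF pE A lam TA D N) {v vA info : Data}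
    {m : QMem} {t : ℕ} (hg : Good S 𝓕 A lam TA D N v vA info m t) (𝒞 : Challenger) (R : ℕ)
    (σ : Option Session) :
    𝒞.play (adversary S pX pF pE A) (R + 1) σ v m = ((A.out vA m).map fun o =>
      ((postP S pX pF pE).out (.cons info o.1) QMem.empty).total fun a k =>
        𝒞.after (𝒞.play (adversary S pX pF pE A) R) σ (a, o.2.tensor k)).sum := by
  rw [Challenger.play, (h.computes_round hg).out_eq]
  refine (Ens.total_flatMap _ _ fun a k =>
    𝒞.after (𝒞.play (adversary S pX pF pE A) R) σ (a, k)).trans ?_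
  simp only [Ens.total_after]

/-- The reduction simulates the hybrid experiment. -/
theorem Setting.play_eq_hybrid (hS : S.Classical) (h : Setting S 𝓕 pX pF pE A lam TA D N)
    (hDT : D ≤ T) (hN : N ≤ 2 ^ lam) (R : ℕ) {b : Sim} {σ τ : Session} {v vA : Data} {m : QMem}
    {t : ℕ} (hR : Simulates 𝓕 lam i N b σ τ)
    (hg : Good S 𝓕 A lam TA D N v vA (.cons .one b.code) m t) :
    Challenger.play (respond (S.game 𝓕 lam T) 𝓕 lam coin) (adversary S pX pF pE A) R (some τ) v m =
      (hybrid S 𝓕 lam (i + coin.toNat)).play A R (some σ) vA m := by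
  induction R generalizing b σ τ v vA m t with
  | zero => rfl
  | succ R ih =>
    rw [h.play_adversary hg, Challenger.play]
    refine congrArg List.sum (List.map_congr_left fun o ho => ?_)
    obtain ⟨-, hcost⟩ := h.lt_of_reach hg.reach ho
    -- The induction hypothesis, in a form that does not depend on the kind of the message; the
    -- invariant `Good` of the next round comes from the run of `preP`.
    have hM : Matches 𝓕 lam i N ((hybrid S 𝓕 lam (i + coin.toNat)).play A R)
        (Challenger.play (respond (S.game 𝓕 lam T) 𝓕 lam coin) (adversary S pX pF pE A) R)
        ((postP S pX pF pE).out (.cons (.cons .one b.code) o.1) QMem.empty) o := by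
      intro s hs hn reply φ hφ b' replyA C σ' τ' hpre hR'
      obtain ⟨t', hg'⟩ := h.good_of_pre hg ho hs hn hφ hpre
      rw [ih hR' hg', QMem.tensor_assoc]
    rw [h.post_eq hg.inv_of_code hcost] at hM ⊢
    have hA : ¬ (Query.decode o.1.snd).IsGuess → _ :=
      Challenger.after_of_not_guess (𝒞 := hybrid S 𝓕 lam (i + coin.toNat))
        (K := (hybrid S 𝓕 lam (i + coin.toNat)).play A R) (σ := some σ)
    have hG : ∀ g, Query.decode o.1.snd = .guess g → _ := fun g =>
      Challenger.after_guess (𝒞 := hybrid S 𝓕 lam (i + coin.toNat))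
        (K := (hybrid S 𝓕 lam (i + coin.toNat)).play A R) (σ := some σ)
    cases hmsg : o.1.snd with
    | nil =>
      rw [hG false (by rw [hmsg]; rfl)]
      change (Ens.pure (.cons .nil .nil)).total _ = _
      rw [Ens.total_pure, Challenger.after_guess (b := false) rfl]
      rfl
    | cons u d =>
      rw [hmsg] at hM hA hG hcost
      rcases u with _ | ⟨_, _ | ⟨_, _ | ⟨_, _ | ⟨_, _ | ⟨_, u⟩⟩⟩⟩⟩
      · rw [hG _ rfl]
        change (Ens.pure (.cons .nil (.cons .nil d))).total _ = _
        rw [Ens.total_pure, Challenger.after_guess (b := decide (d ≠ .nil)) rfl, QMem.tensor_empty]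
      · rw [hA id]
        refine (hM.total_pure_answer hR _).trans ?_
        change _ = List.sum [_]
        rw [List.sum_singleton]
        exact (congrArg _ (QMem.tensor_empty _)).symm
      · rw [hA id]
        exact total_react_enc hS hR hM
      · rw [hA id]
        exact h.total_react_kg hDT hN hcost hR hM
      · rw [hA id]
        exact h.total_react_vrfy hDT hR hM
      · rw [hA id]
        exact total_react_chal hS hR hM

end Reduction

end KeyLeasing

/-! ### The first message and the random index -/

namespace KeyLeasing

open Data (unary binary ofList)

namespace Challenger

open Classical in
/-- The part of an experiment, from its start, in which the first message is no guess. -/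
noncomputable def later (𝒞 : Challenger) (A : Prog) (R : ℕ) (v : Data) (m : QMem) : ENNReal :=
  ((A.out v m).map fun o =>
    if (Query.decode o.1.snd).IsGuess then 0 else 𝒞.after (𝒞.play A R) none o).sum

open Classical in
/-- The part of an experiment in which the first message is a guess. -/
noncomputable def atOnce (A : Prog) (v : Data) (m : QMem) : ENNReal :=
  ((A.out v m).map fun o =>
    if Query.decode o.1.snd = .guess true then ENNReal.ofReal o.2.normSq else 0).sum

/-- A guess sent as first message never reaches the challenger. This part is common to all hybrids
and cancels in differences, so the reduction need not reproduce it and guesses `0` instead. -/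
theorem play_succ_none (𝒞 : Challenger) (A : Prog) (R : ℕ) (v : Data) (m : QMem) :
    𝒞.play A (R + 1) none v m = atOnce A v m + 𝒞.later A R v m := by
  rw [play, atOnce, later, ← List.sum_map_add]
  refine congrArg List.sum (List.map_congr_left fun o _ => ?_)
  cases hq : Query.decode o.1.snd with
  | guess b => rw [after_guess hq, if_pos (show (Query.guess b).IsGuess from trivial)]; simp
  | _ => simp [Query.IsGuess]

theorem later_mono (𝒞 : Challenger) (A : Prog) (v : Data) (m : QMem) :
    Monotone fun R => 𝒞.later A R v m := by
  intro R R' hR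
  refine List.sum_le_sum fun o _ => ?_
  split_ifs
  · exact le_rfl
  · exact after_mono (fun σ v m => play_mono 𝒞 A hR σ v m) none o

end Challenger

namespace Reduction

open Prog

variable {S : Algs} {𝓕 : FunClass} {pX pF pE A : Prog} {lam TA D N i T : ℕ} {coin : Bool}

theorem total_uniform (s : ℕ) (Φ : Data → QMem → ENNReal) : (uniform s).total Φ =
    ∑ w ∈ Finset.range (2 ^ s), Φ (unary w) (QMem.empty.scale (coinAmp s)) := by
  rw [Ens.total, uniform, List.map_map]
  rfl

theorem instances_setup_eq (hl : i < lam) (q : ℕ) : S.instances.setup lam q =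
    Ens.lists (((List.range i).map fun j => (S.atBound (2 ^ (0 + j + 1))).setup lam q) ++
      (S.atBound (2 ^ (i + 1))).setup lam q ::
        (List.range (lam - (i + 1))).map fun j =>
          (S.atBound (2 ^ (i + 1 + j + 1))).setup lam q) := by
  rw [Algs.instances_setup]
  obtain ⟨k, rfl⟩ := Nat.exists_eq_add_of_lt hl
  rw [show i + k + 1 - (i + 1) = k by omega, show i + k + 1 = i + (k + 1) by omega, List.range_add,
    List.map_append, List.range_succ_eq_map]
  simp only [List.map_cons, List.map_map, Function.comp_def, Nat.zero_add, Nat.add_zero,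
    Nat.succ_eq_add_one]
  congr 5
  funext j
  rw [show i + 1 + j + 1 = i + (j + 1) + 1 by omega]

/-- The first activation, if the challenger is put in charge of instance `i`. -/
theorem Setting.total_openAt (hS : S.Classical) (h : Setting S 𝓕 pX pF pE A lam TA D N)
    (hDT : D ≤ T) (hN : N ≤ 2 ^ lam) (R : ℕ) (hi : i < lam) {o : Data × QMem} {t d : Data}
    (ho : o ∈ A.out (.cons (unary lam) .nil) QMem.empty) (hmsg : o.1.snd = .cons t d)
    (hc : t.len = 1 ∧ 0 < d.fst.len ∧ d.snd.snd.fst ∈ 𝓕.X lam ∧ d.snd.snd.snd ∈ 𝓕.X lam)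
    (k₀ : QMem)
    (hmem : ∀ s ∈ openAt S lam o.1.fst d i, (s.1, k₀.tensor s.2) ∈
      (postP S pX pF pE).out (.cons (.cons .nil (unary lam)) o.1) QMem.empty) :
    ((openAt S lam o.1.fst d i).total fun a k =>
      Challenger.after (respond (S.game 𝓕 lam T) 𝓕 lam coin)
        (Challenger.play (respond (S.game 𝓕 lam T) 𝓕 lam coin) (adversary S pX pF pE A) R) none
          (a, o.2.tensor (k₀.tensor k))) =
    (S.instances.setup lam d.fst.len).total fun a k =>
      (hybrid S 𝓕 lam (i + coin.toNat)).play A R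
        (some ⟨a, d.fst.len, d.snd.fst.ofBinary, d.snd.snd.fst, d.snd.snd.snd, [], 0, false⟩)
        (.cons o.1.fst .nil) (o.2.tensor (k₀.tensor k)) := by
  obtain ⟨hlt, hcost⟩ := h.lt_of_reach .start ho
  have hq : d.fst.len ≤ N := by
    rw [hmsg] at hcost
    simp only [Query.decode, hc.1, Query.cost] at hcost
    omega
  have hscal : ∀ n, Ens.Scalar ((S.atBound n).setup lam d.fst.len) := fun n => hS.1.scalar_out _
  rw [instances_setup_eq hi, Ens.total_lists_split (hscal _) (Ens.scalar_lists (by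
    intro e he
    obtain ⟨j, -, rfl⟩ := List.mem_map.1 he
    exact hscal _))]
  unfold openAt at hmem ⊢
  simp only [Ens.total_bind, Ens.total_pure]
  refine Ens.total_congr fun P hP => ?_
  refine Ens.total_congr fun Q hQ => ?_
  have hlenP := (mem_setups hP).1
  have hlenQ := (mem_setups hQ).1
  generalize hb : (⟨[], 0, false, lam, d.snd.snd.fst, d.snd.snd.snd, d.fst.len, P.1.toList,
    Q.1.toList⟩ : Sim) = b
  have hs := hmem _ (Ens.mem_bind.2 ⟨P, hP, _, Ens.mem_bind.2 ⟨Q, hQ, _, List.mem_singleton.2 rfl,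
    rfl⟩, rfl⟩)
  rw [hb] at hs
  have hdec : Query.decode (opened b o.1.fst).snd =
      .start d.fst.len (2 ^ (i + 1)) d.snd.snd.fst d.snd.snd.snd := by
    rw [size_decode_opened, ← hb, ← hlenP]
  have hng : ¬ (Query.decode (opened b o.1.fst).snd).IsGuess := by rw [hdec]; exact id
  rw [Challenger.after_of_not_guess (o := (opened b o.1.fst, _)) hng]
  change ((respond (S.game 𝓕 lam T) 𝓕 lam coin none
    (Query.decode (opened b o.1.fst).snd)).map _).sum = _
  rw [hdec]
  simp only [respond]
  rw [if_pos ⟨hc.2.1, (by positivity : 0 < 2 ^ (i + 1)), hc.2.2⟩, List.map_map]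
  refine congrArg List.sum (List.map_congr_left fun r hr => ?_)
  obtain ⟨t', hg⟩ := h.good_of_pre (good_start h.lam_pos) ho hs hng (reply := .nil) (φ := r.2)
    (normSq_out_ne hr) (preP_refused _ _ _ _ _ _)
  refine Eq.trans (h.play_eq_hybrid hS hDT hN R (i := i)
    (σ := ⟨ofList (P.1.toList ++ r.1 :: Q.1.toList), d.fst.len, d.snd.fst.ofBinary,
      d.snd.snd.fst, d.snd.snd.snd, [], 0, false⟩) ?_ hg) ?_
  · subst hb
    exact
      { lam_eq := rfl
        length_pre := hlenP
        length_eq := by simp only; omega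
        msk := rfl
        n := rfl
        q_left := rfl
        q_right := rfl
        q_pos := hc.2.1
        q_le := hq
        fst_left := rfl
        fst_right := rfl
        snd_left := rfl
        snd_right := rfl
        encs_left := rfl
        encs_right := rfl
        challenged_left := rfl
        challenged_right := rfl
        keys := .nil }
  · simp only [QMem.tensor_empty, QMem.tensor_assoc]

/-- The first message of the adversary. -/
theorem Setting.total_start (hS : S.Classical) (h : Setting S 𝓕 pX pF pE A lam TA D N)
    (hDT : D ≤ T) (hN : N ≤ 2 ^ lam) (R : ℕ) {o : Data × QMem}
    (ho : o ∈ A.out (.cons (unary lam) .nil) QMem.empty)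
    (hng : ¬ (Query.decode o.1.snd).IsGuess) :
    (((postP S pX pF pE).out (.cons (.cons .nil (unary lam)) o.1) QMem.empty).total fun a k =>
      Challenger.after (respond (S.game 𝓕 lam T) 𝓕 lam coin)
        (Challenger.play (respond (S.game 𝓕 lam T) 𝓕 lam coin) (adversary S pX pF pE A) R) none
          (a, o.2.tensor k)) =
    ENNReal.ofReal ((1 / 2) ^ Nat.clog 2 lam) * ∑ i ∈ Finset.range lam,
      (hybrid S 𝓕 lam (i + coin.toNat)).after ((hybrid S 𝓕 lam (i + coin.toNat)).play A R)
        none o := by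
  obtain ⟨hlt, hcost⟩ := h.lt_of_reach .start ho
  have hpost : (postP S pX pF pE).out (.cons (.cons .nil (unary lam)) o.1) QMem.empty =
      reactStart S 𝓕 lam o.1.fst o.1.snd :=
    (postP_start_framed h.lam_pos ((Nat.le_add_left _ _).trans h.le_N) h.deciders o.1 hcost
      h.setup).computes_empty.out_eq
  have hzero : ∀ (𝒞 : Challenger) K (m : QMem), 𝒞.after K none (.cons .nil .nil, m) = 0 :=
    fun 𝒞 K m => Challenger.after_guess (b := false) rfl
  have hA : ∀ h, _ = _ := fun h => Challenger.after_of_not_guess (𝒞 := hybrid S 𝓕 lam h)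
        (K := (hybrid S 𝓕 lam h).play A R) (σ := none) hng
  cases hmsg : o.1.snd with
  | nil => rw [hmsg] at hng; exact absurd trivial hng
  | cons t d =>
    by_cases hc : t.len = 1 ∧ 0 < d.fst.len ∧ d.snd.snd.fst ∈ 𝓕.X lam ∧ d.snd.snd.snd ∈ 𝓕.X lam
    swap
    -- An inadmissible opening ends every hybrid experiment with output `0`, and the reduction
    -- guesses `0`.
    · rw [hpost, hmsg, reactStart, if_neg hc, Ens.total_pure, hzero]
      refine (Eq.trans (congrArg _ (Finset.sum_eq_zero fun i _ => ?_)) (mul_zero _)).symm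
      rw [hA, hmsg]
      simp only [Query.decode]
      split
      · rfl
      · simp only [hybrid, respond]
        rw [if_neg]
        · rfl
        · intro hc'
          exact hc ⟨‹_›, hc'.1, hc'.2.2⟩
      all_goals rfl
    · have hreact : reactStart S 𝓕 lam o.1.fst o.1.snd = (uniform (Nat.clog 2 lam)).bind fun w =>
          if w.len < lam then openAt S lam o.1.fst d w.len else Ens.pure (.cons .nil .nil) := by
        rw [hmsg, reactStart, if_pos hc]
      have hterm : ∀ i, i < lam → _ = _ := fun i hi =>
        h.total_openAt (coin := coin) hS hDT hN R hi ho hmsg hc (QMem.empty.scale (coinAmp (Nat.clog 2 lam)))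
          (by
            intro s hs
            rw [hpost, hreact]
            refine Ens.mem_bind.2 ⟨(unary i, QMem.empty.scale (coinAmp (Nat.clog 2 lam))), ?_, s, ?_,
              rfl⟩
            · exact List.mem_map.2 ⟨i, List.mem_range.2 (hi.trans_le (Nat.le_pow_clog
                (by norm_num) lam)), rfl⟩
            · rwa [if_pos (by rwa [Data.len_unary]), Data.len_unary])
      rw [hpost, hreact, Ens.total_bind, total_uniform]
      -- The indices from `lam` up to the power of two contribute zero, because there the reduction
      -- guesses `0`.
      rw [← Finset.sum_subset (Finset.range_mono (Nat.le_pow_clog (by norm_num) lam)), Finset.mul_sum]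
      · refine Finset.sum_congr rfl fun i hi => ?_
        have hi' := Finset.mem_range.1 hi
        rw [Data.len_unary, if_pos hi']
        refine (hterm i hi').trans ?_
        rw [hA, hmsg]
        simp only [Query.decode, hc.1, hybrid, respond]
        rw [if_pos ⟨hc.2.1, trivial, hc.2.2⟩, List.map_map]
        change _ = _ * Ens.total (S.instances.setup lam d.fst.len) fun a k =>
          (hybrid S 𝓕 lam (i + coin.toNat)).play A R
            (some ⟨a, d.fst.len, d.snd.fst.ofBinary, d.snd.snd.fst, d.snd.snd.snd, [], 0, false⟩)
            (.cons o.1.fst .nil) (o.2.tensor k)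
        rw [← Ens.total_mul_left]
        refine Ens.total_congr fun r _ => ?_
        rw [QMem.scale_tensor, QMem.empty_tensor, QMem.tensor_scale,
          Challenger.play_scale _ _ _ _ _ _ (coinAmp_ne_zero _), normSq_coinAmp]
      · intro w _ hw
        rw [Data.len_unary, if_neg (by simpa using hw), Ens.total_pure, hzero]

theorem Setting.play_start (hS : S.Classical) (h : Setting S 𝓕 pX pF pE A lam TA D N)
    (hDT : D ≤ T) (hN : N ≤ 2 ^ lam) (R : ℕ) :
    Challenger.play (respond (S.game 𝓕 lam T) 𝓕 lam coin) (adversary S pX pF pE A) (R + 1) none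
      (.cons (unary lam) .nil) QMem.empty =
    ENNReal.ofReal ((1 / 2) ^ Nat.clog 2 lam) * ∑ i ∈ Finset.range lam,
      (hybrid S 𝓕 lam (i + coin.toNat)).later A R (.cons (unary lam) .nil) QMem.empty := by
  have hsum : ∀ (l : List (Data × QMem)) (g : ℕ → Data × QMem → ENNReal),
      ∑ i ∈ Finset.range lam, (l.map (g i)).sum =
        (l.map fun o => ∑ i ∈ Finset.range lam, g i o).sum := by
    intro l g
    induction l with
    | nil => simp
    | cons o l ih => simp [Finset.sum_add_distrib, ih]
  rw [h.play_adversary (good_start h.lam_pos)]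
  unfold Challenger.later
  rw [hsum, ← List.sum_map_mul_left]
  refine congrArg List.sum (List.map_congr_left fun o ho => ?_)
  obtain ⟨hlt, hcost⟩ := h.lt_of_reach .start ho
  by_cases hg : (Query.decode o.1.snd).IsGuess
  · simp only [if_pos hg, Finset.sum_const_zero, mul_zero]
    have hp := (postP_start_framed h.lam_pos ((Nat.le_add_left _ _).trans h.le_N) h.deciders o.1
      hcost h.setup).computes_empty.out_eq
    rw [hp]
    refine List.sum_eq_zero fun x hx => ?_
    obtain ⟨s, hs, rfl⟩ := List.mem_map.1 hx
    have := isGuess_start hg hs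
    rw [this]
    exact Challenger.after_guess (b := false) rfl
  · simp only [if_neg hg]
    exact h.total_start hS hDT hN R ho hg

end Reduction

end KeyLeasing

/-! ### The advantage of the reduction -/

namespace KeyLeasing

open Data (unary binary ofList)

namespace Reduction

open Prog

variable {S : Algs} {𝓕 : FunClass} {pX pF pE A : Prog} {lam TA D N T : ℕ}

theorem prExp_eq (G : Game) (A : Prog) (coin : Bool) : prExp G 𝓕 A lam coin =
    ⨆ R : ℕ, Challenger.play (respond G 𝓕 lam coin) A (R + 1) none (.cons (unary lam) .nil)
      QMem.empty := by
  rw [prExp]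
  simp only [play_eq]
  exact (Monotone.iSup_nat_add (fun R R' h => Challenger.play_mono (respond G 𝓕 lam coin) A h none
    (.cons (unary lam) .nil) QMem.empty) 1).symm

/-- The limit of the part of a hybrid experiment in which the first message is no guess. -/
noncomputable def laterInf (S : Algs) (𝓕 : FunClass) (A : Prog) (lam h : ℕ) : ENNReal :=
  ⨆ R : ℕ, (hybrid S 𝓕 lam h).later A R (.cons (unary lam) .nil) QMem.empty

theorem play_hybrid_le (h R : ℕ) : (hybrid S 𝓕 lam h).play A R none (.cons (unary lam) .nil)
    QMem.empty ≤ 1 := by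
  refine (Challenger.play_le (hybrid_bounded S 𝓕 lam h) A R _ _ _).trans ?_
  simp [QMem.normSq_empty]

theorem laterInf_ne_top (h : ℕ) : laterInf S 𝓕 A lam h ≠ ⊤ := by
  refine ne_top_of_le_ne_top ENNReal.one_ne_top (iSup_le fun R => ?_)
  refine le_trans ?_ (play_hybrid_le (S := S) (𝓕 := 𝓕) (A := A) (lam := lam) h (R + 1))
  rw [Challenger.play_succ_none]
  exact le_add_self

theorem atOnce_ne_top : Challenger.atOnce A (.cons (unary lam) .nil) QMem.empty ≠ ⊤ := by
  refine ne_top_of_le_ne_top ENNReal.one_ne_top ?_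
  -- `atOnce` involves neither scheme nor function class, so any choice gives the bound.
  refine le_trans ?_ (play_hybrid_le (S := ⟨.id, .id, .id, .id, .id, .id⟩)
    (𝓕 := ⟨fun _ => ∅, fun _ => ∅, fun _ f _ => f⟩) (A := A) (lam := lam) 0 1)
  rw [Challenger.play_succ_none]
  exact le_self_add

theorem iSup_hybrid (h : ℕ) : ⨆ R : ℕ, (hybrid S 𝓕 lam h).play A (R + 1) none
    (.cons (unary lam) .nil) QMem.empty =
      Challenger.atOnce A (.cons (unary lam) .nil) QMem.empty + laterInf S 𝓕 A lam h := by
  simp only [Challenger.play_succ_none]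
  rw [laterInf, ENNReal.add_iSup]

/-- The identity holds for every number of rounds. The supremum passes through the finite sum
because all summands are monotone in this number. -/
theorem Setting.prExp_adversary (hS : S.Classical) (h : Setting S 𝓕 pX pF pE A lam TA D N)
    (hDT : D ≤ T) (hN : N ≤ 2 ^ lam) (coin : Bool) :
    prExp (S.game 𝓕 lam T) 𝓕 (adversary S pX pF pE A) lam coin =
      ENNReal.ofReal ((1 / 2) ^ Nat.clog 2 lam) *
        ∑ i ∈ Finset.range lam, laterInf S 𝓕 A lam (i + coin.toNat) := by
  rw [prExp_eq]
  simp only [h.play_start hS hDT hN]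
  rw [← ENNReal.mul_iSup]
  congr 1
  exact (ENNReal.finsetSum_iSup_of_monotone fun i => Challenger.later_mono _ A _ _).symm

/-- The advantage of the reduction. -/
theorem Setting.adv_adversary (hS : S.Classical) (h : Setting S 𝓕 pX pF pE A lam TA D N)
    (hDT : D ≤ T) (hN : N ≤ 2 ^ lam) :
    KeyLeasing.adv (S.game 𝓕 lam T) 𝓕 (adversary S pX pF pE A) lam =
      (1 / 2) ^ Nat.clog 2 lam * KeyLeasing.adv S.instances.game 𝓕 A lam := by
  have hc : (0 : ℝ) ≤ (1 / 2) ^ Nat.clog 2 lam := by positivity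
  rw [KeyLeasing.adv, KeyLeasing.adv, h.prExp_adversary hS hDT hN, h.prExp_adversary hS hDT hN, prExp_eq, prExp_eq,
    ← hybrid_zero S 𝓕 h.lam_pos, ← hybrid_lam, iSup_hybrid, iSup_hybrid,
    ENNReal.toReal_add atOnce_ne_top (laterInf_ne_top _),
    ENNReal.toReal_add atOnce_ne_top (laterInf_ne_top _), ENNReal.toReal_mul, ENNReal.toReal_mul,
    ENNReal.toReal_ofReal hc, ENNReal.toReal_sum fun _ _ => laterInf_ne_top _,
    ENNReal.toReal_sum fun _ _ => laterInf_ne_top _, ← mul_sub, abs_mul, abs_of_nonneg hc,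
    ← Finset.sum_sub_distrib]
  -- The differences of neighbouring hybrids telescope inside the absolute value. No single good
  -- index has to exist, and no signs have to agree.
  have := Finset.sum_range_sub' (fun i => (laterInf S 𝓕 A lam i).toReal) lam
  simp only [Bool.toNat_false, Bool.toNat_true, Nat.add_zero]
  rw [this]
  congr 2
  ring

theorem _root_.KeyLeasing.PolyBdd.eventually_le_two_pow {f : ℕ → ℕ} (hf : PolyBdd f) :
    ∀ᶠ lam in Filter.atTop, f lam ≤ 2 ^ lam := by
  obtain ⟨k, hk⟩ := hf
  -- One power more than in the bound for `f` absorbs the coefficient `k`, once the argument is at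
  -- least `k`.
  have h := (isLittleO_pow_const_const_pow_of_one_lt (R := ℝ) (k + 1)
    (r := 2) (by norm_num)).bound one_pos
  filter_upwards [h, Filter.eventually_ge_atTop (k + 1)] with n hn hk'
  have h1 : n ^ (k + 1) ≤ 2 ^ n := by
    have : ((n : ℝ) ^ (k + 1)) ≤ 2 ^ n := by
      simpa [abs_of_nonneg] using hn
    exact_mod_cast this
  calc f n ≤ k * n ^ k := hk n (by omega)
    _ ≤ n * n ^ k := Nat.mul_le_mul_right _ (by omega)
    _ = n ^ (k + 1) := by ring
    _ ≤ 2 ^ n := h1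

end Reduction

/-- Security of the construction. -/
theorem Algs.instances_secure {S : Algs} {𝓕 : FunClass} (h𝓕 : 𝓕.Efficient)
    (hS : S.IsStaticScheme 𝓕) (hsec : S.SelectivelyStrongLessorSecure 𝓕) :
    S.instances.SelectivelyLessorSecure 𝓕 := by
  intro A hA
  obtain ⟨pX, pF, pE, c, hD⟩ := h𝓕.exists_deciders
  obtain ⟨cS, hT⟩ := hS.exists_times
  obtain ⟨TA, D, N, hTA, hD', hN, hset⟩ := Reduction.exists_setting hD hT hA
  obtain ⟨cT, hcT⟩ := hD'.exists_poly
  -- The time allowed to the static oracles is chosen as a polynomial above `D`, so they are open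
  -- whenever the reduction needs them.
  have hB := hsec _ cT (Reduction.qpt_adversary hTA hD' hN hset)
  have h2 : Negligible fun lam : ℕ => 2 * ((lam : ℝ) *
      adv (S.game 𝓕 lam (poly cT lam)) 𝓕 (Reduction.adversary S pX pF pE A) lam) :=
    (Asymptotics.SuperpolynomialDecay.param_mul hB).const_mul 2
  refine h2.trans_eventually_abs_le ?_
  -- Negligibility concerns large `lam` only, so it does no harm that small `lam`, for which a
  -- requested bound may exceed `2 ^ lam`, are left out.
  filter_upwards [hN.eventually_le_two_pow, Filter.eventually_gt_atTop 0] with lam hlam hpos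
  simp only [Function.comp_apply]
  rw [(hset lam hpos).adv_adversary hS.1 (hcT lam hpos) hlam]
  have h0 : 0 ≤ adv S.instances.game 𝓕 A lam := abs_nonneg _
  have h3 : (2 : ℝ) ^ Nat.clog 2 lam ≤ 2 * lam := by
    exact_mod_cast Reduction.two_pow_clog_le hpos
  -- Rounding `lam` up to a power of two loses less than a factor of two, so the probability of each
  -- index is at least `1 / (2 * lam)`.
  have h4 : (1 : ℝ) ≤ 2 * lam * (1 / 2) ^ Nat.clog 2 lam := by
    rw [one_div, inv_pow, ← div_eq_mul_inv, le_div_iff₀ (by positivity), one_mul]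
    exact h3
  rw [abs_of_nonneg h0]
  refine le_trans ?_ (le_abs_self _)
  calc adv S.instances.game 𝓕 A lam = 1 * adv S.instances.game 𝓕 A lam := (one_mul _).symm
    _ ≤ (2 * lam * (1 / 2) ^ Nat.clog 2 lam) * adv S.instances.game 𝓕 A lam := by gcongr
    _ = _ := by ring

end KeyLeasing

theorem mainTheorem6 (𝓕 : KeyLeasing.FunClass) (h𝓕 : 𝓕.Efficient) (S : KeyLeasing.Algs)
    (hS : S.IsStaticScheme 𝓕) (hsec : S.SelectivelyStrongLessorSecure 𝓕) :
    S.instances.IsScheme 𝓕 ∧ S.instances.SelectivelyLessorSecure 𝓕 :=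
  ⟨KeyLeasing.Algs.instances_isScheme hS, KeyLeasing.Algs.instances_secure h𝓕 hS hsec⟩
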